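/- Let $p\ge 3$, $n\ge 1$, and let $X\sim N_p(\theta,\sigma^2I_p)$ and $Z\sim N_n(0,\sigma^2I_n)$ be independent, with $\theta\in\mathbb R^p$ and $\sigma^2>0$ both unknown. Consider estimation of $\theta$ under the loss $L(d,\theta,\sigma^2)=\|d-\theta\|^2/\sigma^2$; an estimator (a measurable function of $(X,Z)$) is minimax if its maximal risk over all $(\theta,\sigma^2)$ is the smallest among all estimators. Put $\eta=1/\sigma^2$ and, for real $a,b,e$, consider the (possibly improper) hierarchical prior $$\theta\mid\eta,\lambda\sim N_p\big(0,\eta^{-1}(1-\lambda)\lambda^{-1}I_p\big),\qquad \eta\sim\eta^{e}\ \text{on }(0,\infty),\qquad \lambda\sim\lambda^{a}(1-\lambda)^{b}\ \text{on }(0,1).$$ A generalized Bayes estimator is one that, for almost every data point, has a proper posterior and minimizes the posterior expected loss (with finite minimum). Let $S=\|Z\|^2$, $W=\|X\|^2/S$, and for $w>0$ $$\phi(w)=w\,\frac{\int_0^1\lambda^{p/2+a+1}(1-\lambda)^b(1+w\lambda)^{-p/2-n/2-e-2}\,d\lambda}{\int_0^1\lambda^{p/2+a}(1-\lambda)^b(1+w\lambda)^{-p/2-n/2-e-2}\,d\lambda}.$$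 Let $c(p,n)=2(p-2)/(n+2)$ and $\alpha=(p/2+a+1)/(n/2+e-a)$. Suppose $e>-p/2-n/2-1$. (i) If $$-\frac p2-1<a\le\frac{c(p,n)(n/2+e)-p/2-1}{1+c(p,n)}\quad\text{and}\quad b\ge\min(n/2+e-a-1,\,0),$$ then the estimator $(1-\phi(W)/W)X$ is generalized Bayes with respect to the prior, every generalized Bayes estimator is almost everywhere equal to it and is minimax, and $\phi$ is monotone nondecreasing on $(0,\infty)$. (ii) If $$-\frac p2-1<a<\frac{c(p,n)(n/2+e)-p/2-1}{1+c(p,n)}\quad\text{and}\quad -(n+2)\frac{c(p,n)-\alpha}{4(p+a+1)(\alpha+1)}\le b<\min(0,\,n/2+e-a-1),$$ then the lower bound for $b$ here is greater than $-1$, the estimator $(1-\phi(W)/W)X$ is generalized Bayes with respect to the prior, every generalized Bayes estimator is almost everywhere equal to it and is minimax, $\lim_{w\to\infty}\phi(w)=\alpha$, and $\phi$ is not monotone on $(0,\infty)$ (neither nondecreasing nor nonincreasing). -/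

import Mathlib

open MeasureTheory

noncomputable section

namespace GenBayes

/-- The density at `x` of the normal distribution `N_d(0, v I_d)` with respect to Lebesgue measure
on `ℝ^d` (used for `v > 0`). -/
def isoNormalPDF (d : ℕ) (v : ℝ) (x : EuclideanSpace ℝ (Fin d)) : ℝ :=
  (2 * Real.pi * v) ^ (-(d : ℝ) / 2) * Real.exp (-‖x‖ ^ 2 / (2 * v))

/-- The joint density at `y = (x, z)` of independent `X ∼ N_p(θ, v I_p)` and `Z ∼ N_n(0, v I_n)`,
where `v = σ²`. -/
def likelihood (p n : ℕ) (θ : EuclideanSpace ℝ (Fin p)) (v : ℝ)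
    (y : EuclideanSpace ℝ (Fin p) × EuclideanSpace ℝ (Fin n)) : ℝ :=
  isoNormalPDF p v (y.1 - θ) * isoNormalPDF n v y.2

/-- The sampling distribution of `(X, Z)`. -/
def model (p n : ℕ) (θ : EuclideanSpace ℝ (Fin p)) (v : ℝ) :
    Measure (EuclideanSpace ℝ (Fin p) × EuclideanSpace ℝ (Fin n)) :=
  volume.withDensity fun y => ENNReal.ofReal (likelihood p n θ v y)

/-- The scale invariant quadratic loss `‖d - θ‖² / σ²`, where `v = σ²`. -/
def loss {p : ℕ} (θ : EuclideanSpace ℝ (Fin p)) (v : ℝ) (d : EuclideanSpace ℝ (Fin p)) : ENNReal :=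
  ENNReal.ofReal (‖d - θ‖ ^ 2 / v)

/-- The risk of the estimator `δ` at `(θ, σ²)`, where `v = σ²`; it may be infinite. -/
def risk {p n : ℕ}
    (δ : EuclideanSpace ℝ (Fin p) × EuclideanSpace ℝ (Fin n) → EuclideanSpace ℝ (Fin p))
    (θ : EuclideanSpace ℝ (Fin p)) (v : ℝ) : ENNReal :=
  ∫⁻ y, loss θ v (δ y) ∂(model p n θ v)

/-- The maximal risk over all `θ ∈ ℝ^p` and `σ² > 0`. -/
def maxRisk {p n : ℕ}
    (δ : EuclideanSpace ℝ (Fin p) × EuclideanSpace ℝ (Fin n) → EuclideanSpace ℝ (Fin p)) :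
    ENNReal :=
  ⨆ (θ : EuclideanSpace ℝ (Fin p)) (v : ℝ) (_ : 0 < v), risk δ θ v

/-- `δ` is minimax: its maximal risk is the smallest one among all estimators
(measurable functions of the data). -/
def IsMinimax {p n : ℕ}
    (δ : EuclideanSpace ℝ (Fin p) × EuclideanSpace ℝ (Fin n) → EuclideanSpace ℝ (Fin p)) : Prop :=
  Measurable δ ∧
    ∀ δ' : EuclideanSpace ℝ (Fin p) × EuclideanSpace ℝ (Fin n) → EuclideanSpace ℝ (Fin p),
      Measurable δ' → maxRisk δ ≤ maxRisk δ'

/-- The marginal density of the data at `y` under a (possibly improper) prior on `(θ, η)`,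
where `η = 1 / σ²`. -/
def marginal {p n : ℕ} (π : Measure (EuclideanSpace ℝ (Fin p) × ℝ))
    (y : EuclideanSpace ℝ (Fin p) × EuclideanSpace ℝ (Fin n)) : ENNReal :=
  ∫⁻ t, ENNReal.ofReal (likelihood p n t.1 t.2⁻¹ y) ∂π

/-- The posterior distribution of `(θ, η)` given the data `y`; it is a probability measure
when `marginal π y` is neither `0` nor infinite. -/
def posterior {p n : ℕ} (π : Measure (EuclideanSpace ℝ (Fin p) × ℝ))
    (y : EuclideanSpace ℝ (Fin p) × EuclideanSpace ℝ (Fin n)) :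
    Measure (EuclideanSpace ℝ (Fin p) × ℝ) :=
  (marginal π y)⁻¹ • π.withDensity fun t => ENNReal.ofReal (likelihood p n t.1 t.2⁻¹ y)

/-- The posterior expected loss of the action `d` given the data `y`. -/
def posteriorLoss {p n : ℕ} (π : Measure (EuclideanSpace ℝ (Fin p) × ℝ))
    (y : EuclideanSpace ℝ (Fin p) × EuclideanSpace ℝ (Fin n)) (d : EuclideanSpace ℝ (Fin p)) :
    ENNReal :=
  ∫⁻ t, loss t.1 t.2⁻¹ d ∂(posterior π y)

/-- `δ` is a generalized Bayes estimator with respect to the (possibly improper) prior `π` on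
`(θ, η)`: for almost every data point the posterior is proper, and `δ` minimizes the posterior
expected loss, the minimum being finite. -/
def IsGeneralizedBayes {p n : ℕ} (π : Measure (EuclideanSpace ℝ (Fin p) × ℝ))
    (δ : EuclideanSpace ℝ (Fin p) × EuclideanSpace ℝ (Fin n) → EuclideanSpace ℝ (Fin p)) : Prop :=
  Measurable δ ∧
    ∀ᵐ y : EuclideanSpace ℝ (Fin p) × EuclideanSpace ℝ (Fin n) ∂volume,
      marginal π y ≠ 0 ∧ marginal π y ≠ ⊤ ∧ posteriorLoss π y (δ y) ≠ ⊤ ∧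
        ∀ d : EuclideanSpace ℝ (Fin p), posteriorLoss π y (δ y) ≤ posteriorLoss π y d

/-- The joint hierarchical prior of `(θ, η, λ)`, on `ℝ^p × (0, ∞) × (0, 1)`:
`θ | η, λ ∼ N_p(0, η⁻¹ (1 - λ) λ⁻¹ I_p)`, `η` has density `η ^ e`, and `λ` has density
`λ ^ a (1 - λ) ^ b`. -/
def jointPrior (p : ℕ) (a b e : ℝ) : Measure (EuclideanSpace ℝ (Fin p) × ℝ × ℝ) :=
  (volume.restrict (Set.univ ×ˢ Set.Ioi (0 : ℝ) ×ˢ Set.Ioo (0 : ℝ) 1)).withDensity fun t =>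
    ENNReal.ofReal (isoNormalPDF p (t.2.1⁻¹ * (1 - t.2.2) * t.2.2⁻¹) t.1 *
      t.2.1 ^ e * (t.2.2 ^ a * (1 - t.2.2) ^ b))

/-- The prior of the parameter `(θ, η)` that results from the hierarchical prior. -/
def prior (p : ℕ) (a b e : ℝ) : Measure (EuclideanSpace ℝ (Fin p) × ℝ) :=
  (jointPrior p a b e).map fun t => (t.1, t.2.1)

/-- The shrinkage function `φ(w)`, for `w > 0`: a ratio of two integrals over `λ ∈ (0, 1)`. -/
def phi (p n : ℕ) (a b e w : ℝ) : ℝ :=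
  w * (∫ t in Set.Ioo (0 : ℝ) 1, t ^ ((p : ℝ) / 2 + a + 1) * (1 - t) ^ b *
        (1 + w * t) ^ (-(p : ℝ) / 2 - (n : ℝ) / 2 - e - 2)) /
    ∫ t in Set.Ioo (0 : ℝ) 1, t ^ ((p : ℝ) / 2 + a) * (1 - t) ^ b *
        (1 + w * t) ^ (-(p : ℝ) / 2 - (n : ℝ) / 2 - e - 2)

/-- The estimator `(1 - f(W) / W) X` with `W = ‖X‖² / S` and `S = ‖Z‖²`. -/
def shrinkageEstimator (p n : ℕ) (f : ℝ → ℝ)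
    (y : EuclideanSpace ℝ (Fin p) × EuclideanSpace ℝ (Fin n)) : EuclideanSpace ℝ (Fin p) :=
  (1 - f (‖y.1‖ ^ 2 / ‖y.2‖ ^ 2) / (‖y.1‖ ^ 2 / ‖y.2‖ ^ 2)) • y.1

/-- The constant `c(p, n) = 2 (p - 2) / (n + 2)`. -/
def cBound (p n : ℕ) : ℝ := 2 * ((p : ℝ) - 2) / ((n : ℝ) + 2)

/-- The constant `α = (p/2 + a + 1) / (n/2 + e - a)`. -/
def alpha (p n : ℕ) (a e : ℝ) : ℝ := ((p : ℝ) / 2 + a + 1) / ((n : ℝ) / 2 + e - a)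

end GenBayes

end

namespace GenBayes

open Set Filter Topology

/-! Put A = p/2 + a and N = p/2 + n/2 + e + 2. Then φ(w) = w E[λ] for the density proportional to
λ^A (1-λ)^b (1+wλ)^(-N); this is `hyperPhi`, and N - 2 - A = n/2 + e - a is the denominator of α.

Bayes property. Given η and λ, the posterior of θ is N((1-λ)x, (1-λ)/η). Integrating out θ
(Gaussian) and η (Gamma) leaves a posterior loss Q + c‖d - (1 - E[λ])x‖² with c > 0
(`posteriorLoss_prior`), so for z ≠ 0 the minimizer exists and is unique.

Minimaxity. The priors θ ∼ N(0, τ I) with σ² = 1 and τ → ∞ show that no estimator has maximal risk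
below p (`le_maxRisk`). Stein's identity, used once in X and once in Z, shows that the risk is at
most p as soon as φ((n+2)φ - 2(p-2)) ≤ 4wφ'(1+φ) (`risk_shrinkage_le`, `isMinimax_of_ae_eq`).

What remains is the analysis of φ. Integration by parts in λ yields a recurrence between the orders
A and A+1 and a Riccati equation for φ, and the recurrence gives φ → α (`tendsto_hyperPhi`). In (i),
φ is nondecreasing (`monotoneOn_hyperPhi`), hence φ ≤ α ≤ c, and the two sides of the inequality
have opposite signs. In (ii), the Riccati equation gives φ' ≥ 0 where φ ≤ α. Where φ ≥ α, a barrier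
argument bounds φ from above (`hyperPhi_le_barrier`), and the same barrier at (A+1, N+1) bounds
wφ'/φ from below (`le_mul_deriv_hyperPhi`); the lower bound on b is exactly what makes these two
estimates combine (`minimax_condition_of_neg`). If φ were monotone, then φ ≤ α would force a bound
on `hyperPhi b A (N - 1)` that contradicts its behaviour at infinity (`not_monotoneOn_hyperPhi`). -/

/-! ### Integrals over λ: positivity, derivative in w, integration by parts. -/

/-- The integral `∫ λ ^ A (1 - λ) ^ b (1 + w λ) ^ (-N)` over the unit interval. -/
noncomputable def hyperInt (b A N w : ℝ) : ℝ :=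
  ∫ t in Ioo (0 : ℝ) 1, t ^ A * (1 - t) ^ b * (1 + w * t) ^ (-N)

/-- The mean of `λ` under the density proportional to `λ ^ A (1 - λ) ^ b (1 + w λ) ^ (-N)`. -/
noncomputable def hyperMean (b A N w : ℝ) : ℝ := hyperInt b (A + 1) N w / hyperInt b A N w

/-- The range w > -1, rather than w ≥ 0, makes w = 0 an interior point, so that two-sided
derivatives at 0 are available later. -/
theorem one_add_mul_pos {w t : ℝ} (hw : -1 < w) (ht : t ∈ Icc (0 : ℝ) 1) : 0 < 1 + w * t := by
  obtain ⟨h0, h1⟩ := ht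
  rcases h1.lt_or_eq with h | rfl
  · nlinarith [mul_nonneg h0 (show 0 ≤ 1 + w by linarith)]
  · linarith

theorem integrableOn_betaWeight {A b : ℝ} (hA : -1 < A) (hb : -1 < b) :
    IntegrableOn (fun t : ℝ => t ^ A * (1 - t) ^ b) (Ioo 0 1) := by
  have h := Complex.betaIntegral_convergent (u := (A + 1 : ℝ)) (v := (b + 1 : ℝ))
    (by simp; linarith) (by simp; linarith)
  rw [intervalIntegrable_iff_integrableOn_Ioo_of_le zero_le_one] at h
  have h' : IntegrableOn _ (Ioo (0 : ℝ) 1) := h.re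
  refine h'.congr_fun (fun t ht => ?_) measurableSet_Ioo
  have h1 : (0 : ℝ) ≤ t := ht.1.le
  have h2 : (0 : ℝ) ≤ 1 - t := by linarith [ht.2]
  have e1 : ((t : ℂ) ^ (((A + 1 : ℝ) : ℂ) - 1)) = ((t ^ A : ℝ) : ℂ) := by
    rw [Complex.ofReal_cpow h1]; push_cast; ring_nf
  have e2 : ((1 - (t : ℂ)) ^ (((b + 1 : ℝ) : ℂ) - 1)) = (((1 - t) ^ b : ℝ) : ℂ) := by
    rw [Complex.ofReal_cpow h2]; push_cast; ring_nf
  simp only [e1, e2]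
  rw [← Complex.ofReal_mul]
  exact Complex.ofReal_re _

theorem continuousOn_one_add_mul_rpow (N : ℝ) :
    ContinuousOn (fun q : ℝ × ℝ => (1 + q.1 * q.2) ^ (-N)) (Ioi (-1) ×ˢ Icc 0 1) := by
  refine ContinuousOn.rpow_const (by fun_prop) ?_
  rintro ⟨w, t⟩ ⟨hw, ht⟩
  exact Or.inl (one_add_mul_pos hw ht).ne'

theorem continuousOn_hyperWeight (b A N w : ℝ) (hw : -1 < w) :
    ContinuousOn (fun t : ℝ => t ^ A * (1 - t) ^ b * (1 + w * t) ^ (-N)) (Ioo 0 1) := by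
  intro t ht
  have h1 := one_add_mul_pos hw ⟨ht.1.le, ht.2.le⟩
  have h2 : 1 - t ≠ 0 := by linarith [ht.2]
  apply ContinuousAt.continuousWithinAt
  exact ((continuousAt_id.rpow_const (Or.inl ht.1.ne')).mul
    ((continuousAt_const.sub continuousAt_id).rpow_const (Or.inl h2))).mul
    ((continuousAt_const.add (continuousAt_const.mul continuousAt_id)).rpow_const (Or.inl h1.ne'))

/-- A bound for `(1 + w λ) ^ (-N)` that is locally uniform in `w`. -/
theorem exists_bound_one_add_mul_rpow (N : ℝ) {w : ℝ} (hw : -1 < w) :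
    ∃ C : ℝ, ∃ s ∈ 𝓝 w, s ⊆ Ioi (-1) ∧ ∀ x ∈ s, ∀ t ∈ Icc (0 : ℝ) 1, |(1 + x * t) ^ (-N)| ≤ C := by
  have hcpt : IsCompact (Icc ((w - 1) / 2) (w + 1) ×ˢ Icc (0 : ℝ) 1) :=
    isCompact_Icc.prod isCompact_Icc
  have hsub : Icc ((w - 1) / 2) (w + 1) ⊆ Ioi (-1) := fun x hx => by
    have := hx.1
    simp only [mem_Ioi]
    linarith
  obtain ⟨C, hC⟩ := hcpt.exists_bound_of_continuousOn
    ((continuousOn_one_add_mul_rpow N).mono (prod_mono hsub le_rfl))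
  exact ⟨C, _, Icc_mem_nhds (by linarith) (by linarith), hsub, fun x hx t ht => hC (x, t) ⟨hx, ht⟩⟩

theorem integrableOn_hyperWeight {b A : ℝ} (hA : -1 < A) (hb : -1 < b) (N : ℝ) {w : ℝ}
    (hw : -1 < w) :
    IntegrableOn (fun t : ℝ => t ^ A * (1 - t) ^ b * (1 + w * t) ^ (-N)) (Ioo 0 1) := by
  obtain ⟨C, s, hs, -, hC⟩ := exists_bound_one_add_mul_rpow N hw
  refine ((integrableOn_betaWeight hA hb).mul_const C).mono'
    ((continuousOn_hyperWeight b A N w hw).aestronglyMeasurable measurableSet_Ioo) ?_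
  filter_upwards [ae_restrict_mem measurableSet_Ioo] with t ht
  have h1 : 0 ≤ t ^ A * (1 - t) ^ b :=
    mul_nonneg (Real.rpow_nonneg ht.1.le _) (Real.rpow_nonneg (by linarith [ht.2]) _)
  rw [Real.norm_eq_abs, abs_mul, abs_of_nonneg h1]
  exact mul_le_mul_of_nonneg_left (hC w (mem_of_mem_nhds hs) t ⟨ht.1.le, ht.2.le⟩) h1

theorem hyperWeight_pos (b A N : ℝ) {w t : ℝ} (hw : -1 < w) (ht : t ∈ Ioo (0 : ℝ) 1) :
    0 < t ^ A * (1 - t) ^ b * (1 + w * t) ^ (-N) := by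
  have h1 := one_add_mul_pos hw ⟨ht.1.le, ht.2.le⟩
  have h2 : 0 < 1 - t := by linarith [ht.2]
  have h3 := ht.1
  positivity

theorem hyperInt_pos {b A : ℝ} (hA : -1 < A) (hb : -1 < b) (N : ℝ) {w : ℝ} (hw : -1 < w) :
    0 < hyperInt b A N w := by
  unfold hyperInt
  rw [setIntegral_pos_iff_support_of_nonneg_ae]
  · refine lt_of_lt_of_le ?_ (measure_mono (s := Ioo (0 : ℝ) 1) ?_)
    · simp
    · exact fun t ht => ⟨(hyperWeight_pos b A N hw ht).ne', ht⟩
  · filter_upwards [ae_restrict_mem measurableSet_Ioo] with t ht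
    exact (hyperWeight_pos b A N hw ht).le
  · exact integrableOn_hyperWeight hA hb N hw

/-- Raising the exponent of `λ` lowers the integral. -/
theorem hyperInt_lt {b A A' : ℝ} (hA : -1 < A) (hA' : A < A') (hb : -1 < b) (N : ℝ) {w : ℝ}
    (hw : -1 < w) : hyperInt b A' N w < hyperInt b A N w := by
  rw [← sub_pos]
  unfold hyperInt
  rw [← integral_sub (integrableOn_hyperWeight hA hb N hw)
    (integrableOn_hyperWeight (hA.trans hA') hb N hw)]
  have key : ∀ t ∈ Ioo (0 : ℝ) 1, 0 < t ^ A * (1 - t) ^ b * (1 + w * t) ^ (-N) -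
      t ^ A' * (1 - t) ^ b * (1 + w * t) ^ (-N) := by
    intro t ht
    have h := hyperWeight_pos b 0 N hw ht
    have h' := Real.rpow_lt_rpow_of_exponent_gt ht.1 ht.2 hA'
    rw [Real.rpow_zero, one_mul] at h
    nlinarith
  rw [setIntegral_pos_iff_support_of_nonneg_ae]
  · refine lt_of_lt_of_le ?_ (measure_mono (s := Ioo (0 : ℝ) 1) ?_)
    · simp
    · exact fun t ht => ⟨(key t ht).ne', ht⟩
  · filter_upwards [ae_restrict_mem measurableSet_Ioo] with t ht
    exact (key t ht).le
  · exact (integrableOn_hyperWeight hA hb N hw).sub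
      (integrableOn_hyperWeight (hA.trans hA') hb N hw)

/-- Splitting off a factor `1 + w λ`. -/
theorem hyperInt_split {b A : ℝ} (hA : -1 < A) (hb : -1 < b) (N : ℝ) {w : ℝ} (hw : -1 < w) :
    hyperInt b A N w = hyperInt b A (N + 1) w + w * hyperInt b (A + 1) (N + 1) w := by
  unfold hyperInt
  rw [← integral_const_mul, ← integral_add (integrableOn_hyperWeight hA hb _ hw)
    ((integrableOn_hyperWeight (by linarith) hb _ hw).const_mul w)]
  refine setIntegral_congr_fun measurableSet_Ioo fun t ht => ?_
  have h1 := one_add_mul_pos hw ⟨ht.1.le, ht.2.le⟩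
  have e1 : (1 + w * t) ^ (-N) = (1 + w * t) ^ (-(N + 1)) * (1 + w * t) := by
    rw [← Real.rpow_add_one h1.ne']; ring_nf
  have e2 : t ^ (A + 1) = t ^ A * t := Real.rpow_add_one ht.1.ne' A
  simp only [e1, e2]
  ring

theorem hasDerivAt_hyperInt {b A : ℝ} (hA : -1 < A) (hb : -1 < b) (N : ℝ) {w : ℝ} (hw : -1 < w) :
    HasDerivAt (hyperInt b A N) (-N * hyperInt b (A + 1) (N + 1) w) w := by
  obtain ⟨C, s, hs, hs1, hC⟩ := exists_bound_one_add_mul_rpow (N + 1) hw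
  have h := hasDerivAt_integral_of_dominated_loc_of_deriv_le (μ := volume.restrict (Ioo (0 : ℝ) 1))
    (F := fun x t => t ^ A * (1 - t) ^ b * (1 + x * t) ^ (-N))
    (F' := fun x t => -N * (t ^ (A + 1) * (1 - t) ^ b * (1 + x * t) ^ (-(N + 1))))
    (bound := fun t => |N| * (t ^ A * (1 - t) ^ b * C)) hs ?_
    (integrableOn_hyperWeight hA hb N hw) ?_ ?_ ?_ ?_
  · exact h.2.congr_deriv (integral_const_mul _ _)
  · filter_upwards [lt_mem_nhds hw] with x hx
    exact (continuousOn_hyperWeight b A N x hx).aestronglyMeasurable measurableSet_Ioo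
  · exact (continuousOn_const.mul
      (continuousOn_hyperWeight b (A + 1) (N + 1) w hw)).aestronglyMeasurable measurableSet_Ioo
  · filter_upwards [ae_restrict_mem measurableSet_Ioo] with t ht x hx
    have h1 : 0 ≤ (1 - t) ^ b := Real.rpow_nonneg (by linarith [ht.2]) _
    have h2 : 0 ≤ t ^ (A + 1) := Real.rpow_nonneg ht.1.le _
    have h3 : t ^ (A + 1) ≤ t ^ A := Real.rpow_le_rpow_of_exponent_ge ht.1 ht.2.le (by linarith)
    rw [norm_mul, norm_neg, Real.norm_eq_abs, Real.norm_eq_abs, abs_mul,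
      abs_of_nonneg (mul_nonneg h2 h1)]
    refine mul_le_mul_of_nonneg_left ?_ (abs_nonneg N)
    exact mul_le_mul (mul_le_mul_of_nonneg_right h3 h1) (hC x hx t ⟨ht.1.le, ht.2.le⟩)
      (abs_nonneg _) (mul_nonneg (h2.trans h3) h1)
  · exact (((integrableOn_betaWeight hA hb).mul_const C).const_mul |N|)
  · filter_upwards [ae_restrict_mem measurableSet_Ioo] with t ht x hx
    have h1 := one_add_mul_pos (hs1 hx) ⟨ht.1.le, ht.2.le⟩
    have h2 : HasDerivAt (fun y : ℝ => 1 + y * t) t x := by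
      simpa using ((hasDerivAt_id x).mul_const t).const_add 1
    have h3 := (h2.rpow_const (p := -N) (Or.inl h1.ne')).const_mul (t ^ A * (1 - t) ^ b)
    refine h3.congr_deriv ?_
    rw [Real.rpow_add_one ht.1.ne', show -(N + 1) = -N - 1 by ring]
    ring

theorem integral_add_four {X : Type*} [MeasurableSpace X] {μ : Measure X} {f₁ f₂ f₃ f₄ : X → ℝ}
    (h₁ : Integrable f₁ μ) (h₂ : Integrable f₂ μ) (h₃ : Integrable f₃ μ) (h₄ : Integrable f₄ μ) :
    ∫ x, (f₁ x + f₂ x + f₃ x + f₄ x) ∂μ =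
      ∫ x, f₁ x ∂μ + ∫ x, f₂ x ∂μ + ∫ x, f₃ x ∂μ + ∫ x, f₄ x ∂μ := by
  have h₁₂ : Integrable (fun x => f₁ x + f₂ x) μ := h₁.add h₂
  have h₁₂₃ : Integrable (fun x => f₁ x + f₂ x + f₃ x) μ := h₁₂.add h₃
  rw [integral_add h₁₂₃ h₄, integral_add h₁₂ h₃, integral_add h₁ h₂]

/-- Integration by parts in `λ`. -/
theorem hyperInt_parts {b A : ℝ} (hA : -1 < A) (hb : -1 < b) (N : ℝ) {w : ℝ} (hw : -1 < w) :
    (A + 1) * (hyperInt b A N w - hyperInt b (A + 1) N w) - (b + 1) * hyperInt b (A + 1) N w =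
      N * w * (hyperInt b (A + 1) (N + 1) w - hyperInt b (A + 2) (N + 1) w) := by
  -- The exponents A + 1 and b + 1 are positive, so f vanishes at both ends. Its derivative `f'` is
  -- expanded so that each term carries (1-t)^b and integrates to a multiple of a `hyperInt` with
  -- the same b.
  set f : ℝ → ℝ := fun t => t ^ (A + 1) * (1 - t) ^ (b + 1) * (1 + w * t) ^ (-N)
  have i1 := integrableOn_hyperWeight hA hb N hw
  have i2 := integrableOn_hyperWeight (A := A + 1) (by linarith) hb N hw
  have i3 := integrableOn_hyperWeight (A := A + 1) (by linarith) hb (N + 1) hw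
  have i4 := integrableOn_hyperWeight (A := A + 2) (by linarith) hb (N + 1) hw
  set f' : ℝ → ℝ := fun t => (A + 1) * (t ^ A * (1 - t) ^ b * (1 + w * t) ^ (-N)) +
    (-(A + b + 2)) * (t ^ (A + 1) * (1 - t) ^ b * (1 + w * t) ^ (-N)) +
    (-(N * w)) * (t ^ (A + 1) * (1 - t) ^ b * (1 + w * t) ^ (-(N + 1))) +
    (N * w) * (t ^ (A + 2) * (1 - t) ^ b * (1 + w * t) ^ (-(N + 1)))
  have j1 := i1.const_mul (A + 1)
  have j2 := i2.const_mul (-(A + b + 2))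
  have j3 := i3.const_mul (-(N * w))
  have j4 := i4.const_mul (N * w)
  have hint : IntegrableOn f' (Ioo 0 1) := ((j1.add j2).add j3).add j4
  have hcont : ContinuousOn f (Icc 0 1) := by
    intro t ht
    have h1 := one_add_mul_pos hw ht
    apply ContinuousAt.continuousWithinAt
    exact ((continuousAt_id.rpow_const (Or.inr (by linarith))).mul
      ((continuousAt_const.sub continuousAt_id).rpow_const (Or.inr (by linarith)))).mul
      ((continuousAt_const.add (continuousAt_const.mul continuousAt_id)).rpow_const (Or.inl h1.ne'))
  have hder : ∀ t ∈ Ioo (0 : ℝ) 1, HasDerivAt f (f' t) t := by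
    intro t ht
    have h1 := one_add_mul_pos hw ⟨ht.1.le, ht.2.le⟩
    have h2 : 0 < 1 - t := by linarith [ht.2]
    have d1 : HasDerivAt (fun t : ℝ => t ^ (A + 1)) ((A + 1) * t ^ A) t := by
      simpa using Real.hasDerivAt_rpow_const (p := A + 1) (Or.inl ht.1.ne')
    have d2 : HasDerivAt (fun t : ℝ => (1 - t) ^ (b + 1)) (-1 * (b + 1) * (1 - t) ^ b) t := by
      have := ((hasDerivAt_id t).const_sub 1).rpow_const (p := b + 1) (Or.inl h2.ne')
      simpa using this
    have d3 : HasDerivAt (fun t : ℝ => (1 + w * t) ^ (-N))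
        (w * (-N) * (1 + w * t) ^ (-(N + 1))) t := by
      have := (((hasDerivAt_id t).const_mul w).const_add 1).rpow_const (p := -N) (Or.inl h1.ne')
      rw [show -(N + 1) = -N - 1 by ring]
      simpa using this
    refine ((d1.fun_mul d2).fun_mul d3).congr_deriv ?_
    have e1 : (1 + w * t) ^ (-N) = (1 + w * t) ^ (-(N + 1)) * (1 + w * t) := by
      rw [← Real.rpow_add_one h1.ne']; ring_nf
    have e2 : t ^ (A + 1) = t ^ A * t := Real.rpow_add_one ht.1.ne' A
    have e3 : t ^ (A + 2) = t ^ A * t ^ 2 := by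
      rw [Real.rpow_add ht.1]; norm_num
    have e4 : (1 - t) ^ (b + 1) = (1 - t) ^ b * (1 - t) := Real.rpow_add_one h2.ne' b
    simp only [f', e1, e2, e3, e4]
    ring
  have hftc := intervalIntegral.integral_eq_sub_of_hasDerivAt_of_le zero_le_one hcont hder
    ((intervalIntegrable_iff_integrableOn_Ioo_of_le zero_le_one).2 hint)
  have hf0 : f 0 = 0 := by simp [f, Real.zero_rpow (show A + 1 ≠ 0 by linarith)]
  have hf1 : f 1 = 0 := by simp [f, Real.zero_rpow (show b + 1 ≠ 0 by linarith)]
  rw [hf0, hf1, intervalIntegral.integral_of_le zero_le_one, integral_Ioc_eq_integral_Ioo] at hftc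
  have hlin := integral_add_four j1 j2 j3 j4
  simp only [integral_const_mul] at hlin
  unfold hyperInt
  linarith

/-! ### The shrinkage function: recurrence, Riccati equation, bounds and limit. -/

/-- The function `w ↦ w E[λ]`, where `λ` has density proportional to
`λ ^ A (1 - λ) ^ b (1 + w λ) ^ (-N)`. -/
noncomputable def hyperPhi (b A N w : ℝ) : ℝ := w * hyperMean b A N w

theorem hyperMean_pos {b A : ℝ} (hA : -1 < A) (hb : -1 < b) (N : ℝ) {w : ℝ} (hw : -1 < w) :
    0 < hyperMean b A N w :=
  div_pos (hyperInt_pos (by linarith) hb N hw) (hyperInt_pos hA hb N hw)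

theorem hyperMean_lt_one {b A : ℝ} (hA : -1 < A) (hb : -1 < b) (N : ℝ) {w : ℝ} (hw : -1 < w) :
    hyperMean b A N w < 1 :=
  (div_lt_one (hyperInt_pos hA hb N hw)).2 (hyperInt_lt hA (by linarith) hb N hw)

theorem hyperInt_eq_mean_mul {b A : ℝ} (hA : -1 < A) (hb : -1 < b) (N : ℝ) {w : ℝ} (hw : -1 < w) :
    hyperInt b (A + 1) N w = hyperMean b A N w * hyperInt b A N w :=
  (div_mul_cancel₀ _ (hyperInt_pos hA hb N hw).ne').symm

theorem hyperPhi_pos {b A : ℝ} (hA : -1 < A) (hb : -1 < b) (N : ℝ) {w : ℝ} (hw : 0 < w) :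
    0 < hyperPhi b A N w :=
  mul_pos hw (hyperMean_pos hA hb N (by linarith))

theorem hyperPhi_lt {b A : ℝ} (hA : -1 < A) (hb : -1 < b) (N : ℝ) {w : ℝ} (hw : 0 < w) :
    hyperPhi b A N w < w :=
  mul_lt_of_lt_one_right hw (hyperMean_lt_one hA hb N (by linarith))

/-- The mean increases with the exponent of `λ`. -/
theorem hyperMean_le_succ {b A : ℝ} (hA : -1 < A) (hb : -1 < b) (N : ℝ) {w : ℝ} (hw : -1 < w) :
    hyperMean b A N w ≤ hyperMean b (A + 1) N w := by
  have p0 := hyperInt_pos hA hb N hw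
  have p1 := hyperInt_pos (A := A + 1) (by linarith) hb N hw
  set m := hyperMean b A N w with hm
  have i0 := integrableOn_hyperWeight hA hb N hw
  have i1 := integrableOn_hyperWeight (A := A + 1) (by linarith) hb N hw
  have i2 := integrableOn_hyperWeight (A := A + 1 + 1) (by linarith) hb N hw
  -- The integral of (t - m)² against the weight, i.e. nonnegativity of the variance. The zero
  -- summand only pads the integrand to the shape of `integral_add_four`.
  have h : 0 ≤ ∫ t in Ioo (0 : ℝ) 1, (t ^ (A + 1 + 1) * (1 - t) ^ b * (1 + w * t) ^ (-N) +
      (-2 * m) * (t ^ (A + 1) * (1 - t) ^ b * (1 + w * t) ^ (-N)) +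
      m ^ 2 * (t ^ A * (1 - t) ^ b * (1 + w * t) ^ (-N)) +
      0 * (t ^ A * (1 - t) ^ b * (1 + w * t) ^ (-N))) := by
    refine setIntegral_nonneg measurableSet_Ioo fun t ht => ?_
    have hp := hyperWeight_pos b A N hw ht
    rw [Real.rpow_add_one ht.1.ne', Real.rpow_add_one ht.1.ne']
    nlinarith [mul_nonneg hp.le (sq_nonneg (t - m))]
  rw [integral_add_four i2 (i1.const_mul _) (i0.const_mul _) (i0.const_mul _)] at h
  simp only [integral_const_mul] at h
  have e1 := hyperInt_eq_mean_mul hA hb N hw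
  have e2 := hyperInt_eq_mean_mul (A := A + 1) (by linarith) hb N hw
  rw [← hm] at e1
  change 0 ≤ hyperInt b (A + 1 + 1) N w + -2 * m * hyperInt b (A + 1) N w +
    m ^ 2 * hyperInt b A N w + 0 * hyperInt b A N w at h
  have hmpos : 0 < m := hyperMean_pos hA hb N hw
  have h3 : 0 ≤ (m * hyperInt b A N w) * (hyperMean b (A + 1) N w - m) := by
    rw [e2, e1] at h
    nlinarith
  have := nonneg_of_mul_nonneg_right h3 (mul_pos hmpos p0)
  linarith

theorem hyperPhi_le_succ {b A : ℝ} (hA : -1 < A) (hb : -1 < b) (N : ℝ) {w : ℝ} (hw : 0 ≤ w) :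
    hyperPhi b A N w ≤ hyperPhi b (A + 1) N w :=
  mul_le_mul_of_nonneg_left (hyperMean_le_succ hA hb N (by linarith)) hw

/-- The recurrence between the means of orders `A` and `A + 1`. -/
theorem hyperPhi_recurrence {b A : ℝ} (hA : -1 < A) (hb : -1 < b) (N : ℝ) {w : ℝ} (hw : -1 < w) :
    (N - 3 - A - b) * (hyperPhi b A N w * hyperPhi b (A + 1) N w) =
      ((N - 2 - A) * w + A + b + 2) * hyperPhi b A N w - (A + 1) * w := by
  have p0 := hyperInt_pos hA hb N hw
  -- Integration by parts is used at N - 1, because `hyperInt_split` then turns every integral into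
  -- one with exponent N. Dividing by the integral of order A leaves the moments E[λ] and E[λ²], and
  -- the product of the two values of `hyperPhi` is w² E[λ²].
  have h1 := hyperInt_parts hA hb (N - 1) hw
  have s0 := hyperInt_split hA hb (N - 1) hw
  have s1 := hyperInt_split (A := A + 1) (by linarith) hb (N - 1) hw
  have e1 := hyperInt_eq_mean_mul hA hb N hw
  have e2 := hyperInt_eq_mean_mul (A := A + 1) (by linarith) hb N hw
  rw [show A + 1 + 1 = A + 2 by ring] at e2 s1
  rw [sub_add_cancel] at h1 s0 s1
  rw [s0, s1, e2, e1] at h1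
  unfold hyperPhi
  have h2 : hyperInt b A N w * (w * ((N - 3 - A - b) * (w * hyperMean b A N w *
      hyperMean b (A + 1) N w)) - w * (((N - 2 - A) * w + A + b + 2) * hyperMean b A N w -
        (A + 1))) = 0 := by
    linear_combination w * h1
  have h3 := (mul_eq_zero.1 h2).resolve_left p0.ne'
  linear_combination h3

/-- The mean is differentiable and its derivative is `O(1 / w)`. -/
theorem hasDerivAt_hyperMean {b A : ℝ} (hA : -1 < A) (hb : -1 < b) (N : ℝ) {w : ℝ} (hw : -1 < w) :
    ∃ m', HasDerivAt (hyperMean b A N) m' w ∧ (0 ≤ w → |w * m'| ≤ 2 * |N|) ∧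
      w * (1 + w) * (hyperMean b A N w + w * m') = (A + 1) * w -
        (A + 1 + b + (N - 2 - A) * w) * hyperPhi b A N w +
        (N - 2 - A - b) * hyperPhi b A N w ^ 2 := by
  have p0 := hyperInt_pos hA hb N hw
  have p1 := hyperInt_pos (A := A + 1) (by linarith) hb N hw
  have px := hyperInt_pos (A := A + 1) (by linarith) hb (N + 1) hw
  have py := hyperInt_pos (A := A + 2) (by linarith) hb (N + 1) hw
  have pz := hyperInt_pos hA hb (N + 1) hw
  have d0 := hasDerivAt_hyperInt hA hb N hw
  have d1 := hasDerivAt_hyperInt (A := A + 1) (by linarith) hb N hw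
  have h1 := hyperInt_parts hA hb N hw
  have s0 := hyperInt_split hA hb N hw
  have s1 := hyperInt_split (A := A + 1) (by linarith) hb N hw
  have e1 := hyperInt_eq_mean_mul hA hb N hw
  have hm1 := hyperMean_lt_one hA hb N hw
  have hm0 := hyperMean_pos hA hb N hw
  rw [show A + 1 + 1 = A + 2 by ring] at d1 s1
  set m := hyperMean b A N w with hm
  set x := hyperInt b (A + 1) (N + 1) w
  set y := hyperInt b (A + 2) (N + 1) w
  set k := hyperInt b A N w
  refine ⟨-N * (y / k) + N * m * (x / k), ?_, fun hw0 => ?_, ?_⟩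
  · refine (d1.div d0 p0.ne').congr_deriv ?_
    change (-N * y * k - hyperInt b (A + 1) N w * (-N * x)) / k ^ 2 = _
    rw [e1]
    field_simp
    ring
  -- By the splitting identities, w y is at most the integral of order A + 1, hence less than k, and
  -- w x ≤ k. Each of the two terms of w m' is therefore at most |N|.
  · have hy : |w * (y / k)| ≤ 1 := by
      rw [abs_of_nonneg (by positivity), ← mul_div_assoc, div_le_one p0]
      nlinarith
    have hx : |w * (x / k)| ≤ 1 := by
      rw [abs_of_nonneg (by positivity), ← mul_div_assoc, div_le_one p0]
      linarith
    have hmx : |m * (w * (x / k))| ≤ 1 := by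
      rw [abs_mul, abs_of_pos hm0]
      nlinarith [abs_nonneg (w * (x / k))]
    calc |w * (-N * (y / k) + N * m * (x / k))|
        = |N| * |m * (w * (x / k)) - w * (y / k)| := by rw [← abs_mul]; ring_nf
      _ ≤ |N| * 2 := by
          refine mul_le_mul_of_nonneg_left ((abs_sub _ _).trans ?_) (abs_nonneg _)
          linarith
      _ = 2 * |N| := mul_comm _ _
  · unfold hyperPhi
    rw [← hm]
    rw [e1] at h1 s1
    have hk : k * (w * (1 + w) * (m + w * (-N * (y / k) + N * m * (x / k)))) = k * ((A + 1) * w -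
        (A + 1 + b + (N - 2 - A) * w) * (w * m) + (N - 2 - A - b) * (w * m) ^ 2) := by
      have hy : k * (y / k) = y := mul_div_cancel₀ _ p0.ne'
      have hx : k * (x / k) = x := mul_div_cancel₀ _ p0.ne'
      -- The splitting and the integration by parts are two linear equations for x and y; `hX` and
      -- `hY` solve them in terms of k and m, which turns the derivative into a polynomial in m.
      have hX : (1 + w) * N * x = N * (m * k) + ((A + 1) * (k - m * k) - (b + 1) * (m * k)) := by
        linear_combination -h1 - N * s1
      have hY : w * (1 + w) * N * y = (1 + w) * N * (m * k) - (1 + w) * N * x := by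
        linear_combination -(1 + w) * N * s1
      linear_combination (-w ^ 2 * (1 + w) * N) * hy + (w ^ 2 * (1 + w) * N * m) * hx
        - w * hY + (w ^ 2 * m + w) * hX
    exact mul_left_cancel₀ p0.ne' hk

/-- The Riccati equation of `hyperPhi`. -/
theorem hasDerivAt_hyperPhi {b A : ℝ} (hA : -1 < A) (hb : -1 < b) (N : ℝ) {w : ℝ} (hw : 0 < w) :
    ∃ f', HasDerivAt (hyperPhi b A N) f' w ∧ f' = hyperMean b A N w + w * deriv (hyperMean b A N) w ∧
      w * (1 + w) * f' = (A + 1) * w -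
        (A + 1 + b + (N - 2 - A) * w) * hyperPhi b A N w +
        (N - 2 - A - b) * hyperPhi b A N w ^ 2 := by
  obtain ⟨m', h1, -, h2⟩ := hasDerivAt_hyperMean hA hb N (show -1 < w by linarith)
  refine ⟨_, ((hasDerivAt_id w).mul h1).congr_deriv ?_, by rw [h1.deriv], h2⟩
  simp

/-- In the recurrence the factor of order A + 1 lies between 0 and w. With a nonnegative coefficient
it is replaced by w; with a nonpositive one, in `hyperPhi_le_of_nonpos`, by 0. -/
theorem hyperPhi_le_of_nonneg {b A N : ℝ} (hA : -1 < A) (hb : -1 < b) (hk : 0 ≤ N - 3 - A - b)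
    {w : ℝ} (hw : 0 < w) : ((1 + b) * w + A + b + 2) * hyperPhi b A N w ≤ (A + 1) * w := by
  have h := hyperPhi_recurrence hA hb N (show -1 < w by linarith)
  have h1 := hyperPhi_pos hA hb N hw
  have h2 := hyperPhi_lt (A := A + 1) (by linarith) hb N hw
  nlinarith [mul_nonneg hk (mul_nonneg h1.le (sub_nonneg.2 h2.le))]

theorem hyperPhi_le_of_nonpos {b A N : ℝ} (hA : -1 < A) (hb : -1 < b) (hk : N - 3 - A - b ≤ 0)
    {w : ℝ} (hw : 0 < w) : ((N - 2 - A) * w + A + b + 2) * hyperPhi b A N w ≤ (A + 1) * w := by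
  have h := hyperPhi_recurrence hA hb N (show -1 < w by linarith)
  have h1 := hyperPhi_pos hA hb N hw
  have h2 := hyperPhi_pos (A := A + 1) (by linarith) hb N hw
  nlinarith [mul_nonneg (neg_nonneg.2 hk) (mul_pos h1 h2).le]

theorem hyperPhi_bounded {b A N : ℝ} (hA : -1 < A) (hb : -1 < b) (hD : 0 < N - 2 - A) :
    ∃ C, 0 < C ∧ ∀ w, 0 < w → hyperPhi b A N w ≤ C := by
  rcases le_total 0 (N - 3 - A - b) with hk | hk
  · refine ⟨(A + 1) / (1 + b), div_pos (by linarith) (by linarith), fun w hw => ?_⟩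
    have h := hyperPhi_le_of_nonneg hA hb hk hw
    have h1 := hyperPhi_pos hA hb N hw
    rw [le_div_iff₀ (by linarith)]
    have : 0 ≤ w * (A + 1 - hyperPhi b A N w * (1 + b)) := by nlinarith
    linarith [nonneg_of_mul_nonneg_right this hw]
  · refine ⟨(A + 1) / (N - 2 - A), div_pos (by linarith) hD, fun w hw => ?_⟩
    have h := hyperPhi_le_of_nonpos hA hb hk hw
    have h1 := hyperPhi_pos hA hb N hw
    rw [le_div_iff₀ hD]
    have : 0 ≤ w * (A + 1 - hyperPhi b A N w * (N - 2 - A)) := by nlinarith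
    linarith [nonneg_of_mul_nonneg_right this hw]

/-- The limit of `hyperPhi` at infinity. -/
theorem tendsto_hyperPhi {b A N : ℝ} (hA : -1 < A) (hb : -1 < b) (hD : 0 < N - 2 - A) :
    Tendsto (hyperPhi b A N) atTop (𝓝 ((A + 1) / (N - 2 - A))) := by
  obtain ⟨C, hC0, hC⟩ := hyperPhi_bounded hA hb hD
  -- By the recurrence it suffices that w E[λ²] → 0. Order A + 1 need not satisfy the condition N -
  -- 2 - (A + 1) > 0 of `hyperPhi_bounded`, but order A + ε does; ε < 1 gives λ² ≤ λ^(1+ε).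
  obtain ⟨ε, hε0, hε⟩ : ∃ ε, 0 < ε ∧ ε < min (N - 2 - A) 1 := exists_between (lt_min hD one_pos)
  have hεD := hε.trans_le (min_le_left _ _)
  have hε1 := hε.trans_le (min_le_right _ _)
  obtain ⟨C', hC'0, hC'⟩ := hyperPhi_bounded (A := A + ε) (N := N) (by linarith) hb (by linarith)
  have t1 : Tendsto (fun w : ℝ => w ^ (-(ε / 2))) atTop (𝓝 0) :=
    tendsto_rpow_neg_atTop (by linarith)
  have t2 : Tendsto (fun w : ℝ => w ^ (-(1 / 2 : ℝ))) atTop (𝓝 0) :=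
    tendsto_rpow_neg_atTop (by norm_num)
  have t3 : Tendsto (fun w : ℝ => w⁻¹) atTop (𝓝 0) := tendsto_inv_atTop_zero
  have t4 : Tendsto (fun w : ℝ => (|N - 3 - A - b| * (C' * (w ^ (-(ε / 2)) +
      C * w ^ (-(1 / 2 : ℝ)))) + (A + b + 2) * (C * w⁻¹)) / (N - 2 - A)) atTop (𝓝 0) := by
    have := ((((t1.add (t2.const_mul C)).const_mul C').const_mul |N - 3 - A - b|).add
      ((t3.const_mul C).const_mul (A + b + 2))).div_const (N - 2 - A)
    simpa using this
  rw [tendsto_iff_norm_sub_tendsto_zero]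
  refine squeeze_zero' (Eventually.of_forall fun _ => norm_nonneg _) ?_ t4
  filter_upwards [eventually_gt_atTop 1] with w hw1
  have hw : 0 < w := by linarith
  have hw' : -1 < w := by linarith
  have hrec := hyperPhi_recurrence hA hb N hw'
  have hpos := hyperPhi_pos hA hb N hw
  have hpos' := hyperPhi_pos (A := A + 1) (by linarith) hb N hw
  have p0 := hyperInt_pos hA hb N hw'
  -- the bound for the fractional moment
  have hfrac : hyperInt b (A + ε) N w ≤
      (w ^ (-(ε / 2)) + C * w ^ (-(1 / 2 : ℝ))) * hyperInt b A N w := by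
    -- Splitting at the threshold η gives λ^ε ≤ η^ε + λ/η. Since E[λ] = O(1/w), the choice η =
    -- w^(-1/2) makes both terms of E[λ^ε] tend to 0.
    set η : ℝ := w ^ (-(1 / 2 : ℝ)) with hη
    have hη0 : 0 < η := Real.rpow_pos_of_pos hw _
    have h1 : hyperInt b (A + ε) N w ≤
        η ^ ε * hyperInt b A N w + η⁻¹ * hyperInt b (A + 1) N w := by
      have i0 := (integrableOn_hyperWeight hA hb N hw').const_mul (η ^ ε)
      have i1 := (integrableOn_hyperWeight (A := A + 1) (by linarith) hb N hw').const_mul η⁻¹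
      unfold hyperInt
      rw [← integral_const_mul, ← integral_const_mul, ← integral_add i0 i1]
      refine setIntegral_mono_on (integrableOn_hyperWeight (by linarith) hb N hw') (i0.add i1)
        measurableSet_Ioo fun t ht => ?_
      have hp := hyperWeight_pos b A N hw' ht
      have hle : t ^ ε ≤ η ^ ε + η⁻¹ * t := by
        rcases le_total t η with h | h
        · have := Real.rpow_le_rpow ht.1.le h hε0.le
          have h2 : 0 ≤ η⁻¹ * t := mul_nonneg (inv_nonneg.2 hη0.le) ht.1.le
          linarith
        · have h2 := Real.rpow_le_one ht.1.le ht.2.le hε0.le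
          have h3 : 1 ≤ η⁻¹ * t := by rwa [inv_mul_eq_div, one_le_div hη0]
          have h4 := Real.rpow_pos_of_pos hη0 ε
          linarith
      rw [Real.rpow_add ht.1, Real.rpow_add_one ht.1.ne']
      nlinarith [mul_le_mul_of_nonneg_left hle hp.le]
    have h2 : hyperInt b (A + 1) N w ≤ C * w⁻¹ * hyperInt b A N w := by
      rw [hyperInt_eq_mean_mul hA hb N hw']
      refine mul_le_mul_of_nonneg_right ?_ p0.le
      rw [← div_eq_mul_inv, le_div_iff₀ hw, mul_comm]
      exact hC w hw
    have h3 : η ^ ε = w ^ (-(ε / 2)) := by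
      rw [hη, ← Real.rpow_mul hw.le]; ring_nf
    have h4 : η⁻¹ * w⁻¹ = η := by
      rw [hη, ← Real.rpow_neg hw.le, ← Real.rpow_neg_one w, ← Real.rpow_add hw]; norm_num
    calc _ ≤ η ^ ε * hyperInt b A N w + η⁻¹ * (C * w⁻¹ * hyperInt b A N w) :=
          h1.trans (by gcongr)
      _ = (η ^ ε + C * (η⁻¹ * w⁻¹)) * hyperInt b A N w := by ring
      _ = _ := by rw [h3, h4]
  -- The left side is w E[λ²] ≤ w E[λ^(1+ε)], which equals `hyperPhi` of order A + ε times E[λ^ε];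
  -- the first factor is at most C'.
  have hsecond : hyperPhi b A N w * hyperPhi b (A + 1) N w / w ≤
      C' * (w ^ (-(ε / 2)) + C * w ^ (-(1 / 2 : ℝ))) := by
    have q1 : hyperPhi b A N w * hyperPhi b (A + 1) N w / w * hyperInt b A N w =
        w * hyperInt b (A + 2) N w := by
      rw [show A + 2 = A + 1 + 1 by ring, hyperInt_eq_mean_mul (A := A + 1) (by linarith) hb N hw',
        hyperInt_eq_mean_mul hA hb N hw']
      unfold hyperPhi
      field_simp
    have q2 : w * hyperInt b (A + 2) N w ≤ w * hyperInt b (A + ε + 1) N w :=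
      mul_le_mul_of_nonneg_left (hyperInt_lt (by linarith) (by linarith) hb N hw').le hw.le
    have q3 : w * hyperInt b (A + ε + 1) N w ≤ C' * hyperInt b (A + ε) N w := by
      rw [hyperInt_eq_mean_mul (A := A + ε) (by linarith) hb N hw', ← mul_assoc]
      exact mul_le_mul_of_nonneg_right (hC' w hw) (hyperInt_pos (by linarith) hb N hw').le
    have q4 := mul_le_mul_of_nonneg_left hfrac hC'0.le
    refine le_of_mul_le_mul_right ?_ p0
    linarith
  rw [Real.norm_eq_abs, le_div_iff₀ hD, ← abs_of_pos hD, ← abs_mul, abs_of_pos hD]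
  -- The recurrence divided by w: both terms on the right tend to 0.
  have heq : (hyperPhi b A N w - (A + 1) / (N - 2 - A)) * (N - 2 - A) =
      (N - 3 - A - b) * (hyperPhi b A N w * hyperPhi b (A + 1) N w / w) -
        (A + b + 2) * (hyperPhi b A N w * w⁻¹) := by
    field_simp
    linear_combination -hrec
  rw [heq]
  refine (abs_sub _ _).trans (add_le_add ?_ ?_)
  · rw [abs_mul]
    refine mul_le_mul_of_nonneg_left ?_ (abs_nonneg _)
    rwa [abs_of_pos (div_pos (mul_pos hpos hpos') hw)]
  · rw [abs_of_pos (mul_pos (by linarith) (mul_pos hpos (inv_pos.2 hw)))]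
    exact mul_le_mul_of_nonneg_left (mul_le_mul_of_nonneg_right (hC w hw) (inv_nonneg.2 hw.le))
      (by linarith)

/-! ### Monotonicity of the shrinkage function. -/

/-- The substitution `s = w λ`. -/
theorem hyperInt_eq_scaled (b A N : ℝ) {w : ℝ} (hw : 0 < w) :
    w ^ (A + 1) * hyperInt b A N w =
      ∫ s in Ioo 0 w, s ^ A * (1 - s / w) ^ b * (1 + s) ^ (-N) := by
  have h := intervalIntegral.integral_comp_mul_left (a := 0) (b := 1)
    (fun s : ℝ => s ^ A * (1 - s / w) ^ b * (1 + s) ^ (-N)) hw.ne'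
  rw [mul_zero, mul_one, intervalIntegral.integral_of_le hw.le,
    intervalIntegral.integral_of_le zero_le_one, integral_Ioc_eq_integral_Ioo,
    integral_Ioc_eq_integral_Ioo, smul_eq_mul] at h
  have h1 : ∫ t in Ioo (0 : ℝ) 1, (w * t) ^ A * (1 - w * t / w) ^ b * (1 + w * t) ^ (-N) =
      w ^ A * hyperInt b A N w := by
    unfold hyperInt
    rw [← integral_const_mul]
    refine setIntegral_congr_fun measurableSet_Ioo fun t ht => ?_
    rw [Real.mul_rpow hw.le ht.1.le, mul_div_cancel_left₀ _ hw.ne']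
    ring
  rw [h1] at h
  rw [Real.rpow_add_one hw.ne', mul_comm (w ^ A), mul_assoc, h, mul_inv_cancel_left₀ hw.ne']

theorem integrableOn_scaledWeight {b A : ℝ} (hA : -1 < A) (hb : -1 < b) (N : ℝ) {w : ℝ}
    (hw : 0 < w) :
    IntegrableOn (fun s : ℝ => s ^ A * (1 - s / w) ^ b * (1 + s) ^ (-N)) (Ioo 0 w) := by
  refine Integrable.of_integral_ne_zero ?_
  rw [← hyperInt_eq_scaled b A N hw]
  exact (mul_pos (Real.rpow_pos_of_pos hw _) (hyperInt_pos hA hb N (by linarith))).ne'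

/-- In the variable s = wλ, `hyperPhi` is the mean of s, and w enters the density only through (1 -
s/w)^b and the support (0, w). This is the form in which likelihood ratios for two values of w can
be compared. -/
theorem hyperPhi_eq_scaled {b A : ℝ} (hA : -1 < A) (hb : -1 < b) (N : ℝ) {w : ℝ} (hw : 0 < w) :
    ∫ s in Ioo 0 w, s ^ (A + 1) * (1 - s / w) ^ b * (1 + s) ^ (-N) =
      hyperPhi b A N w * ∫ s in Ioo 0 w, s ^ A * (1 - s / w) ^ b * (1 + s) ^ (-N) := by
  rw [← hyperInt_eq_scaled _ _ _ hw, ← hyperInt_eq_scaled _ _ _ hw,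
    hyperInt_eq_mean_mul hA hb N (by linarith), Real.rpow_add_one hw.ne' (A + 1)]
  unfold hyperPhi
  ring

/-- Monotonicity of `hyperPhi` for `b ≥ 0`, by the monotone likelihood ratio property. -/
theorem hyperPhi_mono_of_nonneg {b A : ℝ} (hA : -1 < A) (hb : 0 ≤ b) (N : ℝ) {w₁ w₂ : ℝ}
    (hw₁ : 0 < w₁) (h12 : w₁ ≤ w₂) : hyperPhi b A N w₁ ≤ hyperPhi b A N w₂ := by
  have hb' : -1 < b := by linarith
  have hw₂ : 0 < w₂ := hw₁.trans_le h12
  set m := hyperPhi b A N w₁ with hm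
  have hm0 : 0 < m := hyperPhi_pos hA hb' N hw₁
  have hm1 : m < w₁ := hyperPhi_lt hA hb' N hw₁
  have i1 := integrableOn_scaledWeight hA hb' N hw₁
  have i1' := integrableOn_scaledWeight (A := A + 1) (by linarith) hb' N hw₁
  have i2 := integrableOn_scaledWeight hA hb' N hw₂
  have i2' := integrableOn_scaledWeight (A := A + 1) (by linarith) hb' N hw₂
  have hz1 : ∫ s in Ioo 0 w₁, (s ^ (A + 1) * (1 - s / w₁) ^ b * (1 + s) ^ (-N) -
      m * (s ^ A * (1 - s / w₁) ^ b * (1 + s) ^ (-N))) = 0 := by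
    rw [integral_sub i1' (i1.const_mul m), integral_const_mul, hyperPhi_eq_scaled hA hb' N hw₁,
      hm, sub_self]
  have hq₁ : 0 < (1 - m / w₁) := by rw [sub_pos, div_lt_one hw₁]; exact hm1
  have hq₂ : 0 < (1 - m / w₂) := by rw [sub_pos, div_lt_one hw₂]; exact hm1.trans_le h12
  have hp₁ : 0 < (1 - m / w₁) ^ b := Real.rpow_pos_of_pos hq₁ b
  have hp₂ : 0 < (1 - m / w₂) ^ b := Real.rpow_pos_of_pos hq₂ b
  have hz2 : 0 ≤ ∫ s in Ioo 0 w₂, (s ^ (A + 1) * (1 - s / w₂) ^ b * (1 + s) ^ (-N) -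
      m * (s ^ A * (1 - s / w₂) ^ b * (1 + s) ^ (-N))) := by
    have hpt : ∀ s ∈ Ioo 0 w₂, 0 ≤ s ^ A * (1 - s / w₂) ^ b * (1 + s) ^ (-N) := by
      intro s hs
      have h1 : 0 ≤ 1 - s / w₂ := by rw [sub_nonneg, div_le_one hw₂]; exact hs.2.le
      have h2 := hs.1
      positivity
    have hsub : Ioo 0 w₁ ⊆ Ioo 0 w₂ := Ioo_subset_Ioo_right h12
    have j2 : IntegrableOn (fun s => s ^ (A + 1) * (1 - s / w₂) ^ b * (1 + s) ^ (-N) -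
      m * (s ^ A * (1 - s / w₂) ^ b * (1 + s) ^ (-N))) (Ioo 0 w₂) := i2'.sub (i2.const_mul m)
    -- The part of (0, w₂) beyond w₁ contributes a nonnegative amount, since s ≥ w₁ > m there.
    have hge : ∫ s in Ioo 0 w₁, (s ^ (A + 1) * (1 - s / w₂) ^ b * (1 + s) ^ (-N) -
        m * (s ^ A * (1 - s / w₂) ^ b * (1 + s) ^ (-N))) ≤
        ∫ s in Ioo 0 w₂, (s ^ (A + 1) * (1 - s / w₂) ^ b * (1 + s) ^ (-N) -
        m * (s ^ A * (1 - s / w₂) ^ b * (1 + s) ^ (-N))) := by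
      rw [← integral_add_compl₀ (μ := volume.restrict (Ioo 0 w₂)) (s := Ioo 0 w₁)
        measurableSet_Ioo.nullMeasurableSet j2, Measure.restrict_restrict measurableSet_Ioo,
        inter_eq_left.2 hsub]
      refine le_add_of_nonneg_right ?_
      rw [Measure.restrict_restrict measurableSet_Ioo.compl]
      refine setIntegral_nonneg (measurableSet_Ioo.compl.inter measurableSet_Ioo) fun s hs => ?_
      have h1 : w₁ ≤ s := not_lt.1 fun h => hs.1 ⟨hs.2.1, h⟩
      rw [Real.rpow_add_one hs.2.1.ne']
      nlinarith [mul_nonneg (hpt s hs.2) (show 0 ≤ s - m by linarith)]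
    refine le_trans ?_ hge
    -- For b ≥ 0 the ratio (1 - s/w₂)^b / (1 - s/w₁)^b is nondecreasing in s. The constants (1 -
    -- m/wᵢ)^b normalize it, after cross-multiplication, to cross 1 at s = m, so the difference of
    -- the weights has the sign of s - m. The integral of s - m against the first weight is 0.
    have hscaled : 0 ≤ (1 - m / w₁) ^ b * ∫ s in Ioo 0 w₁,
        (s ^ (A + 1) * (1 - s / w₂) ^ b * (1 + s) ^ (-N) -
        m * (s ^ A * (1 - s / w₂) ^ b * (1 + s) ^ (-N))) := by
      have hz1' : (1 - m / w₂) ^ b * ∫ s in Ioo 0 w₁, (s ^ (A + 1) * (1 - s / w₁) ^ b *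
          (1 + s) ^ (-N) - m * (s ^ A * (1 - s / w₁) ^ b * (1 + s) ^ (-N))) = 0 := by
        rw [hz1, mul_zero]
      have j1 : IntegrableOn (fun s => s ^ (A + 1) * (1 - s / w₁) ^ b * (1 + s) ^ (-N) -
        m * (s ^ A * (1 - s / w₁) ^ b * (1 + s) ^ (-N))) (Ioo 0 w₁) := i1'.sub (i1.const_mul m)
      refine hz1'.ge.trans ?_
      rw [← integral_const_mul, ← integral_const_mul]
      refine setIntegral_mono_on (j1.const_mul _)
        ((j2.mono_set hsub).const_mul _) measurableSet_Ioo
        fun s hs => ?_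
      have h1 : 0 < 1 - s / w₁ := by rw [sub_pos, div_lt_one hw₁]; exact hs.2
      have h2 : 0 < 1 - s / w₂ := by rw [sub_pos, div_lt_one hw₂]; exact hs.2.trans_le h12
      have h3 : 0 ≤ s ^ A * (1 + s) ^ (-N) := by have := hs.1; positivity
      have hinv : w₂⁻¹ ≤ w₁⁻¹ := inv_anti₀ hw₁ h12
      have key : 0 ≤ (s - m) * ((1 - m / w₁) ^ b * (1 - s / w₂) ^ b -
          (1 - m / w₂) ^ b * (1 - s / w₁) ^ b) := by
        rw [← Real.mul_rpow hq₁.le h2.le, ← Real.mul_rpow hq₂.le h1.le]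
        have hdiff : (1 - m / w₁) * (1 - s / w₂) - (1 - m / w₂) * (1 - s / w₁) =
            (s - m) * (w₁⁻¹ - w₂⁻¹) := by ring
        rcases le_total m s with h | h
        · refine mul_nonneg (sub_nonneg.2 h) (sub_nonneg.2 (Real.rpow_le_rpow
            (mul_pos hq₂ h1).le ?_ hb))
          linarith [mul_nonneg (sub_nonneg.2 h) (sub_nonneg.2 hinv)]
        · refine mul_nonneg_of_nonpos_of_nonpos (sub_nonpos.2 h) (sub_nonpos.2 (Real.rpow_le_rpow
            (mul_pos hq₁ h2).le ?_ hb))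
          linarith [mul_nonneg (sub_nonneg.2 h) (sub_nonneg.2 hinv)]
      rw [Real.rpow_add_one hs.1.ne']
      linarith [mul_nonneg h3 key]
    exact nonneg_of_mul_nonneg_right hscaled hp₁
  rw [integral_sub i2' (i2.const_mul m), integral_const_mul, hyperPhi_eq_scaled hA hb' N hw₂,
    ← sub_mul] at hz2
  have hpos : 0 < ∫ s in Ioo 0 w₂, s ^ A * (1 - s / w₂) ^ b * (1 + s) ^ (-N) := by
    rw [← hyperInt_eq_scaled b A N hw₂]
    exact mul_pos (Real.rpow_pos_of_pos hw₂ _) (hyperInt_pos hA hb' N (by linarith))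
  linarith [nonneg_of_mul_nonneg_left hz2 hpos]

/-- The derivative of `hyperPhi` in terms of the variance of `w λ`. -/
theorem hasDerivAt_hyperPhi_variance {b A : ℝ} (hA : -1 < A) (hb : -1 < b) (N : ℝ) {w : ℝ}
    (hw : 0 < w) : ∃ f', HasDerivAt (hyperPhi b A N) f' w ∧
      w * (1 + w) * f' = hyperPhi b A N w * (1 + hyperPhi b A N w) - (N - 3 - A - b) *
        (hyperPhi b A N w * (hyperPhi b (A + 1) N w - hyperPhi b A N w)) := by
  obtain ⟨f', h1, -, h2⟩ := hasDerivAt_hyperPhi hA hb N hw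
  refine ⟨f', h1, ?_⟩
  have h3 := hyperPhi_recurrence hA hb N (show -1 < w by linarith)
  linear_combination h2 + h3

/-- If b ≥ N - 3 - A, the variance term in `hasDerivAt_hyperPhi_variance` has a nonnegative effect
on the derivative. If b ≥ 0, the monotone likelihood ratio argument applies. -/
theorem monotoneOn_hyperPhi {b A N : ℝ} (hA : -1 < A) (hb : -1 < b)
    (h : min (N - 3 - A) 0 ≤ b) : MonotoneOn (hyperPhi b A N) (Ioi 0) := by
  rcases min_le_iff.1 h with hk | hb0
  · have hderiv : ∀ w ∈ Ioi (0 : ℝ), ∃ f', HasDerivAt (hyperPhi b A N) f' w ∧ 0 ≤ f' := by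
      intro w hw
      have hw' : (0 : ℝ) < w := hw
      obtain ⟨f', h1, h2⟩ := hasDerivAt_hyperPhi_variance hA hb N hw'
      refine ⟨f', h1, ?_⟩
      have h3 := hyperPhi_pos hA hb N hw'
      have h4 := hyperPhi_le_succ hA hb N hw'.le
      have h5 : 0 ≤ w * (1 + w) * f' := by
        rw [h2]
        have h6 : 0 ≤ (b - (N - 3 - A)) *
            (hyperPhi b A N w * (hyperPhi b (A + 1) N w - hyperPhi b A N w)) :=
          mul_nonneg (sub_nonneg.2 hk) (mul_nonneg h3.le (sub_nonneg.2 h4))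
        nlinarith
      exact nonneg_of_mul_nonneg_right h5 (by positivity)
    refine monotoneOn_of_deriv_nonneg (convex_Ioi 0) ?_ ?_ ?_
    · exact fun w hw => (hderiv w hw).choose_spec.1.continuousAt.continuousWithinAt
    · rw [interior_Ioi]
      exact fun w hw => (hderiv w hw).choose_spec.1.differentiableAt.differentiableWithinAt
    · rw [interior_Ioi]
      intro w hw
      obtain ⟨f', h1, h2⟩ := hderiv w hw
      rwa [h1.deriv]
  · exact fun w₁ hw₁ w₂ _ h12 => hyperPhi_mono_of_nonneg hA hb0 N hw₁ h12

/-- A monotone `hyperPhi` stays below its limit. -/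
theorem hyperPhi_le_limit {b A N : ℝ} (hA : -1 < A) (hb : -1 < b) (hD : 0 < N - 2 - A)
    (hm : MonotoneOn (hyperPhi b A N) (Ioi 0)) {w : ℝ} (hw : 0 < w) :
    hyperPhi b A N w ≤ (A + 1) / (N - 2 - A) := by
  refine ge_of_tendsto (tendsto_hyperPhi hA hb hD) ?_
  filter_upwards [eventually_ge_atTop w] with x hx
  exact hm hw (hw.trans_le hx) hx

/-! ### Bounds for negative b. -/

/-- An upper bound of `hyperPhi` for negative `b`, obtained from a barrier for the Riccati
equation. -/
theorem hyperPhi_le_barrier {b A N : ℝ} (hA : -1 < A) (hb : -1 < b) (hb0 : b < 0)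
    (hk : 0 ≤ N - 3 - A - b) {w : ℝ} (hw : 0 < w) :
    (1 + b) * (N - 1) * hyperPhi b A N w ≤ (A + 1) * (1 + hyperPhi b A N w) := by
  have hpos := hyperPhi_pos hA hb N hw
  rcases le_or_gt ((1 + b) * (N - 1) - (A + 1)) 0 with hκ | hκ
  · nlinarith
  -- The claim reads φ ≤ (A+1)/κ when κ > 0, and is immediate when κ ≤ 0.
  set κ := (1 + b) * (N - 1) - (A + 1) with hκdef
  have hM : 0 < N - 1 := by linarith
  suffices h : hyperPhi b A N w ≤ (A + 1) / κ by
    rw [le_div_iff₀ hκ] at h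
    linarith
  -- While κx ≤ A + b + 2, the constant A + b + 2 in `hyperPhi_le_of_nonneg` can be replaced by κx;
  -- the factor x then cancels and φ ≤ (A+1)/(1+b+κ), strictly below the barrier.
  have hsmall : ∀ x, 0 < x → κ * x ≤ A + b + 2 → hyperPhi b A N x < (A + 1) / κ := by
    intro x hx hκx
    have h1 := hyperPhi_le_of_nonneg hA hb hk hx
    have h2 := hyperPhi_pos hA hb N hx
    have h3 : (1 + b + κ) * hyperPhi b A N x ≤ A + 1 := by
      have : 0 ≤ x * (A + 1 - (1 + b + κ) * hyperPhi b A N x) := by nlinarith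
      linarith [nonneg_of_mul_nonneg_right this hx]
    rw [lt_div_iff₀ hκ]
    nlinarith
  set a := (A + b + 2) / κ with ha
  have ha0 : 0 < a := div_pos (by linarith) hκ
  have hκa : κ * a = A + b + 2 := mul_div_cancel₀ _ hκ.ne'
  rcases le_or_gt w a with hwa | hwa
  · exact (hsmall w hw (by nlinarith)).le
  have hder : ∀ x ∈ Icc a w, HasDerivAt (hyperPhi b A N) (deriv (hyperPhi b A N) x) x := by
    intro x hx
    obtain ⟨f', h1, -⟩ := hasDerivAt_hyperPhi hA hb N (ha0.trans_le hx.1)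
    exact h1.differentiableAt.hasDerivAt
  refine image_le_of_deriv_right_lt_deriv_boundary' (f' := deriv (hyperPhi b A N)) (a := a)
    (B := fun _ => (A + 1) / κ) (B' := fun _ => 0)
    (fun x hx => (hder x hx).continuousAt.continuousWithinAt)
    (fun x hx => (hder x (Ico_subset_Icc_self hx)).hasDerivWithinAt)
    (hsmall a ha0 hκa.le).le continuousOn_const (fun x _ => hasDerivWithinAt_const _ _ _)
    (fun x hx hfx => ?_) (right_mem_Icc.2 hwa.le)
  have hx0 : 0 < x := ha0.trans_le hx.1
  have hκx : A + b + 2 < κ * x := by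
    by_contra hcon
    exact (hsmall x hx0 (not_lt.1 hcon)).ne hfx
  obtain ⟨f', h1, -, h2⟩ := hasDerivAt_hyperPhi hA hb N hx0
  rw [h1.deriv]
  rw [hfx] at h2
  -- At a contact point the Riccati right-hand side factors with sign b < 0, because contact can
  -- only occur where κx > A + b + 2. So φ cannot cross the constant barrier upwards.
  have h3 : x * (1 + x) * f' = b * (N - 1) * (κ * x - (A + b + 2)) * ((A + 1) / κ ^ 2) := by
    rw [h2]
    field_simp
    rw [hκdef]
    ring
  have h4 : x * (1 + x) * f' < 0 := by
    rw [h3]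
    have : 0 < (-b) * (N - 1) * (κ * x - (A + b + 2)) * ((A + 1) / κ ^ 2) :=
      mul_pos (mul_pos (mul_pos (by linarith) hM) (by linarith))
        (div_pos (by linarith) (by positivity))
    linarith
  by_contra hcon
  have := mul_nonneg (show 0 ≤ x * (1 + x) by positivity) (not_lt.1 hcon)
  linarith

/-- A lower bound of `w φ'(w) / φ(w)` where `φ` exceeds its limit. -/
theorem le_mul_deriv_hyperPhi {b A N : ℝ} (hA : -1 < A) (hb : -1 < b) (hb0 : b < 0)
    (hk : 0 ≤ N - 3 - A - b) {w : ℝ} (hw : 0 < w)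
    (hlim : A + 1 ≤ (N - 2 - A) * hyperPhi b A N w) :
    b * (A + 2) * hyperPhi b A N w ≤ (1 + b) * (w * deriv (hyperPhi b A N) w) := by
  have hw' : -1 < w := by linarith
  have hpos := hyperPhi_pos hA hb N hw
  obtain ⟨f', h1, -, h2⟩ := hasDerivAt_hyperPhi hA hb N hw
  rw [h1.deriv]
  have p0 := hyperInt_pos hA hb N hw'
  have px := hyperInt_pos (A := A + 1) (by linarith) hb (N + 1) hw'
  -- Raising A and N together leaves N - 3 - A - b unchanged, so the barrier also holds at (A+1,
  -- N+1). It controls the integral of order A + 2 that appears in the derivative of the mean.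
  have hbar := hyperPhi_le_barrier (A := A + 1) (N := N + 1) (by linarith) hb hb0 (by linarith) hw
  have hq := hyperInt_eq_mean_mul (A := A + 1) (by linarith) hb (N + 1) hw'
  have hparts := hyperInt_parts hA hb N hw'
  have hsplit := hyperInt_split (A := A + 1) (by linarith) hb N hw'
  have e1 := hyperInt_eq_mean_mul hA hb N hw'
  rw [show A + 1 + 1 = A + 2 by ring] at hq hsplit hbar
  unfold hyperPhi at hbar
  have hbar' : (1 + b) * N * (w * hyperInt b (A + 2) (N + 1) w) ≤
      (A + 2) * hyperInt b (A + 1) N w := by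
    rw [hsplit, hq]
    have := mul_le_mul_of_nonneg_right hbar px.le
    linarith
  have hc : (1 + b) * (N * w * hyperPhi b A N w - (A + 1) * w + (A + b + 2) * hyperPhi b A N w) ≤
      (A + 2) * (1 + w) * hyperPhi b A N w := by
    refine le_of_mul_le_mul_right ?_ p0
    have hY : (1 + w) * N * (w * hyperInt b (A + 2) (N + 1) w) =
        (N * w * hyperMean b A N w - (A + 1) + (A + b + 2) * hyperMean b A N w) *
          hyperInt b A N w := by
      rw [e1] at hparts hsplit
      linear_combination hparts - N * w * hsplit
    have h3 := mul_le_mul_of_nonneg_left hbar' (show 0 ≤ w * (1 + w) by positivity)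
    rw [e1] at h3
    unfold hyperPhi
    linear_combination h3 - (1 + b) * w * hY
  refine le_of_mul_le_mul_right ?_ (show 0 < 1 + w by linarith)
  -- This is where φ ≥ α enters: it makes the excess left over after inserting the Riccati equation
  -- nonnegative.
  have h3 : 0 ≤ (1 + b) * hyperPhi b A N w *
      ((N - 2 - A) * hyperPhi b A N w - (A + 1) + (-b) * hyperPhi b A N w) :=
    mul_nonneg (mul_nonneg (by linarith) hpos.le)
      (add_nonneg (by linarith) (mul_nonneg (by linarith) hpos.le))
  linear_combination hc + h3 - (1 + b) * h2

/-! ### The differential inequality that implies minimaxity. -/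

/-- The sufficient condition for minimaxity in the monotone case. -/
theorem minimax_condition_of_monotone {b A N c ν : ℝ} (hA : -1 < A) (hb : -1 < b)
    (hD : 0 < N - 2 - A) (hν : 0 < ν) (hc : (A + 1) / (N - 2 - A) ≤ c)
    (hm : MonotoneOn (hyperPhi b A N) (Ioi 0)) {w : ℝ} (hw : 0 < w) :
    ν * hyperPhi b A N w * (hyperPhi b A N w - c) ≤
      4 * (w * deriv (hyperPhi b A N) w) * (1 + hyperPhi b A N w) := by
  have hpos := hyperPhi_pos hA hb N hw
  have hle := (hyperPhi_le_limit hA hb hD hm hw).trans hc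
  have hder : 0 ≤ deriv (hyperPhi b A N) w := by
    rw [← derivWithin_of_isOpen isOpen_Ioi (show w ∈ Ioi (0 : ℝ) from hw)]
    exact hm.derivWithin_nonneg
  have h1 : 0 ≤ 4 * (w * deriv (hyperPhi b A N) w) * (1 + hyperPhi b A N w) := by positivity
  have h2 : 0 ≤ ν * hyperPhi b A N w * (c - hyperPhi b A N w) :=
    mul_nonneg (by positivity) (by linarith)
  linarith

/-- The sufficient condition for minimaxity in the non-monotone case. -/
theorem minimax_condition_of_neg {b A N h ν : ℝ} (hA : -1 < A) (hb : -1 < b) (hb0 : b < 0)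
    (hk : 0 ≤ N - 3 - A - b) (hν : 0 < ν) (hh : 0 < h)
    (hlow : 4 * (-b) * (h + A + 2) * ((A + 1) / (N - 2 - A) + 1) ≤
      4 * h - ν * ((A + 1) / (N - 2 - A))) {w : ℝ} (hw : 0 < w) :
    hyperPhi b A N w * (ν * hyperPhi b A N w - 4 * h) ≤
      4 * (w * deriv (hyperPhi b A N) w) * (1 + hyperPhi b A N w) := by
  have hD : 0 < N - 2 - A := by linarith
  set α := (A + 1) / (N - 2 - A) with hα
  have hα0 : 0 < α := div_pos (by linarith) hD
  have hαD : (N - 2 - A) * α = A + 1 := mul_div_cancel₀ _ hD.ne'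
  have hpos := hyperPhi_pos hA hb N hw
  have hltw := hyperPhi_lt hA hb N hw
  rcases le_total ((N - 2 - A) * hyperPhi b A N w) (A + 1) with hle | hge
  · obtain ⟨f', h1, -, h2⟩ := hasDerivAt_hyperPhi hA hb N hw
    rw [h1.deriv]
    have h3 : 0 ≤ w * f' := by
      have : 0 ≤ (1 + w) * (w * f') := by
        have h4 := mul_nonneg (sub_nonneg.2 hle) (sub_nonneg.2 hltw.le)
        have h5 : 0 ≤ (-b) * (hyperPhi b A N w * (1 + hyperPhi b A N w)) :=
          mul_nonneg (by linarith) (by positivity)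
        -- The Riccati right-hand side equals (A + 1 - (N-2-A)φ)(w - φ) - bφ(1+φ), a sum of
        -- nonnegative terms while φ ≤ α and b < 0.
        linear_combination h4 + h5 - h2
      exact nonneg_of_mul_nonneg_right this (by linarith)
    have h6 : hyperPhi b A N w ≤ α := by
      rw [hα, le_div_iff₀ hD]; linarith
    have h7 : ν * hyperPhi b A N w ≤ 4 * h := by
      have h8 : 0 ≤ 4 * (-b) * (h + A + 2) * (α + 1) := by
        have : 0 < -b := by linarith
        have : 0 < h + A + 2 := by linarith
        positivity
      have := mul_le_mul_of_nonneg_left h6 hν.le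
      linarith
    have h9 : 0 ≤ hyperPhi b A N w * (4 * h - ν * hyperPhi b A N w) :=
      mul_nonneg hpos.le (by linarith)
    have h10 : 0 ≤ 4 * (w * f') * (1 + hyperPhi b A N w) := by positivity
    linarith
  · have h1 := le_mul_deriv_hyperPhi hA hb hb0 hk hw hge
    have h2 := hyperPhi_le_barrier hA hb hb0 hk hw
    set φ := hyperPhi b A N w
    set d := w * deriv (hyperPhi b A N) w
    -- The barrier `h2` rewritten in terms of α. It is multiplied below by `hH`, which is a weaker
    -- consequence of `hlow`.
    have hY : 0 ≤ α - φ - b * φ * (1 + α) := by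
      have h3 : (N - 2 - A) * ((1 + b) * (1 + α) * φ) ≤ (N - 2 - A) * (α * (1 + φ)) := by
        linear_combination h2 + ((1 + b) * φ - (1 + φ)) * hαD
      linarith [le_of_mul_le_mul_left h3 hD]
    have hH : 0 ≤ (1 + b) * h + b * (A + 2) := by
      have h3 : 0 ≤ (-b) * (h + A + 2) * α :=
        mul_nonneg (mul_nonneg (by linarith) (by linarith)) hα0.le
      have h4 : 0 < ν * α := by positivity
      linarith
    have hprod := mul_nonneg hY hH
    -- The target multiplied by (1+b)α > 0 is the sum of three nonnegative terms: the derivative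
    -- bound times 4α(1+φ), the hypothesis `hlow` times (1+b)φ², and 4φ times the product of `hY`
    -- and `hH`.
    have h5 : 0 ≤ (1 + b) * α * (4 * d * (1 + φ) - φ * (ν * φ - 4 * h)) := by
      have h6 := mul_le_mul_of_nonneg_left h1 (show 0 ≤ 4 * α * (1 + φ) by positivity)
      have h7 := mul_le_mul_of_nonneg_left hlow
        (show 0 ≤ (1 + b) * φ ^ 2 from mul_nonneg (by linarith) (sq_nonneg _))
      have h8 := mul_nonneg (show 0 ≤ 4 * φ by positivity) hprod
      linear_combination h6 + h7 + h8
    have := nonneg_of_mul_nonneg_right h5 (mul_pos (by linarith) hα0)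
    linarith

/-! ### Failure of monotonicity. -/

/-- Since 0 < φ(w) < w, iterating once from 1 gives φ(φ(1)) < φ(1) although φ(1) < 1. -/
theorem not_antitoneOn_hyperPhi {b A : ℝ} (hA : -1 < A) (hb : -1 < b) (N : ℝ) :
    ¬ AntitoneOn (hyperPhi b A N) (Ioi 0) := by
  intro h
  have h1 := hyperPhi_pos hA hb N one_pos
  have h2 := hyperPhi_lt hA hb N one_pos
  have h3 := hyperPhi_lt hA hb N h1
  have h4 := h (show hyperPhi b A N 1 ∈ Ioi 0 from h1) (mem_Ioi.2 one_pos) h2.le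
  linarith

/-- A monotone φ would stay below α, and the recurrence would then give (N-3-A-b) τ(w) ≤ A + 1 for τ
= `hyperPhi b A (N - 1)`. But τ either has limit (A+1)/(N-3-A), which is too large because b < 0,
or, when N - 3 - A ≤ 0, would have to grow like log w. -/
theorem not_monotoneOn_hyperPhi {b A N : ℝ} (hA : -1 < A) (hb : -1 < b) (hb0 : b < 0)
    (hk : 0 < N - 3 - A - b) : ¬ MonotoneOn (hyperPhi b A N) (Ioi 0) := by
  intro hm
  have hD : 0 < N - 2 - A := by linarith
  have hle : ∀ w, 0 < w → (N - 3 - A - b) * hyperPhi b A (N - 1) w ≤ A + 1 := by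
    intro w hw
    have hw' : -1 < w := by linarith
    have h1 := hyperPhi_le_limit hA hb hD hm hw
    rw [le_div_iff₀ hD] at h1
    have hpos := hyperPhi_pos hA hb N hw
    have hrec := hyperPhi_recurrence hA hb N hw'
    have s0 := hyperInt_split hA hb (N - 1) hw'
    have s1 := hyperInt_split (A := A + 1) (by linarith) hb (N - 1) hw'
    have e0 := hyperInt_eq_mean_mul hA hb (N - 1) hw'
    have e1 := hyperInt_eq_mean_mul hA hb N hw'
    have e2 := hyperInt_eq_mean_mul (A := A + 1) (by linarith) hb N hw'
    have p0 := hyperInt_pos hA hb N hw'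
    rw [sub_add_cancel] at s0 s1
    rw [s0, s1, e2, e1] at e0
    -- Passing from N to N - 1 multiplies the weight by 1 + wλ, so τ = w E[λ(1+wλ)] / E[1+wλ], with
    -- moments taken at N.
    have hτ : hyperPhi b A (N - 1) w * (1 + hyperPhi b A N w) =
        hyperPhi b A N w * (1 + hyperPhi b (A + 1) N w) := by
      refine mul_right_cancel₀ p0.ne' ?_
      unfold hyperPhi
      linear_combination -w * e0
    have h2 : 0 ≤ (1 + w) * (A + 1 - hyperPhi b A N w * (N - 2 - A)) :=
      mul_nonneg (by linarith) (by linarith)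
    refine le_of_mul_le_mul_right ?_ (show 0 < 1 + hyperPhi b A N w by linarith)
    linear_combination h2 + (N - 3 - A - b) * hτ + hrec
  rcases lt_or_ge 0 (N - 1 - 2 - A) with hD1 | hD1
  · have hlim := (tendsto_hyperPhi hA hb hD1).const_mul (N - 3 - A - b)
    have h1 := le_of_tendsto hlim
      ((eventually_gt_atTop 0).mono fun w hw => hle w hw)
    rw [← mul_div_assoc, div_le_iff₀ hD1] at h1
    have h2 : 0 < (-b) * (A + 1) := mul_pos (by linarith) (by linarith)
    linarith
  · set C := (A + 1) / (N - 3 - A - b) with hC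
    have hC0 : 0 < C := div_pos (by linarith) hk
    have hτC : ∀ w, 0 < w → hyperPhi b A (N - 1) w ≤ C := fun w hw => by
      rw [hC, le_div_iff₀ hk, mul_comm]; exact hle w hw
    -- For w ≥ 2C + 1, w - C ≥ (1+w)/4; the Riccati equation at N - 1 then gives wτ' ≥ (A+1)/4.
    -- Hence τ - ((A+1)/4) log w is nondecreasing, against τ ≤ C.
    set w₀ := 2 * C + 1 with hw₀
    have hgrow : MonotoneOn (fun w => hyperPhi b A (N - 1) w - (A + 1) / 4 * Real.log w)
        (Ici w₀) := by
      have hder : ∀ w ∈ Ici w₀, ∃ f', HasDerivAt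
          (fun w => hyperPhi b A (N - 1) w - (A + 1) / 4 * Real.log w) f' w ∧ 0 ≤ f' := by
        intro w hw
        have hw1 : w₀ ≤ w := hw
        have hw0 : 0 < w := by linarith
        obtain ⟨f', h1, -, h2⟩ := hasDerivAt_hyperPhi hA hb (N - 1) hw0
        refine ⟨_, h1.sub ((Real.hasDerivAt_log hw0.ne').const_mul _), ?_⟩
        have h3 := hτC w hw0
        have h4 := hyperPhi_pos hA hb (N - 1) hw0
        have h5 : (A + 1) * (w - C) ≤ w * (1 + w) * f' := by
          rw [h2]
          have h6 : 0 ≤ -(N - 1 - 2 - A) * (w * hyperPhi b A (N - 1) w) :=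
            mul_nonneg (by linarith) (by positivity)
          have h7 : 0 ≤ (N - 3 - A - b) * hyperPhi b A (N - 1) w ^ 2 := by positivity
          have h8 := mul_le_mul_of_nonneg_left h3 (show 0 ≤ A + 1 by linarith)
          have h9 : 0 ≤ (-b) * hyperPhi b A (N - 1) w := mul_nonneg (by linarith) h4.le
          linarith
        have h6 : (A + 1) / 4 * (1 + w) ≤ w * (1 + w) * f' := by
          refine le_trans ?_ h5
          have : 0 ≤ (A + 1) * (w - C - (1 + w) / 4) := mul_nonneg (by linarith) (by linarith)
          linarith
        have h7 : (A + 1) / 4 ≤ w * f' := by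
          refine le_of_mul_le_mul_right ?_ (show 0 < 1 + w by linarith)
          linarith
        rw [sub_nonneg, ← div_eq_mul_inv, div_le_iff₀ hw0]
        linarith
      refine monotoneOn_of_deriv_nonneg (convex_Ici w₀) ?_ ?_ ?_
      · exact fun w hw => (hder w hw).choose_spec.1.continuousAt.continuousWithinAt
      · exact fun w hw => (hder w (interior_subset hw)).choose_spec.1.differentiableAt
          |>.differentiableWithinAt
      · intro w hw
        obtain ⟨f', h1, h2⟩ := hder w (interior_subset hw)
        rwa [h1.deriv]
    have hlog := (Real.tendsto_log_atTop.const_mul_atTop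
      (show 0 < (A + 1) / 4 by linarith)).eventually_gt_atTop
      (C + (A + 1) / 4 * Real.log w₀ - hyperPhi b A (N - 1) w₀)
    obtain ⟨w, hw1, hw2⟩ := (hlog.and (eventually_ge_atTop w₀)).exists
    have h1 := hgrow self_mem_Ici (show w ∈ Ici w₀ from hw2) hw2
    have h2 := hτC w (by linarith)
    simp only at h1
    linarith

/-! ### Normal densities and Stein's identity for radial fields. -/

section Gaussian

variable {d : ℕ}

theorem isoNormalPDF_pos {v : ℝ} (hv : 0 < v) (x : EuclideanSpace ℝ (Fin d)) :
    0 < isoNormalPDF d v x := by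
  unfold isoNormalPDF
  have := Real.pi_pos
  positivity

theorem continuous_isoNormalPDF (v : ℝ) : Continuous (isoNormalPDF d v) := by
  unfold isoNormalPDF
  fun_prop

theorem isoNormalPDF_neg (v : ℝ) (x : EuclideanSpace ℝ (Fin d)) :
    isoNormalPDF d v (-x) = isoNormalPDF d v x := by
  simp [isoNormalPDF]

theorem integral_isoNormalPDF {v : ℝ} (hv : 0 < v) : ∫ x, isoNormalPDF d v x = 1 := by
  have h := GaussianFourier.integral_rexp_neg_mul_sq_norm (V := EuclideanSpace ℝ (Fin d))
    (b := (2 * v)⁻¹) (by positivity)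
  have hpi : 0 < 2 * Real.pi * v := by have := Real.pi_pos; positivity
  have he : ∀ x : EuclideanSpace ℝ (Fin d),
      Real.exp (-‖x‖ ^ 2 / (2 * v)) = Real.exp (-(2 * v)⁻¹ * ‖x‖ ^ 2) := by
    intro x; congr 1; ring
  unfold isoNormalPDF
  simp_rw [he]
  rw [integral_const_mul, h, finrank_euclideanSpace_fin,
    show Real.pi / (2 * v)⁻¹ = 2 * Real.pi * v by rw [div_inv_eq_mul]; ring,
    ← Real.rpow_add hpi]
  simp [neg_div]

theorem integrable_isoNormalPDF {v : ℝ} (hv : 0 < v) : Integrable (isoNormalPDF d v) := by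
  refine Integrable.of_integral_ne_zero ?_
  rw [integral_isoNormalPDF hv]
  exact one_ne_zero

/-- Half of the exponent absorbs the quadratic factor: with s = ‖x‖²/(4v), the bound s e^(-s) ≤ 1
dominates the integrand by K times the normal density of variance 2v. -/
theorem integrable_norm_sq_mul_isoNormalPDF {v : ℝ} (hv : 0 < v) :
    Integrable fun x : EuclideanSpace ℝ (Fin d) => ‖x‖ ^ 2 * isoNormalPDF d v x := by
  set K : ℝ := 4 * v * ((2 * Real.pi * v) ^ (-(d : ℝ) / 2)) / (2 * Real.pi * (2 * v)) ^ (-(d : ℝ) / 2)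
    with hK
  have hpi := Real.pi_pos
  have h0 : 0 < (2 * Real.pi * v) ^ (-(d : ℝ) / 2) := by positivity
  have h1 : 0 < (2 * Real.pi * (2 * v)) ^ (-(d : ℝ) / 2) := by positivity
  refine ((integrable_isoNormalPDF (d := d) (v := 2 * v) (by positivity)).const_mul K).mono'
    ((by fun_prop : Continuous fun x : EuclideanSpace ℝ (Fin d) => ‖x‖ ^ 2).mul
      (continuous_isoNormalPDF v)).aestronglyMeasurable (Eventually.of_forall fun x => ?_)
  rw [Real.norm_of_nonneg (mul_nonneg (sq_nonneg _) (isoNormalPDF_pos hv x).le)]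
  unfold isoNormalPDF
  set s := ‖x‖ ^ 2 / (4 * v) with hs
  have hexp : Real.exp (-‖x‖ ^ 2 / (2 * v)) = Real.exp (-s) * Real.exp (-s) := by
    rw [← Real.exp_add]; congr 1; rw [hs]; field_simp; ring
  have hexp2 : Real.exp (-‖x‖ ^ 2 / (2 * (2 * v))) = Real.exp (-s) := by
    congr 1; rw [hs]; field_simp; ring
  have hse : s * Real.exp (-s) ≤ 1 := by
    rw [Real.exp_neg, ← div_eq_mul_inv, div_le_one (Real.exp_pos s)]
    linarith [Real.add_one_le_exp s]
  have hx : ‖x‖ ^ 2 = 4 * v * s := by rw [hs]; field_simp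
  rw [hexp, hexp2, hx]
  have hpos := Real.exp_pos (-s)
  calc 4 * v * s * ((2 * Real.pi * v) ^ (-(d : ℝ) / 2) * (Real.exp (-s) * Real.exp (-s)))
      = 4 * v * ((2 * Real.pi * v) ^ (-(d : ℝ) / 2) * ((s * Real.exp (-s)) * Real.exp (-s))) := by
        ring
    _ ≤ 4 * v * ((2 * Real.pi * v) ^ (-(d : ℝ) / 2) * (1 * Real.exp (-s))) := by gcongr
    _ = K * ((2 * Real.pi * (2 * v)) ^ (-(d : ℝ) / 2) * Real.exp (-s)) := by
        rw [hK]; field_simp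

/-- Functions of at most quadratic growth are integrable against a normal density. -/
theorem integrable_mul_isoNormalPDF {v : ℝ} (hv : 0 < v) (θ : EuclideanSpace ℝ (Fin d))
    {f : EuclideanSpace ℝ (Fin d) → ℝ} (hf : AEStronglyMeasurable f) {C : ℝ}
    (hC : ∀ x, |f x| ≤ C * (1 + ‖x‖ ^ 2)) :
    Integrable fun x => f x * isoNormalPDF d v (x - θ) := by
  have hC0 : 0 ≤ C := by
    have := (abs_nonneg _).trans (hC 0)
    simpa using this
  have h1 : Integrable fun x : EuclideanSpace ℝ (Fin d) =>
      C * ((1 + 2 * ‖θ‖ ^ 2) * isoNormalPDF d v x + 2 * (‖x‖ ^ 2 * isoNormalPDF d v x)) :=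
    (((integrable_isoNormalPDF hv).const_mul _).add
      ((integrable_norm_sq_mul_isoNormalPDF hv).const_mul 2)).const_mul C
  refine (h1.comp_sub_right θ).mono' (hf.mul
    ((continuous_isoNormalPDF v).comp (continuous_id.sub continuous_const)).aestronglyMeasurable)
    (Eventually.of_forall fun x => ?_)
  have hp := isoNormalPDF_pos hv (x - θ)
  rw [norm_mul, Real.norm_eq_abs, Real.norm_of_nonneg hp.le]
  have hnorm : ‖x‖ ^ 2 ≤ 2 * ‖θ‖ ^ 2 + 2 * ‖x - θ‖ ^ 2 := by
    have : ‖x‖ ≤ ‖x - θ‖ + ‖θ‖ := by simpa using norm_add_le (x - θ) θ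
    nlinarith [sq_nonneg (‖x - θ‖ - ‖θ‖), norm_nonneg x]
  calc |f x| * isoNormalPDF d v (x - θ)
      ≤ (C * (1 + ‖x‖ ^ 2)) * isoNormalPDF d v (x - θ) := by gcongr; exact hC x
    _ ≤ (C * (1 + (2 * ‖θ‖ ^ 2 + 2 * ‖x - θ‖ ^ 2))) * isoNormalPDF d v (x - θ) := by gcongr
    _ = _ := by ring

theorem norm_add_smul_single_sq (x : EuclideanSpace ℝ (Fin d)) (i : Fin d) (t : ℝ) :
    ‖x + t • EuclideanSpace.single i (1 : ℝ)‖ ^ 2 = ‖x‖ ^ 2 + 2 * x i * t + t ^ 2 := by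
  rw [norm_add_sq_real, norm_smul, inner_smul_right, EuclideanSpace.inner_single_right,
    PiLp.norm_single]
  simp
  ring

theorem hasLineDerivAt_isoNormalPDF {v : ℝ} (hv : 0 < v) (θ x : EuclideanSpace ℝ (Fin d))
    (i : Fin d) :
    HasLineDerivAt ℝ (fun y => isoNormalPDF d v (y - θ))
      (-(x i - θ i) / v * isoNormalPDF d v (x - θ)) x (EuclideanSpace.single i (1 : ℝ)) := by
  unfold HasLineDerivAt isoNormalPDF
  have h1 : ∀ t : ℝ, ‖x + t • EuclideanSpace.single i (1 : ℝ) - θ‖ ^ 2 =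
      ‖x - θ‖ ^ 2 + 2 * (x i - θ i) * t + t ^ 2 := by
    intro t
    rw [add_sub_right_comm, norm_add_smul_single_sq]
    rfl
  simp_rw [h1]
  have h2 : HasDerivAt (fun t : ℝ => -(‖x - θ‖ ^ 2 + 2 * (x i - θ i) * t + t ^ 2) / (2 * v))
      (-(2 * (x i - θ i)) / (2 * v)) 0 := by
    have h3 := (((hasDerivAt_id (0 : ℝ)).const_mul (2 * (x i - θ i))).const_add (‖x - θ‖ ^ 2)).add
      ((hasDerivAt_id (0 : ℝ)).pow 2)
    refine (h3.neg.div_const (2 * v)).congr_deriv ?_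
    simp
  refine (h2.exp.const_mul _).congr_deriv ?_
  simp only [mul_zero, add_zero, ne_eq, OfNat.ofNat_ne_zero, not_false_eq_true, zero_pow]
  field_simp

/-- Differentiability of G at 0 is not needed: at the origin the difference quotient along the i-th
axis is G(t²), which tends to G(0), and the term with `deriv G 0` carries the factor x i = 0.
Stein's identity can thus use profiles that are only continuous at 0. -/
theorem hasLineDerivAt_coord_mul_radial {G : ℝ → ℝ} (hG : ContinuousWithinAt G (Ici 0) 0)
    (hd : ∀ r, 0 < r → DifferentiableAt ℝ G r) (x : EuclideanSpace ℝ (Fin d)) (i : Fin d) :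
    HasLineDerivAt ℝ (fun y : EuclideanSpace ℝ (Fin d) => y i * G (‖y‖ ^ 2))
      (G (‖x‖ ^ 2) + 2 * x i ^ 2 * deriv G (‖x‖ ^ 2)) x (EuclideanSpace.single i (1 : ℝ)) := by
  unfold HasLineDerivAt
  simp_rw [norm_add_smul_single_sq]
  have hc : ∀ t : ℝ, (x + t • EuclideanSpace.single i (1 : ℝ)) i = x i + t := by
    intro t; simp
  simp_rw [hc]
  rcases eq_or_ne x 0 with rfl | hx
  · simp only [norm_zero, PiLp.zero_apply, zero_add, mul_zero, zero_mul, ne_eq,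
      OfNat.ofNat_ne_zero, not_false_eq_true, zero_pow, add_zero]
    rw [hasDerivAt_iff_tendsto_slope]
    have h1 : Tendsto (fun t : ℝ => G (t ^ 2)) (𝓝[≠] 0) (𝓝 (G 0)) := by
      refine Tendsto.comp hG (tendsto_nhdsWithin_iff.2 ⟨?_, Eventually.of_forall fun t =>
        sq_nonneg t⟩)
      have : Tendsto (fun t : ℝ => t ^ 2) (𝓝 0) (𝓝 (0 ^ 2)) := (continuous_pow 2).tendsto 0
      rw [zero_pow two_ne_zero] at this
      exact this.mono_left nhdsWithin_le_nhds
    refine h1.congr' ?_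
    filter_upwards [self_mem_nhdsWithin] with t ht
    have ht' : t ≠ 0 := ht
    simp [slope_def_field, ht']
  · have hr : 0 < ‖x‖ ^ 2 := by positivity
    have h1 : HasDerivAt (fun t : ℝ => ‖x‖ ^ 2 + 2 * x i * t + t ^ 2) (2 * x i) 0 := by
      refine ((((hasDerivAt_id (0 : ℝ)).const_mul (2 * x i)).const_add (‖x‖ ^ 2)).add
        ((hasDerivAt_id (0 : ℝ)).pow 2)).congr_deriv ?_
      simp
    have h2 : HasDerivAt (fun t : ℝ => x i + t) 1 0 := (hasDerivAt_id (0 : ℝ)).const_add (x i)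
    have h0 : ‖x‖ ^ 2 + 2 * x i * 0 + 0 ^ 2 = ‖x‖ ^ 2 := by ring
    have h3 : HasDerivAt G (deriv G (‖x‖ ^ 2)) (‖x‖ ^ 2 + 2 * x i * 0 + 0 ^ 2) := by
      rw [h0]; exact (hd _ hr).hasDerivAt
    refine (h2.fun_mul (h3.comp (0 : ℝ) h1)).congr_deriv ?_
    simp only [Function.comp_apply, h0, add_zero]
    ring

theorem abs_coord_le (x : EuclideanSpace ℝ (Fin d)) (i : Fin d) : |x i| ≤ ‖x‖ := by
  simpa using PiLp.norm_apply_le x i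

/-- Stein's identity for radial vector fields. -/
theorem stein_radial {v : ℝ} (hv : 0 < v) (θ : EuclideanSpace ℝ (Fin d)) {G : ℝ → ℝ}
    (hG : ContinuousWithinAt G (Ici 0) 0) (hd : ∀ r, 0 < r → DifferentiableAt ℝ G r) {C : ℝ}
    (hC : ∀ r, 0 ≤ r → |G r| ≤ C) (hC' : ∀ r, 0 < r → |r * deriv G r| ≤ C) :
    ∫ x, inner ℝ x (x - θ) * G (‖x‖ ^ 2) * isoNormalPDF d v (x - θ) =
      v * ∫ x, (d * G (‖x‖ ^ 2) + 2 * (‖x‖ ^ 2 * deriv G (‖x‖ ^ 2))) *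
        isoNormalPDF d v (x - θ) := by
  have hC0 : 0 ≤ C := (abs_nonneg _).trans (hC 0 le_rfl)
  have hGc : Continuous fun x : EuclideanSpace ℝ (Fin d) => G (‖x‖ ^ 2) := by
    have h1 : ContinuousOn G (Ici 0) := by
      intro r hr
      rcases (mem_Ici.1 hr).eq_or_lt with rfl | h
      · exact hG
      · exact (hd r h).continuousAt.continuousWithinAt
    exact h1.comp_continuous (by fun_prop) fun x => sq_nonneg ‖x‖
  have hG'm : Measurable fun x : EuclideanSpace ℝ (Fin d) => deriv G (‖x‖ ^ 2) :=
    (measurable_deriv G).comp (by fun_prop)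
  have hCd : ∀ (x : EuclideanSpace ℝ (Fin d)) (i : Fin d), |x i ^ 2 * deriv G (‖x‖ ^ 2)| ≤ C := by
    intro x i
    rcases eq_or_ne x 0 with rfl | hx
    · simpa using hC0
    · refine le_trans ?_ (hC' (‖x‖ ^ 2) (by positivity))
      rw [abs_mul, abs_mul]
      refine mul_le_mul_of_nonneg_right ?_ (abs_nonneg _)
      rw [abs_of_nonneg (sq_nonneg _), abs_of_nonneg (sq_nonneg _), ← sq_abs (x i)]
      exact pow_le_pow_left₀ (abs_nonneg _) (abs_coord_le x i) 2
  have hone : ∀ x : EuclideanSpace ℝ (Fin d), ‖x‖ ≤ 1 + ‖x‖ ^ 2 := fun x => by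
    nlinarith [sq_nonneg (‖x‖ - 1 / 2)]
  have I1 : ∀ i : Fin d, Integrable fun x : EuclideanSpace ℝ (Fin d) =>
      (G (‖x‖ ^ 2) + 2 * x i ^ 2 * deriv G (‖x‖ ^ 2)) * isoNormalPDF d v (x - θ) := by
    intro i
    refine integrable_mul_isoNormalPDF hv θ (C := 3 * C)
      (by exact (hGc.measurable.add ((by fun_prop : Measurable fun x : EuclideanSpace ℝ (Fin d) =>
        2 * x i ^ 2).mul hG'm)).aestronglyMeasurable) fun x => ?_
    have h1 := hC _ (sq_nonneg ‖x‖)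
    have h2 := hCd x i
    have h3 := abs_add_le (G (‖x‖ ^ 2)) (2 * (x i ^ 2 * deriv G (‖x‖ ^ 2)))
    rw [abs_mul 2, abs_two] at h3
    rw [mul_assoc 2]
    nlinarith [mul_nonneg hC0 (sq_nonneg ‖x‖)]
  have I2 : ∀ i : Fin d, Integrable fun x : EuclideanSpace ℝ (Fin d) =>
      (x i * (x i - θ i) * G (‖x‖ ^ 2)) * isoNormalPDF d v (x - θ) := by
    intro i
    refine integrable_mul_isoNormalPDF hv θ (C := C * (1 + ‖θ‖))
      (by exact ((by fun_prop : Continuous fun x : EuclideanSpace ℝ (Fin d) =>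
        x i * (x i - θ i)).mul hGc).aestronglyMeasurable) fun x => ?_
    rw [abs_mul, abs_mul, mul_comm, mul_assoc C]
    refine mul_le_mul (hC _ (sq_nonneg _)) ?_ (by positivity) hC0
    have h1 := abs_coord_le x i
    have h2 : |x i - θ i| ≤ ‖x‖ + ‖θ‖ :=
      (abs_sub _ _).trans (add_le_add h1 (abs_coord_le θ i))
    calc |x i| * |x i - θ i| ≤ ‖x‖ * (‖x‖ + ‖θ‖) := by gcongr
      _ = ‖x‖ ^ 2 + ‖x‖ * ‖θ‖ := by ring
      _ ≤ (1 + ‖x‖ ^ 2) + (1 + ‖x‖ ^ 2) * ‖θ‖ :=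
          add_le_add (by linarith) (mul_le_mul_of_nonneg_right (hone x) (norm_nonneg θ))
      _ = (1 + ‖θ‖) * (1 + ‖x‖ ^ 2) := by ring
  have I3 : ∀ i : Fin d, Integrable fun x : EuclideanSpace ℝ (Fin d) =>
      (x i * G (‖x‖ ^ 2)) * isoNormalPDF d v (x - θ) := by
    intro i
    refine integrable_mul_isoNormalPDF hv θ (C := C)
      (by exact ((by fun_prop : Continuous fun x : EuclideanSpace ℝ (Fin d) =>
        x i).mul hGc).aestronglyMeasurable) fun x => ?_
    rw [abs_mul, mul_comm]
    exact mul_le_mul (hC _ (sq_nonneg _)) ((abs_coord_le x i).trans (hone x)) (abs_nonneg _) hC0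
  have key : ∀ i : Fin d, ∫ x : EuclideanSpace ℝ (Fin d),
      (x i * (x i - θ i) * G (‖x‖ ^ 2)) * isoNormalPDF d v (x - θ) =
      v * ∫ x : EuclideanSpace ℝ (Fin d),
        (G (‖x‖ ^ 2) + 2 * x i ^ 2 * deriv G (‖x‖ ^ 2)) * isoNormalPDF d v (x - θ) := by
    intro i
    have e : ∀ x : EuclideanSpace ℝ (Fin d), (x i * G (‖x‖ ^ 2)) *
        (-(x i - θ i) / v * isoNormalPDF d v (x - θ)) =
        (-v⁻¹) * ((x i * (x i - θ i) * G (‖x‖ ^ 2)) * isoNormalPDF d v (x - θ)) := by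
      intro x; field_simp
    -- Integration by parts along the i-th axis between the field x i · G(‖x‖²) and the density,
    -- whose derivative reproduces the factor x i - θ i. Summation over i gives the inner product on
    -- one side and the divergence on the other.
    have h := integral_bilinear_hasLineDerivAt_right_eq_neg_left_of_integrable
      (μ := (volume : Measure (EuclideanSpace ℝ (Fin d)))) (B := ContinuousLinearMap.mul ℝ ℝ)
      (f := fun x : EuclideanSpace ℝ (Fin d) => x i * G (‖x‖ ^ 2))
      (f' := fun x : EuclideanSpace ℝ (Fin d) =>
        G (‖x‖ ^ 2) + 2 * x i ^ 2 * deriv G (‖x‖ ^ 2))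
      (g := fun x => isoNormalPDF d v (x - θ))
      (g' := fun x => -(x i - θ i) / v * isoNormalPDF d v (x - θ))
      (v := EuclideanSpace.single i (1 : ℝ)) (I1 i)
      (((I2 i).const_mul (-v⁻¹)).congr (Eventually.of_forall fun x => (e x).symm)) (I3 i)
      (fun x _ => hasLineDerivAt_coord_mul_radial hG hd x i)
      (fun x _ => hasLineDerivAt_isoNormalPDF hv θ x i)
    simp only [ContinuousLinearMap.mul_apply'] at h
    simp_rw [e] at h
    rw [integral_const_mul] at h
    field_simp at h
    linarith
  have hsum := Finset.sum_congr rfl fun i (_ : i ∈ Finset.univ) => key i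
  rw [← Finset.mul_sum, ← integral_finsetSum _ (fun i _ => I2 i),
    ← integral_finsetSum _ (fun i _ => I1 i)] at hsum
  have e1 : ∀ x : EuclideanSpace ℝ (Fin d),
      ∑ i, (x i * (x i - θ i) * G (‖x‖ ^ 2)) * isoNormalPDF d v (x - θ) =
      inner ℝ x (x - θ) * G (‖x‖ ^ 2) * isoNormalPDF d v (x - θ) := by
    intro x
    rw [PiLp.inner_apply, ← Finset.sum_mul, ← Finset.sum_mul]
    congr 2
    refine Finset.sum_congr rfl fun i _ => ?_
    simp [mul_comm]
  have e2 : ∀ x : EuclideanSpace ℝ (Fin d),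
      ∑ i, (G (‖x‖ ^ 2) + 2 * x i ^ 2 * deriv G (‖x‖ ^ 2)) * isoNormalPDF d v (x - θ) =
      (d * G (‖x‖ ^ 2) + 2 * (‖x‖ ^ 2 * deriv G (‖x‖ ^ 2))) * isoNormalPDF d v (x - θ) := by
    intro x
    rw [← Finset.sum_mul, Finset.sum_add_distrib, ← Finset.sum_mul, ← Finset.mul_sum,
      ← EuclideanSpace.real_norm_sq_eq]
    simp only [Finset.sum_const, Finset.card_univ, Fintype.card_fin, nsmul_eq_mul]
    ring
  simp_rw [e1, e2] at hsum
  exact hsum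

theorem integral_norm_sq_mul_isoNormalPDF {v : ℝ} (hv : 0 < v) :
    ∫ x : EuclideanSpace ℝ (Fin d), ‖x‖ ^ 2 * isoNormalPDF d v x = d * v := by
  have h := stein_radial hv (0 : EuclideanSpace ℝ (Fin d)) (G := fun _ => 1) (C := 1)
    continuousWithinAt_const (fun _ _ => differentiableAt_const _) (by simp) (by simp)
  simp only [sub_zero, real_inner_self_eq_norm_sq, mul_one, deriv_const, mul_zero, add_zero,
    integral_const_mul, integral_isoNormalPDF hv] at h
  rw [h, mul_comm]

/-- Bias plus variance: after centring, the cross term is odd and integrates to 0. -/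
theorem integral_dist_sq_mul_isoNormalPDF {v : ℝ} (hv : 0 < v) (c μ : EuclideanSpace ℝ (Fin d)) :
    Integrable (fun x => ‖c - x‖ ^ 2 * isoNormalPDF d v (x - μ)) ∧
      ∫ x, ‖c - x‖ ^ 2 * isoNormalPDF d v (x - μ) = ‖c - μ‖ ^ 2 + d * v := by
  have i0 := (integrable_isoNormalPDF (d := d) hv).const_mul (‖c - μ‖ ^ 2)
  have i2 := integrable_norm_sq_mul_isoNormalPDF (d := d) hv
  have i1 : Integrable fun x : EuclideanSpace ℝ (Fin d) =>
      inner ℝ (c - μ) x * isoNormalPDF d v x := by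
    have := integrable_mul_isoNormalPDF hv (0 : EuclideanSpace ℝ (Fin d))
      (f := fun x => inner ℝ (c - μ) x) (C := ‖c - μ‖)
      (by exact (by fun_prop : Continuous fun x : EuclideanSpace ℝ (Fin d) =>
        inner ℝ (c - μ) x).aestronglyMeasurable) (fun x => ?_)
    · simpa using this
    · refine (abs_real_inner_le_norm _ _).trans (mul_le_mul_of_nonneg_left ?_ (norm_nonneg _))
      nlinarith [sq_nonneg (‖x‖ - 1 / 2)]
  have hodd : ∫ x : EuclideanSpace ℝ (Fin d), inner ℝ (c - μ) x * isoNormalPDF d v x = 0 := by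
    have h := integral_neg_eq_self
      (fun x : EuclideanSpace ℝ (Fin d) => inner ℝ (c - μ) x * isoNormalPDF d v x) volume
    simp only [inner_neg_right, isoNormalPDF_neg, neg_mul, integral_neg] at h
    linarith
  have e : ∀ x : EuclideanSpace ℝ (Fin d), ‖c - μ - x‖ ^ 2 * isoNormalPDF d v x =
      ‖c - μ‖ ^ 2 * isoNormalPDF d v x + (-2) * (inner ℝ (c - μ) x * isoNormalPDF d v x) +
        ‖x‖ ^ 2 * isoNormalPDF d v x + 0 * isoNormalPDF d v x := by
    intro x; rw [norm_sub_sq_real]; ring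
  have hI : Integrable fun x : EuclideanSpace ℝ (Fin d) =>
      ‖c - μ - x‖ ^ 2 * isoNormalPDF d v x := by
    simp_rw [e]
    exact ((i0.add (i1.const_mul (-2))).add i2).add ((integrable_isoNormalPDF hv).const_mul 0)
  have hshift : ∀ x : EuclideanSpace ℝ (Fin d), ‖c - μ - (x - μ)‖ ^ 2 * isoNormalPDF d v (x - μ) =
      ‖c - x‖ ^ 2 * isoNormalPDF d v (x - μ) := by
    intro x; rw [sub_sub_sub_cancel_right]
  constructor
  · have := hI.comp_sub_right μ
    simp_rw [hshift] at this
    exact this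
  · have := integral_sub_right_eq_self (μ := volume)
      (fun x : EuclideanSpace ℝ (Fin d) => ‖c - μ - x‖ ^ 2 * isoNormalPDF d v x) μ
    simp_rw [hshift] at this
    rw [this]
    simp_rw [e]
    rw [integral_add_four i0 (i1.const_mul (-2)) i2 ((integrable_isoNormalPDF hv).const_mul 0), integral_const_mul,
      integral_const_mul, hodd, integral_const_mul, integral_isoNormalPDF hv, integral_norm_sq_mul_isoNormalPDF hv]
    simp

theorem lintegral_isoNormalPDF {v : ℝ} (hv : 0 < v) (μ : EuclideanSpace ℝ (Fin d)) :
    ∫⁻ x, ENNReal.ofReal (isoNormalPDF d v (x - μ)) = 1 := by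
  rw [← ofReal_integral_eq_lintegral_ofReal ((integrable_isoNormalPDF hv).comp_sub_right μ)
    (Eventually.of_forall fun x => (isoNormalPDF_pos hv _).le),
    integral_sub_right_eq_self (fun x => isoNormalPDF d v x), integral_isoNormalPDF hv,
    ENNReal.ofReal_one]

theorem lintegral_dist_sq_mul_isoNormalPDF {v : ℝ} (hv : 0 < v)
    (c μ : EuclideanSpace ℝ (Fin d)) :
    ∫⁻ x, ENNReal.ofReal (‖c - x‖ ^ 2 * isoNormalPDF d v (x - μ)) =
      ENNReal.ofReal (‖c - μ‖ ^ 2 + d * v) := by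
  obtain ⟨h1, h2⟩ := integral_dist_sq_mul_isoNormalPDF hv c μ
  rw [← ofReal_integral_eq_lintegral_ofReal h1
    (Eventually.of_forall fun x => mul_nonneg (sq_nonneg _) (isoNormalPDF_pos hv _).le), h2]

/-- Completing the square: the posterior of a normal mean under a normal prior. -/
theorem isoNormalPDF_mul_isoNormalPDF {v τ : ℝ} (hv : 0 < v) (hτ : 0 < τ)
    (x θ : EuclideanSpace ℝ (Fin d)) :
    isoNormalPDF d v (x - θ) * isoNormalPDF d τ θ =
      isoNormalPDF d (v + τ) x *
        isoNormalPDF d (v * τ / (v + τ)) (θ - (τ / (v + τ)) • x) := by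
  have hpi := Real.pi_pos
  unfold isoNormalPDF
  rw [mul_mul_mul_comm, mul_mul_mul_comm ((2 * Real.pi * (v + τ)) ^ (-(d : ℝ) / 2)),
    ← Real.mul_rpow (by positivity) (by positivity), ← Real.mul_rpow (by positivity) (by positivity),
    ← Real.exp_add, ← Real.exp_add, norm_sub_sq_real, norm_sub_sq_real, norm_smul, mul_pow,
    Real.norm_of_nonneg (show 0 ≤ τ / (v + τ) by positivity), inner_smul_right,
    real_inner_comm x θ]
  congr 2
  · field_simp
  · field_simp
    ring

end Gaussian

/-! ### Stein's identities on the data space and the upper bound on the risk. -/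

theorem ae_ne_zero_euclidean {n : ℕ} (hn : 1 ≤ n) :
    ∀ᵐ z : EuclideanSpace ℝ (Fin n), z ≠ 0 := by
  have : Nonempty (Fin n) := ⟨⟨0, hn⟩⟩
  exact compl_mem_ae_iff.2 (measure_singleton (0 : EuclideanSpace ℝ (Fin n)))

theorem integrable_mul_likelihood {p n : ℕ} {v : ℝ} (hv : 0 < v) (θ : EuclideanSpace ℝ (Fin p))
    {f : EuclideanSpace ℝ (Fin p) × EuclideanSpace ℝ (Fin n) → ℝ} (hf : AEStronglyMeasurable f)
    {C : ℝ} (hC : ∀ y, |f y| ≤ C * (1 + ‖y.1‖ ^ 2)) :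
    Integrable fun y => f y * likelihood p n θ v y := by
  have h1 : Integrable fun x : EuclideanSpace ℝ (Fin p) =>
      (C * (1 + ‖x‖ ^ 2)) * isoNormalPDF p v (x - θ) :=
    integrable_mul_isoNormalPDF hv θ
      (by exact (by fun_prop : Continuous fun x : EuclideanSpace ℝ (Fin p) =>
        C * (1 + ‖x‖ ^ 2)).aestronglyMeasurable) (C := |C|) fun x => by
        rw [abs_mul, abs_of_pos (show 0 < 1 + ‖x‖ ^ 2 by positivity)]
  have h2 := h1.mul_prod (integrable_isoNormalPDF (d := n) hv)
  have hl : Continuous (likelihood p n θ v) := by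
    unfold likelihood
    exact ((continuous_isoNormalPDF v).comp (continuous_fst.sub continuous_const)).mul
      ((continuous_isoNormalPDF v).comp continuous_snd)
  refine h2.mono' (hf.mul hl.aestronglyMeasurable) (Eventually.of_forall fun y => ?_)
  have hp : 0 < likelihood p n θ v y := mul_pos (isoNormalPDF_pos hv _) (isoNormalPDF_pos hv _)
  rw [norm_mul, Real.norm_eq_abs, Real.norm_of_nonneg hp.le]
  calc |f y| * likelihood p n θ v y ≤ (C * (1 + ‖y.1‖ ^ 2)) * likelihood p n θ v y := by
        gcongr; exact hC y
    _ = _ := by unfold likelihood; ring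

section RiskBound

variable {p n : ℕ} {g : ℝ → ℝ} {C v : ℝ}

/-- Stein's identity for the observation `X`. -/
theorem integral_stein_fst (hn : 1 ≤ n) (hgm : Measurable g)
    (hg0 : ContinuousWithinAt g (Ici 0) 0) (hgd : ∀ w, 0 < w → DifferentiableAt ℝ g w)
    (hC : ∀ w, 0 ≤ w → |g w| ≤ C) (hC' : ∀ w, 0 ≤ w → |w * deriv g w| ≤ C) (hv : 0 < v)
    (θ : EuclideanSpace ℝ (Fin p)) :
    ∫ y : EuclideanSpace ℝ (Fin p) × EuclideanSpace ℝ (Fin n),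
        (inner ℝ y.1 (y.1 - θ) * g (‖y.1‖ ^ 2 / ‖y.2‖ ^ 2)) * likelihood p n θ v y =
      v * ∫ y : EuclideanSpace ℝ (Fin p) × EuclideanSpace ℝ (Fin n),
        (p * g (‖y.1‖ ^ 2 / ‖y.2‖ ^ 2) + 2 * (‖y.1‖ ^ 2 / ‖y.2‖ ^ 2 *
          deriv g (‖y.1‖ ^ 2 / ‖y.2‖ ^ 2))) * likelihood p n θ v y := by
  have hC0 : 0 ≤ C := (abs_nonneg _).trans (hC 0 le_rfl)
  have hW : Measurable fun y : EuclideanSpace ℝ (Fin p) × EuclideanSpace ℝ (Fin n) =>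
      ‖y.1‖ ^ 2 / ‖y.2‖ ^ 2 := by fun_prop
  have hgW := hgm.comp hW
  have hdW := (measurable_deriv g).comp hW
  have hW0 : ∀ y : EuclideanSpace ℝ (Fin p) × EuclideanSpace ℝ (Fin n),
      0 ≤ ‖y.1‖ ^ 2 / ‖y.2‖ ^ 2 := fun y => by positivity
  have i1 : Integrable fun y : EuclideanSpace ℝ (Fin p) × EuclideanSpace ℝ (Fin n) =>
      (inner ℝ y.1 (y.1 - θ) * g (‖y.1‖ ^ 2 / ‖y.2‖ ^ 2)) * likelihood p n θ v y := by
    refine integrable_mul_likelihood hv θ (C := C * (1 + ‖θ‖))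
      (by exact ((by fun_prop : Measurable fun y : EuclideanSpace ℝ (Fin p) ×
        EuclideanSpace ℝ (Fin n) => inner ℝ y.1 (y.1 - θ)).mul hgW).aestronglyMeasurable)
      fun y => ?_
    rw [abs_mul, mul_comm, mul_assoc C]
    refine mul_le_mul (hC _ (hW0 y)) ?_ (abs_nonneg _) hC0
    have h1 := abs_real_inner_le_norm y.1 (y.1 - θ)
    have h2 : ‖y.1‖ * ‖y.1 - θ‖ ≤ ‖y.1‖ * (‖y.1‖ + ‖θ‖) :=
      mul_le_mul_of_nonneg_left (norm_sub_le _ _) (norm_nonneg _)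
    nlinarith [sq_nonneg (‖y.1‖ - 1 / 2), norm_nonneg θ, mul_nonneg (norm_nonneg θ)
      (sq_nonneg (‖y.1‖ - 1 / 2))]
  have i2 : Integrable fun y : EuclideanSpace ℝ (Fin p) × EuclideanSpace ℝ (Fin n) =>
      (p * g (‖y.1‖ ^ 2 / ‖y.2‖ ^ 2) + 2 * (‖y.1‖ ^ 2 / ‖y.2‖ ^ 2 *
          deriv g (‖y.1‖ ^ 2 / ‖y.2‖ ^ 2))) * likelihood p n θ v y := by
    refine integrable_mul_likelihood hv θ (C := (p + 2) * C)
      (by exact ((hgW.const_mul _).add ((hW.mul hdW).const_mul 2)).aestronglyMeasurable)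
      fun y => ?_
    refine (abs_add_le _ _).trans ?_
    rw [abs_mul, abs_mul 2, abs_two, Nat.abs_cast]
    have h1 := mul_le_mul_of_nonneg_left (hC _ (hW0 y)) (Nat.cast_nonneg (α := ℝ) p)
    have h2 := hC' _ (hW0 y)
    have h3 : 0 ≤ (p + 2) * C * ‖y.1‖ ^ 2 := by positivity
    linarith
  rw [Measure.volume_eq_prod] at i1 i2 ⊢
  rw [integral_prod_symm _ i1, integral_prod_symm _ i2, ← integral_const_mul]
  refine integral_congr_ae ?_
  -- With z ≠ 0 fixed, this is `stein_radial` for G(r) = g(r/‖z‖²).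
  filter_upwards [ae_ne_zero_euclidean hn] with z hz
  have hs : 0 < ‖z‖ ^ 2 := by positivity
  have hG : ContinuousWithinAt (fun r => g (r / ‖z‖ ^ 2)) (Ici 0) 0 := by
    have h1 : ContinuousWithinAt g (Ici 0) (0 / ‖z‖ ^ 2) := by rwa [zero_div]
    exact h1.comp (f := fun r : ℝ => r / ‖z‖ ^ 2)
      (continuous_id.div_const _).continuousWithinAt fun r hr => div_nonneg hr hs.le
  have hder : ∀ r, 0 < r → HasDerivAt (fun r => g (r / ‖z‖ ^ 2))
      (deriv g (r / ‖z‖ ^ 2) * (1 / ‖z‖ ^ 2)) r := fun r hr =>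
    (hgd _ (div_pos hr hs)).hasDerivAt.comp r ((hasDerivAt_id r).div_const _)
  have hrG : ∀ r, 0 < r → r * deriv (fun r => g (r / ‖z‖ ^ 2)) r =
      r / ‖z‖ ^ 2 * deriv g (r / ‖z‖ ^ 2) := by
    intro r hr
    rw [(hder r hr).deriv]; ring
  have h := stein_radial hv θ hG (fun r hr => (hder r hr).differentiableAt) (C := C)
    (fun r hr => hC _ (div_nonneg hr hs.le))
    (fun r hr => by rw [hrG r hr]; exact hC' _ (div_nonneg hr.le hs.le))
  have e : ∀ x : EuclideanSpace ℝ (Fin p), ‖x‖ ^ 2 * deriv (fun r => g (r / ‖z‖ ^ 2)) (‖x‖ ^ 2) =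
      ‖x‖ ^ 2 / ‖z‖ ^ 2 * deriv g (‖x‖ ^ 2 / ‖z‖ ^ 2) := by
    intro x
    rcases eq_or_ne x 0 with rfl | hx
    · simp
    · exact hrG _ (by positivity)
  simp_rw [e] at h
  simp only [likelihood]
  simp_rw [← mul_assoc _ (isoNormalPDF p v _)]
  rw [integral_mul_const, integral_mul_const, h, mul_assoc]

/-- Stein's identity for the residual `Z`. -/
theorem integral_stein_snd (hp : 1 ≤ p) (hn : 1 ≤ n) (hgm : Measurable g)
    (hgd : ∀ w, 0 < w → DifferentiableAt ℝ g w) (hC1 : 1 ≤ C)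
    (hg1 : ∀ w, 0 ≤ w → |g w| ≤ 1) (hgC : ∀ w, 0 ≤ w → |w * g w| ≤ C)
    (hC' : ∀ w, 0 ≤ w → |w * deriv g w| ≤ C) (hv : 0 < v) (θ : EuclideanSpace ℝ (Fin p)) :
    ∫ y : EuclideanSpace ℝ (Fin p) × EuclideanSpace ℝ (Fin n),
        (g (‖y.1‖ ^ 2 / ‖y.2‖ ^ 2) ^ 2 * ‖y.1‖ ^ 2) * likelihood p n θ v y =
      v * ∫ y : EuclideanSpace ℝ (Fin p) × EuclideanSpace ℝ (Fin n),
        ((n - 2) * (g (‖y.1‖ ^ 2 / ‖y.2‖ ^ 2) * (‖y.1‖ ^ 2 / ‖y.2‖ ^ 2 *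
            g (‖y.1‖ ^ 2 / ‖y.2‖ ^ 2))) -
          4 * ((‖y.1‖ ^ 2 / ‖y.2‖ ^ 2 * g (‖y.1‖ ^ 2 / ‖y.2‖ ^ 2)) * (‖y.1‖ ^ 2 / ‖y.2‖ ^ 2 *
            deriv g (‖y.1‖ ^ 2 / ‖y.2‖ ^ 2)))) * likelihood p n θ v y := by
  have hC0 : 0 ≤ C := by linarith
  have hW : Measurable fun y : EuclideanSpace ℝ (Fin p) × EuclideanSpace ℝ (Fin n) =>
      ‖y.1‖ ^ 2 / ‖y.2‖ ^ 2 := by fun_prop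
  have hgW : Measurable fun y : EuclideanSpace ℝ (Fin p) × EuclideanSpace ℝ (Fin n) =>
      g (‖y.1‖ ^ 2 / ‖y.2‖ ^ 2) := hgm.comp hW
  have hdW : Measurable fun y : EuclideanSpace ℝ (Fin p) × EuclideanSpace ℝ (Fin n) =>
      deriv g (‖y.1‖ ^ 2 / ‖y.2‖ ^ 2) := (measurable_deriv g).comp hW
  have hW0 : ∀ y : EuclideanSpace ℝ (Fin p) × EuclideanSpace ℝ (Fin n),
      0 ≤ ‖y.1‖ ^ 2 / ‖y.2‖ ^ 2 := fun y => by positivity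
  have b1 : ∀ w, 0 ≤ w → |g w * (w * g w)| ≤ C := fun w hw => by
    rw [abs_mul]
    calc |g w| * |w * g w| ≤ 1 * C :=
          mul_le_mul (hg1 w hw) (hgC w hw) (abs_nonneg _) zero_le_one
      _ = C := one_mul C
  have b2 : ∀ w, 0 ≤ w → |(w * g w) * (w * deriv g w)| ≤ C * C := fun w hw => by
    rw [abs_mul]
    exact mul_le_mul (hgC w hw) (hC' w hw) (abs_nonneg _) hC0
  have i1 : Integrable fun y : EuclideanSpace ℝ (Fin p) × EuclideanSpace ℝ (Fin n) =>
      (g (‖y.1‖ ^ 2 / ‖y.2‖ ^ 2) ^ 2 * ‖y.1‖ ^ 2) * likelihood p n θ v y := by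
    refine integrable_mul_likelihood hv θ (C := 1)
      (by exact ((hgW.pow_const 2).mul (by fun_prop)).aestronglyMeasurable) fun y => ?_
    have h1 : g (‖y.1‖ ^ 2 / ‖y.2‖ ^ 2) ^ 2 ≤ 1 := (sq_le_one_iff_abs_le_one _).2 (hg1 _ (hW0 y))
    rw [abs_of_nonneg (by positivity), one_mul]
    nlinarith [sq_nonneg ‖y.1‖]
  have i2 : Integrable fun y : EuclideanSpace ℝ (Fin p) × EuclideanSpace ℝ (Fin n) =>
      ((n - 2) * (g (‖y.1‖ ^ 2 / ‖y.2‖ ^ 2) * (‖y.1‖ ^ 2 / ‖y.2‖ ^ 2 *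
            g (‖y.1‖ ^ 2 / ‖y.2‖ ^ 2))) -
          4 * ((‖y.1‖ ^ 2 / ‖y.2‖ ^ 2 * g (‖y.1‖ ^ 2 / ‖y.2‖ ^ 2)) * (‖y.1‖ ^ 2 / ‖y.2‖ ^ 2 *
            deriv g (‖y.1‖ ^ 2 / ‖y.2‖ ^ 2)))) * likelihood p n θ v y := by
    refine integrable_mul_likelihood hv θ (C := |(n : ℝ) - 2| * C + 4 * (C * C))
      (by exact (((hgW.mul (hW.mul hgW)).const_mul _).sub
        (((hW.mul hgW).mul (hW.mul hdW)).const_mul 4)).aestronglyMeasurable) fun y => ?_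
    refine (abs_sub _ _).trans ?_
    rw [abs_mul, abs_mul 4, abs_of_pos (show (0 : ℝ) < 4 by norm_num)]
    have h1 := mul_le_mul_of_nonneg_left (b1 _ (hW0 y)) (abs_nonneg ((n : ℝ) - 2))
    have h2 := b2 _ (hW0 y)
    have h3 : 0 ≤ (|(n : ℝ) - 2| * C + 4 * (C * C)) * ‖y.1‖ ^ 2 := by positivity
    linarith
  rw [Measure.volume_eq_prod] at i1 i2 ⊢
  rw [integral_prod _ i1, integral_prod _ i2, ← integral_const_mul]
  refine integral_congr_ae ?_
  filter_upwards [ae_ne_zero_euclidean hp] with x hx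
  have hs : 0 < ‖x‖ ^ 2 := by positivity
  set a := ‖x‖ ^ 2 with ha
  -- With x ≠ 0 fixed, g(W)²‖x‖² = ‖z‖² H(‖z‖²), so Stein's identity in z with mean 0 applies to H;
  -- the chain rule for s ↦ a/s changes the dimension n into n - 2.
  set H : ℝ → ℝ := fun s => g (a / s) * (a / s * g (a / s)) with hH
  have hHc : ContinuousWithinAt H (Ici 0) 0 := by
    -- Here a / 0 = 0 by convention. This agrees with the limit, since boundedness of w g(w) gives
    -- |H(s)| ≤ C² s / a.
    have h0 : H 0 = 0 := by simp [hH]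
    unfold ContinuousWithinAt
    rw [h0, tendsto_zero_iff_abs_tendsto_zero]
    have hlim : Tendsto (fun s : ℝ => C ^ 2 / a * s) (𝓝[Ici 0] 0) (𝓝 0) := by
      have : Tendsto (fun s : ℝ => C ^ 2 / a * s) (𝓝 0) (𝓝 (C ^ 2 / a * 0)) :=
        (continuous_const.mul continuous_id).tendsto 0
      rw [mul_zero] at this
      exact this.mono_left nhdsWithin_le_nhds
    refine squeeze_zero' (Eventually.of_forall fun s => abs_nonneg _) ?_ hlim
    filter_upwards [self_mem_nhdsWithin] with s hs'
    rcases (mem_Ici.1 hs').eq_or_lt with rfl | hs0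
    · simp [hH]
    · have e : H s = (a / s * g (a / s)) ^ 2 / a * s := by
        simp only [hH]; field_simp
      have h1 := hgC (a / s) (by positivity)
      simp only [Function.comp_apply]
      rw [e, abs_of_nonneg (by positivity), ← sq_abs]
      gcongr
  have hder : ∀ s, 0 < s → HasDerivAt H (-(2 * (g (a / s) * (a / s * deriv g (a / s))) +
      g (a / s) * g (a / s)) * (a / s ^ 2)) s := by
    intro s hs0
    have hw : HasDerivAt (fun s : ℝ => a / s) (-(a / s ^ 2)) s := by
      have := (hasDerivAt_inv hs0.ne').const_mul a
      simp_rw [← div_eq_mul_inv] at this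
      refine this.congr_deriv ?_
      field_simp
    have hg := (hgd _ (div_pos hs hs0)).hasDerivAt.comp s hw
    refine (hg.mul (hw.mul hg)).congr_deriv ?_
    simp only [Function.comp_apply, Pi.mul_apply]
    ring
  have hrH : ∀ s, 0 < s → s * deriv H s = -(2 * ((a / s * g (a / s)) * (a / s * deriv g (a / s))) +
      g (a / s) * (a / s * g (a / s))) := by
    intro s hs0
    rw [(hder s hs0).deriv]
    field_simp
  have h := stein_radial hv (0 : EuclideanSpace ℝ (Fin n)) hHc
    (fun r hr => (hder r hr).differentiableAt) (C := 2 * (C * C) + C)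
    (fun r hr => (b1 _ (by positivity)).trans (by nlinarith))
    (fun r hr => by
      rw [hrH r hr, abs_neg]
      refine (abs_add_le _ _).trans (add_le_add ?_ (b1 _ (by positivity)))
      rw [abs_mul, abs_two]
      exact mul_le_mul_of_nonneg_left (b2 _ (by positivity)) zero_le_two)
  simp only [sub_zero, real_inner_self_eq_norm_sq] at h
  have hl : ∫ z : EuclideanSpace ℝ (Fin n), (g (a / ‖z‖ ^ 2) ^ 2 * a) * isoNormalPDF n v z =
      ∫ z : EuclideanSpace ℝ (Fin n), ‖z‖ ^ 2 * H (‖z‖ ^ 2) * isoNormalPDF n v z := by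
    refine integral_congr_ae ?_
    filter_upwards [ae_ne_zero_euclidean hn] with z hz
    have hz' : 0 < ‖z‖ := norm_pos_iff.2 hz
    simp only [hH]
    field_simp
  have hr : ∫ z : EuclideanSpace ℝ (Fin n), (n * H (‖z‖ ^ 2) + 2 * (‖z‖ ^ 2 * deriv H (‖z‖ ^ 2))) *
      isoNormalPDF n v z = ∫ z : EuclideanSpace ℝ (Fin n),
      ((n - 2) * (g (a / ‖z‖ ^ 2) * (a / ‖z‖ ^ 2 * g (a / ‖z‖ ^ 2))) -
        4 * ((a / ‖z‖ ^ 2 * g (a / ‖z‖ ^ 2)) * (a / ‖z‖ ^ 2 * deriv g (a / ‖z‖ ^ 2)))) *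
        isoNormalPDF n v z := by
    refine integral_congr_ae ?_
    filter_upwards [ae_ne_zero_euclidean hn] with z hz
    have hz' : 0 < ‖z‖ ^ 2 := by positivity
    rw [hrH _ hz']
    simp only [hH]
    ring
  simp only [likelihood]
  simp_rw [mul_left_comm _ (isoNormalPDF p v _)]
  rw [integral_const_mul, integral_const_mul, hl, h, hr]
  ring

end RiskBound

theorem likelihood_pos {p n : ℕ} {v : ℝ} (hv : 0 < v) (θ : EuclideanSpace ℝ (Fin p))
    (y : EuclideanSpace ℝ (Fin p) × EuclideanSpace ℝ (Fin n)) : 0 < likelihood p n θ v y :=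
  mul_pos (isoNormalPDF_pos hv _) (isoNormalPDF_pos hv _)

theorem continuous_likelihood {p n : ℕ} (v : ℝ) :
    Continuous fun t : EuclideanSpace ℝ (Fin p) ×
      (EuclideanSpace ℝ (Fin p) × EuclideanSpace ℝ (Fin n)) => likelihood p n t.1 v t.2 := by
  unfold likelihood
  exact ((continuous_isoNormalPDF v).comp (by fun_prop)).mul
    ((continuous_isoNormalPDF v).comp (by fun_prop))

theorem risk_eq_lintegral {p n : ℕ} {v : ℝ} (hv : 0 < v)
    {δ : EuclideanSpace ℝ (Fin p) × EuclideanSpace ℝ (Fin n) → EuclideanSpace ℝ (Fin p)}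
    (hδ : Measurable δ) (θ : EuclideanSpace ℝ (Fin p)) :
    risk δ θ v = ∫⁻ y, ENNReal.ofReal (‖δ y - θ‖ ^ 2 / v * likelihood p n θ v y) := by
  have hl : Measurable (likelihood p n θ v) :=
    ((continuous_likelihood v).comp (continuous_const.prodMk continuous_id)).measurable
  unfold risk model
  rw [lintegral_withDensity_eq_lintegral_mul _ hl.ennreal_ofReal
    (by unfold loss; fun_prop)]
  refine lintegral_congr fun y => ?_
  simp only [Pi.mul_apply, loss]
  rw [mul_comm, ← ENNReal.ofReal_mul (by positivity)]

theorem integral_norm_sub_sq_mul_likelihood {p n : ℕ} {v : ℝ} (hv : 0 < v)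
    (θ : EuclideanSpace ℝ (Fin p)) :
    ∫ y : EuclideanSpace ℝ (Fin p) × EuclideanSpace ℝ (Fin n),
      ‖y.1 - θ‖ ^ 2 * likelihood p n θ v y = p * v := by
  simp only [likelihood, ← mul_assoc]
  rw [Measure.volume_eq_prod, integral_prod_mul
    (fun x : EuclideanSpace ℝ (Fin p) => ‖x - θ‖ ^ 2 * isoNormalPDF p v (x - θ))
    (isoNormalPDF n v), integral_isoNormalPDF hv, mul_one]
  have h := (integral_dist_sq_mul_isoNormalPDF hv θ θ).2
  simp_rw [norm_sub_rev θ] at h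
  simpa using h

/-- The risk of a shrinkage estimator satisfying a differential inequality is at most `p`. -/
theorem risk_shrinkage_le {p n : ℕ} {g : ℝ → ℝ} {C v : ℝ} (hp : 1 ≤ p) (hn : 1 ≤ n)
    (hgm : Measurable g) (hg0 : ContinuousWithinAt g (Ici 0) 0)
    (hgd : ∀ w, 0 < w → DifferentiableAt ℝ g w) (hC1 : 1 ≤ C)
    (hpos : ∀ w, 0 ≤ w → 0 ≤ g w) (hle : ∀ w, 0 ≤ w → g w ≤ 1)
    (hgC : ∀ w, 0 ≤ w → |w * g w| ≤ C) (hC' : ∀ w, 0 ≤ w → |w * deriv g w| ≤ C)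
    (hineq : ∀ w, 0 < w → (n - 2) * (g w * (w * g w)) - 4 * ((w * g w) * (w * deriv g w)) ≤
      2 * (p * g w + 2 * (w * deriv g w)))
    (hv : 0 < v) (θ : EuclideanSpace ℝ (Fin p)) :
    risk (fun y : EuclideanSpace ℝ (Fin p) × EuclideanSpace ℝ (Fin n) =>
      (1 - g (‖y.1‖ ^ 2 / ‖y.2‖ ^ 2)) • y.1) θ v ≤ p := by
  have habs : ∀ w, 0 ≤ w → |g w| ≤ 1 := fun w hw => by
    rw [abs_of_nonneg (hpos w hw)]; exact hle w hw
  have hC0 : 0 ≤ C := by linarith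
  have hW : Measurable fun y : EuclideanSpace ℝ (Fin p) × EuclideanSpace ℝ (Fin n) =>
      ‖y.1‖ ^ 2 / ‖y.2‖ ^ 2 := by fun_prop
  have hW0 : ∀ y : EuclideanSpace ℝ (Fin p) × EuclideanSpace ℝ (Fin n),
      0 ≤ ‖y.1‖ ^ 2 / ‖y.2‖ ^ 2 := fun y => by positivity
  have hgW : Measurable fun y : EuclideanSpace ℝ (Fin p) × EuclideanSpace ℝ (Fin n) =>
      g (‖y.1‖ ^ 2 / ‖y.2‖ ^ 2) := hgm.comp hW
  have hdW : Measurable fun y : EuclideanSpace ℝ (Fin p) × EuclideanSpace ℝ (Fin n) =>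
      deriv g (‖y.1‖ ^ 2 / ‖y.2‖ ^ 2) := (measurable_deriv g).comp hW
  have hδm : Measurable fun y : EuclideanSpace ℝ (Fin p) × EuclideanSpace ℝ (Fin n) =>
      (1 - g (‖y.1‖ ^ 2 / ‖y.2‖ ^ 2)) • y.1 := (hgW.const_sub 1).smul measurable_fst
  have quad : ∀ x : EuclideanSpace ℝ (Fin p), ‖x‖ * (‖x‖ + ‖θ‖) ≤ (1 + ‖θ‖) * (1 + ‖x‖ ^ 2) :=
    fun x => by
      nlinarith [sq_nonneg (‖x‖ - 1 / 2), norm_nonneg θ, mul_nonneg (norm_nonneg θ)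
        (sq_nonneg (‖x‖ - 1 / 2))]
  have i0 : Integrable fun y : EuclideanSpace ℝ (Fin p) × EuclideanSpace ℝ (Fin n) =>
      ‖y.1 - θ‖ ^ 2 * likelihood p n θ v y := by
    refine integrable_mul_likelihood hv θ (C := 2 + 2 * ‖θ‖ ^ 2)
      (by exact (by fun_prop : Continuous fun y : EuclideanSpace ℝ (Fin p) ×
        EuclideanSpace ℝ (Fin n) => ‖y.1 - θ‖ ^ 2).aestronglyMeasurable) fun y => ?_
    rw [abs_of_nonneg (sq_nonneg _)]
    have h1 := pow_le_pow_left₀ (norm_nonneg _) (norm_sub_le y.1 θ) 2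
    nlinarith [sq_nonneg (‖y.1‖ - ‖θ‖), mul_nonneg (sq_nonneg ‖y.1‖) (sq_nonneg ‖θ‖)]
  have i1 : Integrable fun y : EuclideanSpace ℝ (Fin p) × EuclideanSpace ℝ (Fin n) =>
      (inner ℝ y.1 (y.1 - θ) * g (‖y.1‖ ^ 2 / ‖y.2‖ ^ 2)) * likelihood p n θ v y := by
    refine integrable_mul_likelihood hv θ (C := 1 + ‖θ‖)
      (by exact ((by fun_prop : Measurable fun y : EuclideanSpace ℝ (Fin p) ×
        EuclideanSpace ℝ (Fin n) => inner ℝ y.1 (y.1 - θ)).mul hgW).aestronglyMeasurable)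
      fun y => ?_
    rw [abs_mul]
    have h1 := abs_real_inner_le_norm y.1 (y.1 - θ)
    have h2 : ‖y.1‖ * ‖y.1 - θ‖ ≤ ‖y.1‖ * (‖y.1‖ + ‖θ‖) :=
      mul_le_mul_of_nonneg_left (norm_sub_le _ _) (norm_nonneg _)
    calc _ ≤ |inner ℝ y.1 (y.1 - θ)| * 1 :=
          mul_le_mul_of_nonneg_left (habs _ (hW0 y)) (abs_nonneg _)
      _ ≤ _ := by linarith [quad y.1]
  have i2 : Integrable fun y : EuclideanSpace ℝ (Fin p) × EuclideanSpace ℝ (Fin n) =>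
      (g (‖y.1‖ ^ 2 / ‖y.2‖ ^ 2) ^ 2 * ‖y.1‖ ^ 2) * likelihood p n θ v y := by
    refine integrable_mul_likelihood hv θ (C := 1)
      (by exact ((hgW.pow_const 2).mul (by fun_prop)).aestronglyMeasurable) fun y => ?_
    have h1 : g (‖y.1‖ ^ 2 / ‖y.2‖ ^ 2) ^ 2 ≤ 1 := (sq_le_one_iff_abs_le_one _).2 (habs _ (hW0 y))
    rw [abs_of_nonneg (by positivity), one_mul]
    nlinarith [sq_nonneg ‖y.1‖]
  have j1 : Integrable fun y : EuclideanSpace ℝ (Fin p) × EuclideanSpace ℝ (Fin n) =>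
      (p * g (‖y.1‖ ^ 2 / ‖y.2‖ ^ 2) + 2 * (‖y.1‖ ^ 2 / ‖y.2‖ ^ 2 *
          deriv g (‖y.1‖ ^ 2 / ‖y.2‖ ^ 2))) * likelihood p n θ v y := by
    refine integrable_mul_likelihood hv θ (C := p + 2 * C)
      (by exact ((hgW.const_mul _).add ((hW.mul hdW).const_mul 2)).aestronglyMeasurable)
      fun y => ?_
    refine (abs_add_le _ _).trans ?_
    rw [abs_mul, abs_mul 2, abs_two, Nat.abs_cast]
    have h1 := mul_le_mul_of_nonneg_left (habs _ (hW0 y)) (Nat.cast_nonneg (α := ℝ) p)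
    have h2 := hC' _ (hW0 y)
    have h3 : 0 ≤ (p + 2 * C) * ‖y.1‖ ^ 2 := by positivity
    linarith
  have hstein1 := integral_stein_fst (p := p) hn hgm hg0 hgd
    (fun w hw => (habs w hw).trans hC1) hC' hv θ
  have hstein2 := integral_stein_snd hp hn hgm hgd hC1 habs hgC hC' hv θ
  -- The squared error of X - gX is expanded; the two Stein identities then replace the cross term
  -- and the term g²‖X‖² by expressions in W alone, which `hineq` compares pointwise. The zero
  -- summand is padding for `integral_add_four`.
  have e : ∀ y : EuclideanSpace ℝ (Fin p) × EuclideanSpace ℝ (Fin n),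
      ‖(1 - g (‖y.1‖ ^ 2 / ‖y.2‖ ^ 2)) • y.1 - θ‖ ^ 2 / v * likelihood p n θ v y =
      v⁻¹ * (‖y.1 - θ‖ ^ 2 * likelihood p n θ v y) +
      (-2 * v⁻¹) * ((inner ℝ y.1 (y.1 - θ) * g (‖y.1‖ ^ 2 / ‖y.2‖ ^ 2)) * likelihood p n θ v y) +
      v⁻¹ * ((g (‖y.1‖ ^ 2 / ‖y.2‖ ^ 2) ^ 2 * ‖y.1‖ ^ 2) * likelihood p n θ v y) +
      0 * (‖y.1 - θ‖ ^ 2 * likelihood p n θ v y) := by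
    intro y
    have h1 : (1 - g (‖y.1‖ ^ 2 / ‖y.2‖ ^ 2)) • y.1 - θ =
        (y.1 - θ) - g (‖y.1‖ ^ 2 / ‖y.2‖ ^ 2) • y.1 := by
      rw [sub_smul, one_smul]; abel
    rw [h1, norm_sub_sq_real (y.1 - θ), inner_smul_right, norm_smul, mul_pow, Real.norm_eq_abs,
      sq_abs, real_inner_comm]
    field_simp
    ring
  have hI := integral_add_four (i0.const_mul v⁻¹) (i1.const_mul (-2 * v⁻¹)) (i2.const_mul v⁻¹)
    (i0.const_mul 0)
  simp only [integral_const_mul] at hI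
  rw [integral_norm_sub_sq_mul_likelihood hv, hstein1, hstein2] at hI
  have hcmp : ∫ y : EuclideanSpace ℝ (Fin p) × EuclideanSpace ℝ (Fin n),
        ((n - 2) * (g (‖y.1‖ ^ 2 / ‖y.2‖ ^ 2) * (‖y.1‖ ^ 2 / ‖y.2‖ ^ 2 *
            g (‖y.1‖ ^ 2 / ‖y.2‖ ^ 2))) -
          4 * ((‖y.1‖ ^ 2 / ‖y.2‖ ^ 2 * g (‖y.1‖ ^ 2 / ‖y.2‖ ^ 2)) * (‖y.1‖ ^ 2 / ‖y.2‖ ^ 2 *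
            deriv g (‖y.1‖ ^ 2 / ‖y.2‖ ^ 2)))) * likelihood p n θ v y ≤
      2 * ∫ y : EuclideanSpace ℝ (Fin p) × EuclideanSpace ℝ (Fin n),
        (p * g (‖y.1‖ ^ 2 / ‖y.2‖ ^ 2) + 2 * (‖y.1‖ ^ 2 / ‖y.2‖ ^ 2 *
          deriv g (‖y.1‖ ^ 2 / ‖y.2‖ ^ 2))) * likelihood p n θ v y := by
    rw [← integral_const_mul]
    have i3 : Integrable fun y : EuclideanSpace ℝ (Fin p) × EuclideanSpace ℝ (Fin n) =>
        ((n - 2) * (g (‖y.1‖ ^ 2 / ‖y.2‖ ^ 2) * (‖y.1‖ ^ 2 / ‖y.2‖ ^ 2 *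
            g (‖y.1‖ ^ 2 / ‖y.2‖ ^ 2))) -
          4 * ((‖y.1‖ ^ 2 / ‖y.2‖ ^ 2 * g (‖y.1‖ ^ 2 / ‖y.2‖ ^ 2)) * (‖y.1‖ ^ 2 / ‖y.2‖ ^ 2 *
            deriv g (‖y.1‖ ^ 2 / ‖y.2‖ ^ 2)))) * likelihood p n θ v y := by
      refine integrable_mul_likelihood hv θ (C := |(n : ℝ) - 2| * C + 4 * (C * C))
        (by exact (((hgW.mul (hW.mul hgW)).const_mul _).sub
          (((hW.mul hgW).mul (hW.mul hdW)).const_mul 4)).aestronglyMeasurable) fun y => ?_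
      refine (abs_sub _ _).trans ?_
      rw [abs_mul, abs_mul 4, abs_of_pos (show (0 : ℝ) < 4 by norm_num)]
      have b1 : |g (‖y.1‖ ^ 2 / ‖y.2‖ ^ 2) * (‖y.1‖ ^ 2 / ‖y.2‖ ^ 2 *
            g (‖y.1‖ ^ 2 / ‖y.2‖ ^ 2))| ≤ C := by
        rw [abs_mul]
        exact (mul_le_mul (habs _ (hW0 y)) (hgC _ (hW0 y)) (abs_nonneg _)
          zero_le_one).trans (one_mul C).le
      have b2 : |(‖y.1‖ ^ 2 / ‖y.2‖ ^ 2 * g (‖y.1‖ ^ 2 / ‖y.2‖ ^ 2)) * (‖y.1‖ ^ 2 / ‖y.2‖ ^ 2 *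
            deriv g (‖y.1‖ ^ 2 / ‖y.2‖ ^ 2))| ≤ C * C := by
        rw [abs_mul]
        exact mul_le_mul (hgC _ (hW0 y)) (hC' _ (hW0 y)) (abs_nonneg _) hC0
      have h1 := mul_le_mul_of_nonneg_left b1 (abs_nonneg ((n : ℝ) - 2))
      have h3 : 0 ≤ (|(n : ℝ) - 2| * C + 4 * (C * C)) * ‖y.1‖ ^ 2 := by positivity
      linarith
    refine integral_mono i3 (j1.const_mul 2) fun y => ?_
    simp only
    rw [← mul_assoc 2]
    refine mul_le_mul_of_nonneg_right ?_ (likelihood_pos hv θ y).le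
    -- At W = 0 every derivative term carries the factor W, and only g(0) ≥ 0 is needed.
    rcases (hW0 y).eq_or_lt with h | h
    · rw [← h]
      have h1 := mul_nonneg (Nat.cast_nonneg (α := ℝ) p) (hpos 0 le_rfl)
      simp only [zero_mul, mul_zero, sub_zero, add_zero]
      linarith
    · exact hineq _ h
  have hint : Integrable fun y : EuclideanSpace ℝ (Fin p) × EuclideanSpace ℝ (Fin n) =>
      ‖(1 - g (‖y.1‖ ^ 2 / ‖y.2‖ ^ 2)) • y.1 - θ‖ ^ 2 / v * likelihood p n θ v y := by
    simp_rw [e]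
    exact (((i0.const_mul v⁻¹).add (i1.const_mul (-2 * v⁻¹))).add (i2.const_mul v⁻¹)).add
      (i0.const_mul 0)
  rw [risk_eq_lintegral hv hδm, ← ofReal_integral_eq_lintegral_ofReal hint
    (Eventually.of_forall fun y => mul_nonneg (by positivity) (likelihood_pos hv θ y).le),
    ← ENNReal.ofReal_natCast p]
  refine ENNReal.ofReal_le_ofReal ?_
  simp_rw [e]
  rw [hI]
  rw [mul_comm (p : ℝ) v, mul_assoc (-2), inv_mul_cancel_left₀ hv.ne', inv_mul_cancel_left₀ hv.ne',
    inv_mul_cancel_left₀ hv.ne', zero_mul]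
  linarith

/-! ### The minimax lower bound. -/

/-- Every estimator has maximal risk at least `p`. -/
theorem le_maxRisk {p n : ℕ}
    {δ : EuclideanSpace ℝ (Fin p) × EuclideanSpace ℝ (Fin n) → EuclideanSpace ℝ (Fin p)}
    (hδ : Measurable δ) : (p : ENNReal) ≤ maxRisk δ := by
  -- The maximal risk dominates the risk averaged over θ ∼ N(0, τ I) at σ² = 1, and this average is
  -- at least the total posterior variance pτ/(1+τ). The factor 1 is the variance v in
  -- `isoNormalPDF_mul_isoNormalPDF`.
  have hbayes : ∀ τ : ℝ, 0 < τ → ENNReal.ofReal (p * (1 * τ / (1 + τ))) ≤ maxRisk δ := by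
    intro τ hτ
    have hm : 0 < 1 * τ / (1 + τ) := by positivity
    have hmeas : Measurable fun t : EuclideanSpace ℝ (Fin p) ×
        (EuclideanSpace ℝ (Fin p) × EuclideanSpace ℝ (Fin n)) =>
        ENNReal.ofReal (‖δ t.2 - t.1‖ ^ 2 * likelihood p n t.1 1 t.2 * isoNormalPDF p τ t.1) := by
      have h1 := (continuous_likelihood (p := p) (n := n) 1).measurable
      have h2 := (continuous_isoNormalPDF (d := p) τ).measurable
      fun_prop
    have h1 : ∫⁻ θ, risk δ θ 1 * ENNReal.ofReal (isoNormalPDF p τ θ) ≤ maxRisk δ := by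
      calc ∫⁻ θ, risk δ θ 1 * ENNReal.ofReal (isoNormalPDF p τ θ)
          ≤ ∫⁻ θ, maxRisk δ * ENNReal.ofReal (isoNormalPDF p τ θ) := by
            refine lintegral_mono fun θ => mul_le_mul_left ?_ _
            exact le_iSup_of_le θ (le_iSup_of_le 1 (le_iSup_of_le one_pos le_rfl))
        _ = maxRisk δ := by
            rw [lintegral_const_mul _ (continuous_isoNormalPDF τ).measurable.ennreal_ofReal]
            have := lintegral_isoNormalPDF (d := p) hτ 0
            simp only [sub_zero] at this
            rw [this, mul_one]
    refine le_trans ?_ h1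
    have h2 : ∀ θ, risk δ θ 1 * ENNReal.ofReal (isoNormalPDF p τ θ) = ∫⁻ y,
        ENNReal.ofReal (‖δ y - θ‖ ^ 2 * likelihood p n θ 1 y * isoNormalPDF p τ θ) := by
      intro θ
      rw [risk_eq_lintegral one_pos hδ, ← lintegral_mul_const'' _ (by
        have h1 : Measurable (likelihood p n θ 1) :=
          ((continuous_likelihood 1).comp (continuous_const.prodMk continuous_id)).measurable
        fun_prop)]
      refine lintegral_congr fun y => ?_
      rw [div_one, ← ENNReal.ofReal_mul (mul_nonneg (sq_nonneg _) (likelihood_pos one_pos θ y).le)]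
    simp_rw [h2]
    rw [lintegral_lintegral_swap hmeas.aemeasurable]
    -- For each y, completing the square factors out the marginal density of y; the remaining
    -- expected squared distance is at least the posterior variance, whatever δ does.
    have h3 : ∀ y : EuclideanSpace ℝ (Fin p) × EuclideanSpace ℝ (Fin n),
        ENNReal.ofReal (p * (1 * τ / (1 + τ))) *
          ENNReal.ofReal (isoNormalPDF p (1 + τ) y.1 * isoNormalPDF n 1 y.2) ≤
        ∫⁻ θ, ENNReal.ofReal (‖δ y - θ‖ ^ 2 * likelihood p n θ 1 y * isoNormalPDF p τ θ) := by
      intro y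
      have hc : 0 ≤ isoNormalPDF p (1 + τ) y.1 * isoNormalPDF n 1 y.2 :=
        mul_nonneg (isoNormalPDF_pos (by linarith) _).le (isoNormalPDF_pos one_pos _).le
      have e : ∀ θ, ENNReal.ofReal (‖δ y - θ‖ ^ 2 * likelihood p n θ 1 y * isoNormalPDF p τ θ) =
          ENNReal.ofReal (isoNormalPDF p (1 + τ) y.1 * isoNormalPDF n 1 y.2) *
          ENNReal.ofReal (‖δ y - θ‖ ^ 2 *
            isoNormalPDF p (1 * τ / (1 + τ)) (θ - (τ / (1 + τ)) • y.1)) := by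
        intro θ
        rw [← ENNReal.ofReal_mul hc]
        congr 1
        unfold likelihood
        linear_combination (‖δ y - θ‖ ^ 2 * isoNormalPDF n 1 y.2) *
          isoNormalPDF_mul_isoNormalPDF one_pos hτ y.1 θ
      simp_rw [e]
      rw [lintegral_const_mul' _ _ ENNReal.ofReal_ne_top, lintegral_dist_sq_mul_isoNormalPDF hm,
        mul_comm]
      refine mul_le_mul_right (ENNReal.ofReal_le_ofReal ?_) _
      exact le_add_of_nonneg_left (sq_nonneg _)
    refine le_trans ?_ (lintegral_mono h3)
    rw [lintegral_const_mul' _ _ ENNReal.ofReal_ne_top, Measure.volume_eq_prod]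
    simp_rw [fun y : EuclideanSpace ℝ (Fin p) × EuclideanSpace ℝ (Fin n) =>
      ENNReal.ofReal_mul (q := isoNormalPDF n 1 y.2)
        (isoNormalPDF_pos (show 0 < 1 + τ by linarith) y.1).le]
    rw [lintegral_prod_mul (f := fun x => ENNReal.ofReal (isoNormalPDF p (1 + τ) x))
      (g := fun z => ENNReal.ofReal (isoNormalPDF n 1 z))
      (continuous_isoNormalPDF _).measurable.ennreal_ofReal.aemeasurable
      (continuous_isoNormalPDF _).measurable.ennreal_ofReal.aemeasurable]
    have e1 := lintegral_isoNormalPDF (d := p) (show 0 < 1 + τ by linarith) 0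
    have e2 := lintegral_isoNormalPDF (d := n) one_pos 0
    simp only [sub_zero] at e1 e2
    rw [e1, e2, mul_one, mul_one]
  have hlim : Tendsto (fun τ : ℝ => ENNReal.ofReal (p * (1 * τ / (1 + τ)))) atTop
      (𝓝 (ENNReal.ofReal (p * 1))) := by
    refine ENNReal.tendsto_ofReal (Tendsto.const_mul _ ?_)
    have h1 : Tendsto (fun τ : ℝ => 1 - (1 + τ)⁻¹) atTop (𝓝 (1 - 0)) :=
      (tendsto_inv_atTop_zero.comp (tendsto_atTop_add_const_left _ 1 tendsto_id)).const_sub 1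
    rw [sub_zero] at h1
    refine h1.congr' ?_
    filter_upwards [eventually_gt_atTop 0] with τ hτ
    field_simp
    ring
  rw [mul_one, ENNReal.ofReal_natCast] at hlim
  exact le_of_tendsto hlim ((eventually_gt_atTop 0).mono hbayes)

/-! ### From the differential inequality to minimaxity of the estimator. -/

theorem measurable_hyperInt (b A N : ℝ) : Measurable (hyperInt b A N) := by
  unfold hyperInt
  have h : StronglyMeasurable fun q : ℝ × ℝ =>
      q.2 ^ A * (1 - q.2) ^ b * (1 + q.1 * q.2) ^ (-N) := by
    apply Measurable.stronglyMeasurable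
    fun_prop
  exact (h.integral_prod_right' (ν := volume.restrict (Ioo (0 : ℝ) 1))).measurable

theorem measurable_hyperMean (b A N : ℝ) : Measurable (hyperMean b A N) :=
  (measurable_hyperInt b (A + 1) N).div (measurable_hyperInt b A N)

theorem phi_eq_hyperPhi (p n : ℕ) (a b e : ℝ) :
    phi p n a b e = hyperPhi b ((p : ℝ) / 2 + a) ((p : ℝ) / 2 + (n : ℝ) / 2 + e + 2) := by
  ext w
  unfold phi hyperPhi hyperMean hyperInt
  rw [show -((p : ℝ) / 2 + (n : ℝ) / 2 + e + 2) = -(p : ℝ) / 2 - (n : ℝ) / 2 - e - 2 by ring,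
    mul_div_assoc]

theorem measurable_shrinkageEstimator {p n : ℕ} {f : ℝ → ℝ} (hf : Measurable f) :
    Measurable (shrinkageEstimator p n f) := by
  unfold shrinkageEstimator
  fun_prop

/-- The quotient φ(W)/W equals `hyperMean` only for W ≠ 0; for z ≠ 0, W vanishes only at x = 0,
where both sides are 0. -/
theorem shrinkageEstimator_hyperPhi_eq {p n : ℕ} (b A N : ℝ)
    (y : EuclideanSpace ℝ (Fin p) × EuclideanSpace ℝ (Fin n)) (hy : y.2 ≠ 0) :
    shrinkageEstimator p n (hyperPhi b A N) y =
      (1 - hyperMean b A N (‖y.1‖ ^ 2 / ‖y.2‖ ^ 2)) • y.1 := by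
  unfold shrinkageEstimator hyperPhi
  rcases eq_or_ne y.1 0 with hx | hx
  · rw [hx, smul_zero, smul_zero]
  · have : ‖y.1‖ ^ 2 / ‖y.2‖ ^ 2 ≠ 0 := by
      have h1 := norm_pos_iff.2 hx
      have h2 := norm_pos_iff.2 hy
      positivity
    rw [mul_div_cancel_left₀ _ this]

theorem ae_snd_ne_zero {p n : ℕ} (hn : 1 ≤ n) :
    ∀ᵐ y : EuclideanSpace ℝ (Fin p) × EuclideanSpace ℝ (Fin n), y.2 ≠ 0 := by
  rw [Measure.volume_eq_prod]
  exact Measure.quasiMeasurePreserving_snd.ae (ae_ne_zero_euclidean hn)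

theorem risk_congr_ae {p n : ℕ}
    {δ δ' : EuclideanSpace ℝ (Fin p) × EuclideanSpace ℝ (Fin n) → EuclideanSpace ℝ (Fin p)}
    (h : δ =ᵐ[volume] δ') (θ : EuclideanSpace ℝ (Fin p)) (v : ℝ) : risk δ θ v = risk δ' θ v := by
  unfold risk
  refine lintegral_congr_ae ?_
  have hac : model p n θ v ≪ volume := withDensity_absolutelyContinuous _ _
  filter_upwards [hac.ae_le h] with y hy
  rw [hy]

/-- With g = φ/w one has w²g' = wφ' - φ, so `hcond` is the inequality required by
`risk_shrinkage_le` multiplied by w. The bound by p matches `le_maxRisk`. Since the sampling laws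
have densities, changing δ on a null set does not affect its risk. -/
theorem isMinimax_of_ae_eq {p n : ℕ} (hp : 1 ≤ p) (hn : 1 ≤ n) {b A N : ℝ} (hA : -1 < A)
    (hb : -1 < b) (hD : 0 < N - 2 - A)
    (hcond : ∀ w, 0 < w → hyperPhi b A N w * ((n + 2) * hyperPhi b A N w - 2 * (p - 2)) ≤
      4 * (w * deriv (hyperPhi b A N) w) * (1 + hyperPhi b A N w))
    {δ : EuclideanSpace ℝ (Fin p) × EuclideanSpace ℝ (Fin n) → EuclideanSpace ℝ (Fin p)}
    (hδ : Measurable δ) (h : δ =ᵐ[volume] shrinkageEstimator p n (hyperPhi b A N)) :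
    IsMinimax δ := by
  refine ⟨hδ, fun δ' hδ' => le_trans ?_ (le_maxRisk hδ')⟩
  have h' : δ =ᵐ[volume] fun y => (1 - hyperMean b A N (‖y.1‖ ^ 2 / ‖y.2‖ ^ 2)) • y.1 := by
    filter_upwards [h, ae_snd_ne_zero hn] with y h1 h2
    rw [h1, shrinkageEstimator_hyperPhi_eq b A N y h2]
  refine iSup_le fun θ => iSup_le fun v => iSup_le fun hv => ?_
  rw [risk_congr_ae h']
  obtain ⟨C, hC0, hC⟩ := hyperPhi_bounded hA hb hD
  have hmean : ∀ w, 0 ≤ w → 0 < hyperMean b A N w ∧ hyperMean b A N w < 1 := fun w hw =>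
    ⟨hyperMean_pos hA hb N (by linarith), hyperMean_lt_one hA hb N (by linarith)⟩
  refine risk_shrinkage_le (C := max 1 (max C (2 * |N|))) hp hn (measurable_hyperMean b A N) ?_ ?_
    (le_max_left _ _) (fun w hw => (hmean w hw).1.le) (fun w hw => (hmean w hw).2.le) ?_ ?_ ?_ hv θ
  · obtain ⟨m', h1, -⟩ := hasDerivAt_hyperMean hA hb N (show (-1 : ℝ) < 0 by norm_num)
    exact h1.continuousAt.continuousWithinAt
  · intro w hw
    obtain ⟨m', h1, -⟩ := hasDerivAt_hyperMean hA hb N (show -1 < w by linarith)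
    exact h1.differentiableAt
  · intro w hw
    rw [abs_of_nonneg (mul_nonneg hw (hmean w hw).1.le)]
    rcases hw.eq_or_lt with rfl | hw
    · rw [zero_mul]
      positivity
    · exact (hC w hw).trans ((le_max_left _ _).trans (le_max_right _ _))
  · intro w hw
    obtain ⟨m', h1, h2, -⟩ := hasDerivAt_hyperMean hA hb N (show -1 < w by linarith)
    rw [h1.deriv]
    exact (h2 hw).trans ((le_max_right _ _).trans (le_max_right _ _))
  · intro w hw
    obtain ⟨f', h1, h2, -⟩ := hasDerivAt_hyperPhi hA hb N hw
    have h3 := hcond w hw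
    rw [h1.deriv, h2] at h3
    unfold hyperPhi at h3
    refine le_of_mul_le_mul_left ?_ hw
    linarith

/-! ### The posterior under the hierarchical prior. -/

/-- The density of the hierarchical prior. -/
noncomputable def jointPriorDensity (p : ℕ) (a b e : ℝ) (t : EuclideanSpace ℝ (Fin p) × ℝ × ℝ) :
    ℝ :=
  isoNormalPDF p (t.2.1⁻¹ * (1 - t.2.2) * t.2.2⁻¹) t.1 * t.2.1 ^ e *
    (t.2.2 ^ a * (1 - t.2.2) ^ b)

/-- The joint density of `η`, `λ` and the data, with `θ` integrated out. -/
noncomputable def mixingDensity (p n : ℕ) (a b e : ℝ)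
    (y : EuclideanSpace ℝ (Fin p) × EuclideanSpace ℝ (Fin n)) (η t : ℝ) : ℝ :=
  isoNormalPDF p (η * t)⁻¹ y.1 * isoNormalPDF n η⁻¹ y.2 * η ^ e * (t ^ a * (1 - t) ^ b)

theorem measurable_isoNormalPDF_uncurry (d : ℕ) :
    Measurable fun q : ℝ × EuclideanSpace ℝ (Fin d) => isoNormalPDF d q.1 q.2 := by
  unfold isoNormalPDF
  fun_prop

theorem measurable_jointPriorDensity (p : ℕ) (a b e : ℝ) :
    Measurable (jointPriorDensity p a b e) := by
  have h := (measurable_isoNormalPDF_uncurry p).comp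
    (by fun_prop : Measurable fun t : EuclideanSpace ℝ (Fin p) × ℝ × ℝ =>
      (t.2.1⁻¹ * (1 - t.2.2) * t.2.2⁻¹, t.1))
  exact (h.mul (by fun_prop)).mul (by fun_prop)

theorem measurable_likelihood_param {p n : ℕ}
    (y : EuclideanSpace ℝ (Fin p) × EuclideanSpace ℝ (Fin n)) :
    Measurable fun t : EuclideanSpace ℝ (Fin p) × ℝ => likelihood p n t.1 t.2⁻¹ y := by
  have h1 := (measurable_isoNormalPDF_uncurry p).comp
    (by fun_prop : Measurable fun t : EuclideanSpace ℝ (Fin p) × ℝ => (t.2⁻¹, y.1 - t.1))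
  have h2 := (measurable_isoNormalPDF_uncurry n).comp
    (by fun_prop : Measurable fun t : EuclideanSpace ℝ (Fin p) × ℝ => (t.2⁻¹, y.2))
  exact h1.mul h2

/-- This order of integration makes the θ integral Gaussian and the η integral a Gamma integral,
leaving one over λ. -/
theorem lintegral_prior {p : ℕ} {a b e : ℝ} {f : EuclideanSpace ℝ (Fin p) × ℝ → ENNReal}
    (hf : Measurable f) :
    ∫⁻ t, f t ∂(prior p a b e) = ∫⁻ t in Ioo (0 : ℝ) 1, ∫⁻ η in Ioi (0 : ℝ), ∫⁻ θ,
      ENNReal.ofReal (jointPriorDensity p a b e (θ, η, t)) * f (θ, η) := by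
  have hd := (measurable_jointPriorDensity p a b e).ennreal_ofReal
  have hf' : Measurable fun t : EuclideanSpace ℝ (Fin p) × ℝ × ℝ => f (t.1, t.2.1) := by fun_prop
  have hprod : Measurable fun t : EuclideanSpace ℝ (Fin p) × ℝ × ℝ =>
      ENNReal.ofReal (jointPriorDensity p a b e t) * f (t.1, t.2.1) := hd.mul hf'
  unfold prior jointPrior
  rw [lintegral_map hf (by fun_prop)]
  change ∫⁻ t, f (t.1, t.2.1) ∂(Measure.withDensity _ fun t =>
    ENNReal.ofReal (jointPriorDensity p a b e t)) = _
  rw [lintegral_withDensity_eq_lintegral_mul _ hd hf', Measure.volume_eq_prod,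
    Measure.volume_eq_prod, ← Measure.prod_restrict, ← Measure.prod_restrict,
    Measure.restrict_univ]
  simp only [Pi.mul_apply]
  rw [lintegral_prod_symm' _ hprod, lintegral_prod_symm' _ hprod.lintegral_prod_left']

/-- Conjugacy: given η and λ, X is marginally N(0, (ηλ)⁻¹ I) and the posterior of θ is N((1-λ)x,
η⁻¹(1-λ) I). -/
theorem jointPriorDensity_mul_likelihood {p n : ℕ} {a b e η t : ℝ} (hη : 0 < η)
    (ht : t ∈ Ioo (0 : ℝ) 1) (y : EuclideanSpace ℝ (Fin p) × EuclideanSpace ℝ (Fin n))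
    (θ : EuclideanSpace ℝ (Fin p)) :
    jointPriorDensity p a b e (θ, η, t) * likelihood p n θ η⁻¹ y =
      mixingDensity p n a b e y η t *
        isoNormalPDF p (η⁻¹ * (1 - t)) (θ - (1 - t) • y.1) := by
  have h0 := ht.1
  have h1 : 0 < 1 - t := by linarith [ht.2]
  have h := isoNormalPDF_mul_isoNormalPDF (d := p) (v := η⁻¹) (τ := η⁻¹ * (1 - t) * t⁻¹)
    (by positivity) (by positivity) y.1 θ
  have e1 : η⁻¹ + η⁻¹ * (1 - t) * t⁻¹ = (η * t)⁻¹ := by field_simp; ring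
  have e2 : η⁻¹ * (η⁻¹ * (1 - t) * t⁻¹) / (η * t)⁻¹ = η⁻¹ * (1 - t) := by field_simp
  have e3 : η⁻¹ * (1 - t) * t⁻¹ / (η * t)⁻¹ = 1 - t := by field_simp
  rw [e1, e2, e3] at h
  unfold jointPriorDensity mixingDensity likelihood
  linear_combination (η ^ e * (t ^ a * (1 - t) ^ b) * isoNormalPDF n η⁻¹ y.2) * h

theorem mixingDensity_nonneg {p n : ℕ} {a b e η t : ℝ} (hη : 0 < η) (ht : t ∈ Ioo (0 : ℝ) 1)
    (y : EuclideanSpace ℝ (Fin p) × EuclideanSpace ℝ (Fin n)) :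
    0 ≤ mixingDensity p n a b e y η t := by
  have h0 := ht.1
  have h1 : 0 < 1 - t := by linarith [ht.2]
  have h2 := isoNormalPDF_pos (d := p) (v := (η * t)⁻¹) (by positivity) y.1
  have h3 := isoNormalPDF_pos (d := n) (v := η⁻¹) (by positivity) y.2
  unfold mixingDensity
  positivity

theorem jointPriorDensity_nonneg {p : ℕ} {a b e η t : ℝ} (hη : 0 < η) (ht : t ∈ Ioo (0 : ℝ) 1)
    (θ : EuclideanSpace ℝ (Fin p)) : 0 ≤ jointPriorDensity p a b e (θ, η, t) := by
  have h0 := ht.1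
  have h1 : 0 < 1 - t := by linarith [ht.2]
  have h2 := isoNormalPDF_pos (d := p) (v := η⁻¹ * (1 - t) * t⁻¹) (by positivity) θ
  unfold jointPriorDensity
  positivity

/-- The factor 0 · η + 1 is the case u₁ = 0, u₀ = 1 of the linear form u₁η + u₀ in `lintegral_eta`.
-/
theorem lintegral_theta_likelihood {p n : ℕ} {a b e η t : ℝ} (hη : 0 < η)
    (ht : t ∈ Ioo (0 : ℝ) 1) (y : EuclideanSpace ℝ (Fin p) × EuclideanSpace ℝ (Fin n)) :
    ∫⁻ θ, ENNReal.ofReal (jointPriorDensity p a b e (θ, η, t)) *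
      ENNReal.ofReal (likelihood p n θ η⁻¹ y) =
      ENNReal.ofReal ((0 * η + 1) * mixingDensity p n a b e y η t) := by
  have h1 : 0 < 1 - t := by linarith [ht.2]
  have hm : 0 < η⁻¹ * (1 - t) := by positivity
  simp_rw [fun θ => (ENNReal.ofReal_mul (q := likelihood p n θ η⁻¹ y)
    (jointPriorDensity_nonneg (a := a) (b := b) (e := e) hη ht θ)).symm,
    jointPriorDensity_mul_likelihood hη ht y,
    fun x => ENNReal.ofReal_mul (q := x)
      (mixingDensity_nonneg (a := a) (b := b) (e := e) hη ht y)]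
  rw [lintegral_const_mul' _ _ ENNReal.ofReal_ne_top, lintegral_isoNormalPDF hm]
  simp

/-- The loss is η‖d - θ‖²: its squared bias keeps the factor η, while in the variance term η cancels
against η⁻¹(1-λ). -/
theorem lintegral_theta_loss {p n : ℕ} {a b e η t : ℝ} (hη : 0 < η)
    (ht : t ∈ Ioo (0 : ℝ) 1) (y : EuclideanSpace ℝ (Fin p) × EuclideanSpace ℝ (Fin n))
    (d : EuclideanSpace ℝ (Fin p)) :
    ∫⁻ θ, ENNReal.ofReal (jointPriorDensity p a b e (θ, η, t)) *
      (ENNReal.ofReal (likelihood p n θ η⁻¹ y) * loss θ η⁻¹ d) =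
      ENNReal.ofReal ((‖d - (1 - t) • y.1‖ ^ 2 * η + p * (1 - t)) *
        mixingDensity p n a b e y η t) := by
  have h1 : 0 < 1 - t := by linarith [ht.2]
  have hm : 0 < η⁻¹ * (1 - t) := by positivity
  have hmix := mixingDensity_nonneg (a := a) (b := b) (e := e) hη ht y
  have e1 : ∀ θ, ENNReal.ofReal (jointPriorDensity p a b e (θ, η, t)) *
      (ENNReal.ofReal (likelihood p n θ η⁻¹ y) * loss θ η⁻¹ d) =
      ENNReal.ofReal (η * mixingDensity p n a b e y η t) * ENNReal.ofReal (‖d - θ‖ ^ 2 *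
        isoNormalPDF p (η⁻¹ * (1 - t)) (θ - (1 - t) • y.1)) := by
    intro θ
    unfold loss
    rw [← mul_assoc, ← ENNReal.ofReal_mul (jointPriorDensity_nonneg hη ht θ),
      jointPriorDensity_mul_likelihood hη ht y,
      ← ENNReal.ofReal_mul (mul_nonneg hmix (isoNormalPDF_pos hm _).le),
      ← ENNReal.ofReal_mul (mul_nonneg hη.le hmix)]
    congr 1
    rw [div_inv_eq_mul]
    ring
  simp_rw [e1]
  rw [lintegral_const_mul' _ _ ENNReal.ofReal_ne_top, lintegral_dist_sq_mul_isoNormalPDF hm,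
    ← ENNReal.ofReal_mul (mul_nonneg hη.le hmix)]
  congr 1
  field_simp

theorem lintegral_gamma {s r : ℝ} (hs : 0 < s) (hr : 0 < r) :
    ∫⁻ η in Ioi (0 : ℝ), ENNReal.ofReal (η ^ (s - 1) * Real.exp (-(r * η))) =
      ENNReal.ofReal ((1 / r) ^ s * Real.Gamma s) := by
  have h := Real.integral_rpow_mul_exp_neg_mul_Ioi hs hr
  have hint : IntegrableOn (fun η : ℝ => η ^ (s - 1) * Real.exp (-(r * η))) (Ioi 0) := by
    refine Integrable.of_integral_ne_zero ?_
    rw [h]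
    exact (mul_pos (Real.rpow_pos_of_pos (by positivity) _) (Real.Gamma_pos_of_pos hs)).ne'
  rw [← h, ofReal_integral_eq_lintegral_ofReal hint]
  filter_upwards [ae_restrict_mem measurableSet_Ioi] with η hη
  have hη' : (0 : ℝ) < η := hη
  positivity

theorem mixingDensity_eq {p n : ℕ} {a b e η t : ℝ} (hη : 0 < η) (ht : t ∈ Ioo (0 : ℝ) 1)
    (y : EuclideanSpace ℝ (Fin p) × EuclideanSpace ℝ (Fin n)) :
    mixingDensity p n a b e y η t =
      ((2 * Real.pi) ^ (-(p : ℝ) / 2) * (2 * Real.pi) ^ (-(n : ℝ) / 2)) *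
        (t ^ ((p : ℝ) / 2 + a) * (1 - t) ^ b) * (η ^ ((p : ℝ) / 2 + n / 2 + e) *
          Real.exp (-((t * ‖y.1‖ ^ 2 + ‖y.2‖ ^ 2) / 2 * η))) := by
  have h0 := ht.1
  have hpi := Real.pi_pos
  have e1 : (2 * Real.pi * (η * t)⁻¹) ^ (-(p : ℝ) / 2) =
      (2 * Real.pi) ^ (-(p : ℝ) / 2) * (η ^ ((p : ℝ) / 2) * t ^ ((p : ℝ) / 2)) := by
    rw [Real.mul_rpow (by positivity) (by positivity), Real.inv_rpow (by positivity),
      ← Real.rpow_neg (by positivity), Real.mul_rpow hη.le h0.le,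
      show -(-(p : ℝ) / 2) = (p : ℝ) / 2 by ring]
  have e2 : (2 * Real.pi * η⁻¹) ^ (-(n : ℝ) / 2) =
      (2 * Real.pi) ^ (-(n : ℝ) / 2) * η ^ ((n : ℝ) / 2) := by
    rw [Real.mul_rpow (by positivity) (by positivity), Real.inv_rpow hη.le,
      ← Real.rpow_neg hη.le, show -(-(n : ℝ) / 2) = (n : ℝ) / 2 by ring]
  have e3 : Real.exp (-((t * ‖y.1‖ ^ 2 + ‖y.2‖ ^ 2) / 2 * η)) =
      Real.exp (-‖y.1‖ ^ 2 / (2 * (η * t)⁻¹)) * Real.exp (-‖y.2‖ ^ 2 / (2 * η⁻¹)) := by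
    rw [← Real.exp_add]
    congr 1
    field_simp
    ring
  unfold mixingDensity isoNormalPDF
  rw [e1, e2, e3, Real.rpow_add hη, Real.rpow_add hη, Real.rpow_add h0]
  ring

/-- Integrating out `η`. -/
theorem lintegral_eta {p n : ℕ} {a b e : ℝ} (he : -(p : ℝ) / 2 - (n : ℝ) / 2 - 1 < e)
    (y : EuclideanSpace ℝ (Fin p) × EuclideanSpace ℝ (Fin n)) (hy : y.2 ≠ 0) :
    ∃ c₀ c₁ : ℝ, 0 < c₀ ∧ 0 < c₁ ∧ ∀ t ∈ Ioo (0 : ℝ) 1, ∀ u₀ u₁ : ℝ, 0 ≤ u₀ → 0 ≤ u₁ →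
      ∫⁻ η in Ioi (0 : ℝ), ENNReal.ofReal ((u₁ * η + u₀) * mixingDensity p n a b e y η t) =
      ENNReal.ofReal (c₁ * (u₁ * (t ^ ((p : ℝ) / 2 + a) * (1 - t) ^ b *
          (1 + ‖y.1‖ ^ 2 / ‖y.2‖ ^ 2 * t) ^ (-((p : ℝ) / 2 + n / 2 + e + 2)))) +
        c₀ * (u₀ * (t ^ ((p : ℝ) / 2 + a) * (1 - t) ^ b *
          (1 + ‖y.1‖ ^ 2 / ‖y.2‖ ^ 2 * t) ^ (-((p : ℝ) / 2 + n / 2 + e + 2 - 1))))) := by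
  set N : ℝ := (p : ℝ) / 2 + n / 2 + e + 2 with hN
  have hN1 : 0 < N - 1 := by rw [hN]; linarith
  have hpi := Real.pi_pos
  set κ : ℝ := (2 * Real.pi) ^ (-(p : ℝ) / 2) * (2 * Real.pi) ^ (-(n : ℝ) / 2) with hκ
  have hκ0 : 0 < κ := by positivity
  have hz : 0 < ‖y.2‖ := norm_pos_iff.2 hy
  have hS : 0 < ‖y.2‖ ^ 2 / 2 := by positivity
  -- In η the two terms are Gamma densities of shapes N and N - 1 with rate (‖z‖²/2)(1 + Wλ); `he`
  -- says that N - 1 > 0. The constants collect everything that does not depend on λ.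
  refine ⟨κ * (‖y.2‖ ^ 2 / 2) ^ (-(N - 1)) * Real.Gamma (N - 1),
    κ * (‖y.2‖ ^ 2 / 2) ^ (-N) * Real.Gamma N,
    mul_pos (by positivity) (Real.Gamma_pos_of_pos hN1),
    mul_pos (by positivity) (Real.Gamma_pos_of_pos (by linarith)),
    fun t ht u₀ u₁ hu₀ hu₁ => ?_⟩
  have h0 := ht.1
  have h1 : 0 < 1 - t := by linarith [ht.2]
  set r : ℝ := (t * ‖y.1‖ ^ 2 + ‖y.2‖ ^ 2) / 2 with hr
  have hr0 : 0 < r := by positivity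
  have hrS : r = ‖y.2‖ ^ 2 / 2 * (1 + ‖y.1‖ ^ 2 / ‖y.2‖ ^ 2 * t) := by
    rw [hr]; field_simp; ring
  have hW : 0 < 1 + ‖y.1‖ ^ 2 / ‖y.2‖ ^ 2 * t := by positivity
  have hpow : ∀ s : ℝ, (1 / r) ^ s = (‖y.2‖ ^ 2 / 2) ^ (-s) *
      (1 + ‖y.1‖ ^ 2 / ‖y.2‖ ^ 2 * t) ^ (-s) := by
    intro s
    rw [one_div, Real.inv_rpow hr0.le, ← Real.rpow_neg hr0.le, hrS, Real.mul_rpow hS.le hW.le]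
  set q : ℝ := t ^ ((p : ℝ) / 2 + a) * (1 - t) ^ b with hq
  have hq0 : 0 < q := by positivity
  have e1 : ∀ η ∈ Ioi (0 : ℝ), ENNReal.ofReal ((u₁ * η + u₀) * mixingDensity p n a b e y η t) =
      ENNReal.ofReal (κ * q * u₁) * ENNReal.ofReal (η ^ (N - 1) * Real.exp (-(r * η))) +
      ENNReal.ofReal (κ * q * u₀) * ENNReal.ofReal (η ^ (N - 1 - 1) * Real.exp (-(r * η))) := by
    intro η hη
    have hη' : (0 : ℝ) < η := hη
    rw [← ENNReal.ofReal_mul (by positivity), ← ENNReal.ofReal_mul (by positivity),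
      ← ENNReal.ofReal_add (by positivity) (by positivity), mixingDensity_eq hη' ht y]
    congr 1
    have e2 : η ^ (N - 1) = η ^ ((p : ℝ) / 2 + n / 2 + e) * η := by
      rw [← Real.rpow_add_one hη'.ne', hN]; ring_nf
    have e3 : N - 1 - 1 = (p : ℝ) / 2 + n / 2 + e := by rw [hN]; ring
    rw [e2, e3]
    ring
  rw [setLIntegral_congr_fun measurableSet_Ioi e1, lintegral_add_left (by fun_prop),
    lintegral_const_mul' _ _ ENNReal.ofReal_ne_top, lintegral_const_mul' _ _ ENNReal.ofReal_ne_top,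
    lintegral_gamma (by linarith) hr0, lintegral_gamma hN1 hr0,
    ← ENNReal.ofReal_mul (by positivity), ← ENNReal.ofReal_mul (by positivity),
    ← ENNReal.ofReal_add, hpow, hpow]
  · congr 1
    ring
  · have := Real.Gamma_pos_of_pos (show 0 < N by linarith)
    positivity
  · have := Real.Gamma_pos_of_pos hN1
    positivity

theorem rpow_mul_hyperWeight {b A N w t : ℝ} (ht : t ∈ Ioo (0 : ℝ) 1) :
    t * (t ^ A * (1 - t) ^ b * (1 + w * t) ^ (-N)) =
      t ^ (A + 1) * (1 - t) ^ b * (1 + w * t) ^ (-N) := by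
  rw [Real.rpow_add_one ht.1.ne']
  ring

/-- The weighted quadratic `‖d - (1 - λ) x‖²` splits into its minimum and a centred square. -/
theorem integral_dist_sq_mul_hyperWeight {p : ℕ} {b A w : ℝ} (hA : -1 < A) (hb : -1 < b) (N : ℝ)
    (hw : -1 < w) (x : EuclideanSpace ℝ (Fin p)) :
    (∀ d : EuclideanSpace ℝ (Fin p), IntegrableOn (fun t : ℝ => ‖d - (1 - t) • x‖ ^ 2 *
      (t ^ A * (1 - t) ^ b * (1 + w * t) ^ (-N))) (Ioo 0 1)) ∧
    ∃ R : ℝ, 0 ≤ R ∧ ∀ d : EuclideanSpace ℝ (Fin p), ∫ t in Ioo (0 : ℝ) 1,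
      ‖d - (1 - t) • x‖ ^ 2 * (t ^ A * (1 - t) ^ b * (1 + w * t) ^ (-N)) =
        R + hyperInt b A N w * ‖d - (1 - hyperMean b A N w) • x‖ ^ 2 := by
  have i0 := integrableOn_hyperWeight hA hb N hw
  have i1 := integrableOn_hyperWeight (A := A + 1) (by linarith) hb N hw
  have i2 := integrableOn_hyperWeight (A := A + 1 + 1) (by linarith) hb N hw
  have hsq : ∀ (d : EuclideanSpace ℝ (Fin p)) (t : ℝ), ‖d - (1 - t) • x‖ ^ 2 =
      ‖d - x‖ ^ 2 + 2 * (t * inner ℝ (d - x) x) + t ^ 2 * ‖x‖ ^ 2 := by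
    intro d t
    rw [show d - (1 - t) • x = (d - x) + t • x by module, norm_add_sq_real, inner_smul_right,
      norm_smul, mul_pow, Real.norm_eq_abs, sq_abs]
  have hexp : ∀ d : EuclideanSpace ℝ (Fin p), EqOn (fun t : ℝ => ‖d - (1 - t) • x‖ ^ 2 *
      (t ^ A * (1 - t) ^ b * (1 + w * t) ^ (-N)))
      (fun t => ‖d - x‖ ^ 2 * (t ^ A * (1 - t) ^ b * (1 + w * t) ^ (-N)) +
        2 * inner ℝ (d - x) x * (t ^ (A + 1) * (1 - t) ^ b * (1 + w * t) ^ (-N)) +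
        ‖x‖ ^ 2 * (t ^ (A + 1 + 1) * (1 - t) ^ b * (1 + w * t) ^ (-N))) (Ioo 0 1) := by
    intro d t ht
    simp only [← rpow_mul_hyperWeight ht, hsq]
    ring
  have i01 : ∀ d : EuclideanSpace ℝ (Fin p), IntegrableOn (fun t : ℝ =>
      ‖d - x‖ ^ 2 * (t ^ A * (1 - t) ^ b * (1 + w * t) ^ (-N)) +
        2 * inner ℝ (d - x) x * (t ^ (A + 1) * (1 - t) ^ b * (1 + w * t) ^ (-N))) (Ioo 0 1) :=
    fun d => (i0.const_mul _).add (i1.const_mul _)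
  have i012 : ∀ d : EuclideanSpace ℝ (Fin p), IntegrableOn (fun t : ℝ =>
      ‖d - x‖ ^ 2 * (t ^ A * (1 - t) ^ b * (1 + w * t) ^ (-N)) +
        2 * inner ℝ (d - x) x * (t ^ (A + 1) * (1 - t) ^ b * (1 + w * t) ^ (-N)) +
        ‖x‖ ^ 2 * (t ^ (A + 1 + 1) * (1 - t) ^ b * (1 + w * t) ^ (-N))) (Ioo 0 1) :=
    fun d => (i01 d).add (i2.const_mul _)
  have hint : ∀ d : EuclideanSpace ℝ (Fin p), ∫ t in Ioo (0 : ℝ) 1,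
      ‖d - (1 - t) • x‖ ^ 2 * (t ^ A * (1 - t) ^ b * (1 + w * t) ^ (-N)) =
        ‖d - x‖ ^ 2 * hyperInt b A N w + 2 * inner ℝ (d - x) x * hyperInt b (A + 1) N w +
          ‖x‖ ^ 2 * hyperInt b (A + 1 + 1) N w := by
    intro d
    rw [setIntegral_congr_fun measurableSet_Ioo (hexp d),
      integral_add (i01 d) (i2.const_mul _),
      integral_add (i0.const_mul _) (i1.const_mul _), integral_const_mul, integral_const_mul,
      integral_const_mul]
    rfl
  refine ⟨fun d => (i012 d).congr_fun (hexp d).symm measurableSet_Ioo, ?_⟩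
  refine ⟨∫ t in Ioo (0 : ℝ) 1, ‖(1 - hyperMean b A N w) • x - (1 - t) • x‖ ^ 2 *
    (t ^ A * (1 - t) ^ b * (1 + w * t) ^ (-N)), ?_, fun d => ?_⟩
  · exact setIntegral_nonneg measurableSet_Ioo fun t ht =>
      mul_nonneg (sq_nonneg _) (hyperWeight_pos b A N hw ht).le
  · rw [hint, hint, hsq, hyperInt_eq_mean_mul hA hb N hw,
      show (1 - hyperMean b A N w) • x - x = -(hyperMean b A N w • x) by module, norm_neg,
      inner_neg_left, inner_smul_left, real_inner_self_eq_norm_sq, norm_smul, mul_pow,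
      Real.norm_eq_abs, sq_abs]
    simp only [conj_trivial]
    ring

theorem marginal_prior {p n : ℕ} {a b e c₀ c₁ : ℝ} (ha : -1 < (p : ℝ) / 2 + a) (hb : -1 < b)
    (hc₀ : 0 < c₀) (y : EuclideanSpace ℝ (Fin p) × EuclideanSpace ℝ (Fin n))
    (hη : ∀ t ∈ Ioo (0 : ℝ) 1, ∀ u₀ u₁ : ℝ, 0 ≤ u₀ → 0 ≤ u₁ →
      ∫⁻ η in Ioi (0 : ℝ), ENNReal.ofReal ((u₁ * η + u₀) * mixingDensity p n a b e y η t) =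
      ENNReal.ofReal (c₁ * (u₁ * (t ^ ((p : ℝ) / 2 + a) * (1 - t) ^ b *
          (1 + ‖y.1‖ ^ 2 / ‖y.2‖ ^ 2 * t) ^ (-((p : ℝ) / 2 + n / 2 + e + 2)))) +
        c₀ * (u₀ * (t ^ ((p : ℝ) / 2 + a) * (1 - t) ^ b *
          (1 + ‖y.1‖ ^ 2 / ‖y.2‖ ^ 2 * t) ^ (-((p : ℝ) / 2 + n / 2 + e + 2 - 1)))))) :
    marginal (prior p a b e) y = ENNReal.ofReal (c₀ * hyperInt b ((p : ℝ) / 2 + a)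
      ((p : ℝ) / 2 + n / 2 + e + 2 - 1) (‖y.1‖ ^ 2 / ‖y.2‖ ^ 2)) := by
  have hW : (-1 : ℝ) < ‖y.1‖ ^ 2 / ‖y.2‖ ^ 2 := by
    have : 0 ≤ ‖y.1‖ ^ 2 / ‖y.2‖ ^ 2 := by positivity
    linarith
  have i0 := (integrableOn_hyperWeight ha hb ((p : ℝ) / 2 + n / 2 + e + 2 - 1) hW).const_mul c₀
  unfold marginal
  rw [lintegral_prior (measurable_likelihood_param y).ennreal_ofReal,
    setLIntegral_congr_fun measurableSet_Ioo fun t ht =>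
      (setLIntegral_congr_fun measurableSet_Ioi fun η hη' =>
        lintegral_theta_likelihood hη' ht y).trans (hη t ht 1 0 zero_le_one le_rfl)]
  simp only [zero_mul, mul_zero, zero_add, one_mul]
  rw [← ofReal_integral_eq_lintegral_ofReal i0, integral_const_mul]
  · rfl
  · filter_upwards [ae_restrict_mem measurableSet_Ioo] with t ht
    exact mul_nonneg hc₀.le (hyperWeight_pos b _ _ hW ht).le

/-- The action d occurs only in the term with the factor η, hence with exponent N and not N - 1.
This is why φ uses the density with exponent N, although the marginal density of the data uses N -
1. -/
theorem lintegral_likelihood_mul_loss_prior {p n : ℕ} {a b e c₀ c₁ : ℝ}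
    (ha : -1 < (p : ℝ) / 2 + a) (hb : -1 < b) (hc₀ : 0 < c₀) (hc₁ : 0 < c₁)
    (y : EuclideanSpace ℝ (Fin p) × EuclideanSpace ℝ (Fin n))
    (hη : ∀ t ∈ Ioo (0 : ℝ) 1, ∀ u₀ u₁ : ℝ, 0 ≤ u₀ → 0 ≤ u₁ →
      ∫⁻ η in Ioi (0 : ℝ), ENNReal.ofReal ((u₁ * η + u₀) * mixingDensity p n a b e y η t) =
      ENNReal.ofReal (c₁ * (u₁ * (t ^ ((p : ℝ) / 2 + a) * (1 - t) ^ b *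
          (1 + ‖y.1‖ ^ 2 / ‖y.2‖ ^ 2 * t) ^ (-((p : ℝ) / 2 + n / 2 + e + 2)))) +
        c₀ * (u₀ * (t ^ ((p : ℝ) / 2 + a) * (1 - t) ^ b *
          (1 + ‖y.1‖ ^ 2 / ‖y.2‖ ^ 2 * t) ^ (-((p : ℝ) / 2 + n / 2 + e + 2 - 1)))))) :
    ∃ Q : ℝ, 0 ≤ Q ∧ ∀ d : EuclideanSpace ℝ (Fin p),
      ∫⁻ t, ENNReal.ofReal (likelihood p n t.1 t.2⁻¹ y) * loss t.1 t.2⁻¹ d ∂(prior p a b e) =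
      ENNReal.ofReal (Q + c₁ * hyperInt b ((p : ℝ) / 2 + a) ((p : ℝ) / 2 + n / 2 + e + 2)
        (‖y.1‖ ^ 2 / ‖y.2‖ ^ 2) * ‖d - (1 - hyperMean b ((p : ℝ) / 2 + a)
          ((p : ℝ) / 2 + n / 2 + e + 2) (‖y.1‖ ^ 2 / ‖y.2‖ ^ 2)) • y.1‖ ^ 2) := by
  have hW : (-1 : ℝ) < ‖y.1‖ ^ 2 / ‖y.2‖ ^ 2 := by
    have : 0 ≤ ‖y.1‖ ^ 2 / ‖y.2‖ ^ 2 := by positivity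
    linarith
  set W := ‖y.1‖ ^ 2 / ‖y.2‖ ^ 2
  set N : ℝ := (p : ℝ) / 2 + n / 2 + e + 2
  set A : ℝ := (p : ℝ) / 2 + a
  have i0 := integrableOn_hyperWeight ha hb (N - 1) hW
  have i1 := integrableOn_hyperWeight (A := A + 1) (by linarith) hb (N - 1) hW
  obtain ⟨hint, R, hR, hquad⟩ := integral_dist_sq_mul_hyperWeight ha hb N hW y.1
  have hq : IntegrableOn (fun t : ℝ => p * (1 - t) * (t ^ A * (1 - t) ^ b *
      (1 + W * t) ^ (-(N - 1)))) (Ioo 0 1) := by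
    have h : IntegrableOn (fun t : ℝ => p * (t ^ A * (1 - t) ^ b * (1 + W * t) ^ (-(N - 1)) -
      t ^ (A + 1) * (1 - t) ^ b * (1 + W * t) ^ (-(N - 1)))) (Ioo 0 1) :=
      (i0.sub i1).const_mul (p : ℝ)
    refine h.congr_fun (fun t ht => ?_) measurableSet_Ioo
    simp only [← rpow_mul_hyperWeight ht]
    ring
  have hq0 : ∀ t ∈ Ioo (0 : ℝ) 1, 0 ≤ p * (1 - t) * (t ^ A * (1 - t) ^ b *
      (1 + W * t) ^ (-(N - 1))) := fun t ht =>
    mul_nonneg (mul_nonneg p.cast_nonneg (by linarith [ht.2])) (hyperWeight_pos b _ _ hW ht).le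
  refine ⟨c₁ * R + c₀ * ∫ t in Ioo (0 : ℝ) 1, p * (1 - t) * (t ^ A * (1 - t) ^ b *
      (1 + W * t) ^ (-(N - 1))),
    add_nonneg (mul_nonneg hc₁.le hR)
      (mul_nonneg hc₀.le (setIntegral_nonneg measurableSet_Ioo hq0)), fun d => ?_⟩
  have hmeas : Measurable fun t : EuclideanSpace ℝ (Fin p) × ℝ => loss t.1 t.2⁻¹ d := by
    unfold loss
    fun_prop
  have hmeas' : Measurable fun t : EuclideanSpace ℝ (Fin p) × ℝ =>
      ENNReal.ofReal (likelihood p n t.1 t.2⁻¹ y) * loss t.1 t.2⁻¹ d :=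
    (measurable_likelihood_param y).ennreal_ofReal.mul hmeas
  have hsum : IntegrableOn (fun t : ℝ =>
      c₁ * (‖d - (1 - t) • y.1‖ ^ 2 * (t ^ A * (1 - t) ^ b * (1 + W * t) ^ (-N))) +
        c₀ * (p * (1 - t) * (t ^ A * (1 - t) ^ b * (1 + W * t) ^ (-(N - 1))))) (Ioo 0 1) :=
    ((hint d).const_mul c₁).add (hq.const_mul c₀)
  rw [lintegral_prior hmeas',
    setLIntegral_congr_fun measurableSet_Ioo fun t ht =>
      (setLIntegral_congr_fun measurableSet_Ioi fun η hη' =>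
        lintegral_theta_loss hη' ht y d).trans (hη t ht (p * (1 - t)) (‖d - (1 - t) • y.1‖ ^ 2)
          (mul_nonneg p.cast_nonneg (by linarith [ht.2])) (sq_nonneg _)),
    ← ofReal_integral_eq_lintegral_ofReal hsum,
    integral_add ((hint d).const_mul c₁) (hq.const_mul c₀), integral_const_mul,
    integral_const_mul, hquad]
  · congr 1
    ring
  · filter_upwards [ae_restrict_mem measurableSet_Ioo] with t ht
    exact add_nonneg (mul_nonneg hc₁.le
      (mul_nonneg (sq_nonneg _) (hyperWeight_pos b _ _ hW ht).le))
      (mul_nonneg hc₀.le (hq0 t ht))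

theorem posteriorLoss_eq {p n : ℕ} (π : Measure (EuclideanSpace ℝ (Fin p) × ℝ))
    (y : EuclideanSpace ℝ (Fin p) × EuclideanSpace ℝ (Fin n)) (d : EuclideanSpace ℝ (Fin p)) :
    posteriorLoss π y d = (marginal π y)⁻¹ *
      ∫⁻ t, ENNReal.ofReal (likelihood p n t.1 t.2⁻¹ y) * loss t.1 t.2⁻¹ d ∂π := by
  have hmeas : Measurable fun t : EuclideanSpace ℝ (Fin p) × ℝ => loss t.1 t.2⁻¹ d := by
    unfold loss
    fun_prop
  unfold posteriorLoss posterior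
  rw [lintegral_smul_measure, smul_eq_mul, lintegral_withDensity_eq_lintegral_mul _
    (measurable_likelihood_param y).ennreal_ofReal hmeas]
  rfl

/-- The posterior is proper and the posterior loss is a quadratic function of the action. -/
theorem posteriorLoss_prior {p n : ℕ} {a b e : ℝ} (ha : -1 < (p : ℝ) / 2 + a) (hb : -1 < b)
    (he : -(p : ℝ) / 2 - (n : ℝ) / 2 - 1 < e)
    (y : EuclideanSpace ℝ (Fin p) × EuclideanSpace ℝ (Fin n)) (hy : y.2 ≠ 0) :
    marginal (prior p a b e) y ≠ 0 ∧ marginal (prior p a b e) y ≠ ⊤ ∧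
    ∃ Q c : ℝ, 0 ≤ Q ∧ 0 < c ∧ ∀ d : EuclideanSpace ℝ (Fin p),
      posteriorLoss (prior p a b e) y d = ENNReal.ofReal
        (Q + c * ‖d - shrinkageEstimator p n (phi p n a b e) y‖ ^ 2) := by
  obtain ⟨c₀, c₁, hc₀, hc₁, hη⟩ := lintegral_eta (a := a) (b := b) he y hy
  have hW : (-1 : ℝ) < ‖y.1‖ ^ 2 / ‖y.2‖ ^ 2 := by
    have : 0 ≤ ‖y.1‖ ^ 2 / ‖y.2‖ ^ 2 := by positivity
    linarith
  have hm := marginal_prior ha hb hc₀ y hη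
  obtain ⟨Q, hQ, hl⟩ := lintegral_likelihood_mul_loss_prior ha hb hc₀ hc₁ y hη
  have hm0 := mul_pos hc₀ (hyperInt_pos ha hb ((p : ℝ) / 2 + n / 2 + e + 2 - 1) hW)
  have hK := mul_pos hc₁ (hyperInt_pos ha hb ((p : ℝ) / 2 + n / 2 + e + 2) hW)
  rw [phi_eq_hyperPhi, shrinkageEstimator_hyperPhi_eq _ _ _ _ hy]
  simp only [posteriorLoss_eq, hm, hl]
  refine ⟨(ENNReal.ofReal_pos.2 hm0).ne', ENNReal.ofReal_ne_top, _, _,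
    mul_nonneg (inv_pos.2 hm0).le hQ, mul_pos (inv_pos.2 hm0) hK, fun d => ?_⟩
  rw [← ENNReal.ofReal_inv_of_pos hm0, ← ENNReal.ofReal_mul (inv_pos.2 hm0).le]
  congr 1
  ring

theorem isGeneralizedBayes_shrinkageEstimator {p n : ℕ} (hn : 1 ≤ n) {a b e : ℝ}
    (ha : -1 < (p : ℝ) / 2 + a) (hb : -1 < b) (he : -(p : ℝ) / 2 - (n : ℝ) / 2 - 1 < e) :
    IsGeneralizedBayes (prior p a b e) (shrinkageEstimator p n (phi p n a b e)) := by
  refine ⟨measurable_shrinkageEstimator ?_, ?_⟩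
  · rw [phi_eq_hyperPhi]
    exact measurable_id.mul (measurable_hyperMean _ _ _)
  · filter_upwards [ae_snd_ne_zero hn] with y hy
    obtain ⟨h0, h1, Q, c, hQ, hc, h⟩ := posteriorLoss_prior ha hb he y hy
    refine ⟨h0, h1, by rw [h]; exact ENNReal.ofReal_ne_top, fun d => ?_⟩
    rw [h, h, sub_self, norm_zero]
    exact ENNReal.ofReal_le_ofReal (by
      have := mul_nonneg hc.le (sq_nonneg ‖d - shrinkageEstimator p n (phi p n a b e) y‖)
      simpa using this)

/-- The posterior loss is a quadratic in d with positive leading coefficient, so a minimizer must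
coincide with its centre. -/
theorem IsGeneralizedBayes.ae_eq_shrinkageEstimator {p n : ℕ} (hn : 1 ≤ n) {a b e : ℝ}
    (ha : -1 < (p : ℝ) / 2 + a) (hb : -1 < b) (he : -(p : ℝ) / 2 - (n : ℝ) / 2 - 1 < e)
    {δ : EuclideanSpace ℝ (Fin p) × EuclideanSpace ℝ (Fin n) → EuclideanSpace ℝ (Fin p)}
    (hδ : IsGeneralizedBayes (prior p a b e) δ) :
    δ =ᵐ[volume] shrinkageEstimator p n (phi p n a b e) := by
  filter_upwards [ae_snd_ne_zero hn, hδ.2] with y hy hmin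
  obtain ⟨-, -, Q, c, hQ, hc, h⟩ := posteriorLoss_prior ha hb he y hy
  have hle := hmin.2.2.2 (shrinkageEstimator p n (phi p n a b e) y)
  rw [h, h, sub_self, norm_zero, ENNReal.ofReal_le_ofReal_iff (by simpa using hQ)] at hle
  have hsq : c * ‖δ y - shrinkageEstimator p n (phi p n a b e) y‖ ^ 2 ≤ 0 := by
    simpa using hle
  have hz : ‖δ y - shrinkageEstimator p n (phi p n a b e) y‖ ^ 2 = 0 :=
    le_antisymm (nonpos_of_mul_nonpos_right hsq hc) (sq_nonneg _)
  exact sub_eq_zero.1 (norm_eq_zero.1 (pow_eq_zero_iff two_ne_zero |>.1 hz))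

end GenBayes

/-! ### Translation of the parameter conditions. -/

open GenBayes in
theorem mainTheorem3 (p n : ℕ) (hp : 3 ≤ p) (hn : 1 ≤ n) (a b e : ℝ)
    (he : -(p : ℝ) / 2 - (n : ℝ) / 2 - 1 < e) :
    (-(p : ℝ) / 2 - 1 < a →
      a ≤ (cBound p n * ((n : ℝ) / 2 + e) - (p : ℝ) / 2 - 1) / (1 + cBound p n) →
      min ((n : ℝ) / 2 + e - a - 1) 0 ≤ b →
        IsGeneralizedBayes (prior p a b e) (shrinkageEstimator p n (phi p n a b e)) ∧
        (∀ δ : EuclideanSpace ℝ (Fin p) × EuclideanSpace ℝ (Fin n) → EuclideanSpace ℝ (Fin p),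
          IsGeneralizedBayes (prior p a b e) δ →
            δ =ᵐ[MeasureTheory.volume] shrinkageEstimator p n (phi p n a b e) ∧ IsMinimax δ) ∧
        MonotoneOn (phi p n a b e) (Set.Ioi 0)) ∧
    (-(p : ℝ) / 2 - 1 < a →
      a < (cBound p n * ((n : ℝ) / 2 + e) - (p : ℝ) / 2 - 1) / (1 + cBound p n) →
      -((n : ℝ) + 2) * ((cBound p n - alpha p n a e) /
          (4 * ((p : ℝ) + a + 1) * (alpha p n a e + 1))) ≤ b →
      b < min 0 ((n : ℝ) / 2 + e - a - 1) →
        -1 < -((n : ℝ) + 2) * ((cBound p n - alpha p n a e) /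
          (4 * ((p : ℝ) + a + 1) * (alpha p n a e + 1))) ∧
        IsGeneralizedBayes (prior p a b e) (shrinkageEstimator p n (phi p n a b e)) ∧
        (∀ δ : EuclideanSpace ℝ (Fin p) × EuclideanSpace ℝ (Fin n) → EuclideanSpace ℝ (Fin p),
          IsGeneralizedBayes (prior p a b e) δ →
            δ =ᵐ[MeasureTheory.volume] shrinkageEstimator p n (phi p n a b e) ∧ IsMinimax δ) ∧
        Filter.Tendsto (phi p n a b e) Filter.atTop (nhds (alpha p n a e)) ∧
        ¬ MonotoneOn (phi p n a b e) (Set.Ioi 0) ∧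
        ¬ AntitoneOn (phi p n a b e) (Set.Ioi 0)) := by
  have hp3 : (3 : ℝ) ≤ p := by exact_mod_cast hp
  have hn1 : (1 : ℝ) ≤ n := by exact_mod_cast hn
  have hn2 : (0 : ℝ) < (n : ℝ) + 2 := by linarith
  have hc : 0 < cBound p n := div_pos (by linarith) hn2
  have hnc : ((n : ℝ) + 2) * cBound p n = 2 * ((p : ℝ) - 2) := mul_div_cancel₀ _ hn2.ne'
  have hND : (p : ℝ) / 2 + n / 2 + e + 2 - 2 - ((p : ℝ) / 2 + a) = n / 2 + e - a := by ring
  have hND' : (p : ℝ) / 2 + n / 2 + e + 2 - 3 - ((p : ℝ) / 2 + a) = n / 2 + e - a - 1 := by ring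
  refine ⟨fun ha1 ha2 hb => ?_, fun ha1 ha2 hb1 hb2 => ?_⟩
  · have hA : -1 < (p : ℝ) / 2 + a := by linarith
    rw [le_div_iff₀ (by linarith)] at ha2
    -- The upper bound on a is the statement α ≤ c with denominators cleared, and it forces n/2 + e
    -- - a > 0.
    have hle : (p : ℝ) / 2 + a + 1 ≤ cBound p n * (n / 2 + e - a) := by linarith
    have hD : 0 < (n : ℝ) / 2 + e - a := pos_of_mul_pos_right (by linarith) hc.le
    have hb' : -1 < b := lt_of_lt_of_le (lt_min (by linarith) (by norm_num)) hb
    refine ⟨isGeneralizedBayes_shrinkageEstimator hn hA hb' he, fun δ hδ => ?_, ?_⟩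
    · have hae := hδ.ae_eq_shrinkageEstimator hn hA hb' he
      refine ⟨hae, ?_⟩
      rw [phi_eq_hyperPhi] at hae
      refine isMinimax_of_ae_eq (by omega) hn hA hb' (by rwa [hND]) (fun w hw => ?_) hδ.1 hae
      have h := minimax_condition_of_monotone (c := cBound p n) hA hb' (by rwa [hND]) hn2
        (by rw [hND, div_le_iff₀ hD]; exact hle)
        (monotoneOn_hyperPhi hA hb' (by rwa [hND'])) hw
      refine le_trans (le_of_eq ?_) h
      rw [← hnc]
      ring
    · rw [phi_eq_hyperPhi]
      exact monotoneOn_hyperPhi hA hb' (by rwa [hND'])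
  · have hA : -1 < (p : ℝ) / 2 + a := by linarith
    rw [lt_div_iff₀ (by linarith)] at ha2
    have hlt : (p : ℝ) / 2 + a + 1 < cBound p n * (n / 2 + e - a) := by linarith
    have hD : 0 < (n : ℝ) / 2 + e - a := pos_of_mul_pos_right (by linarith) hc.le
    have hα : 0 < alpha p n a e := div_pos (by linarith) hD
    have hden : 0 < 4 * ((p : ℝ) + a + 1) * (alpha p n a e + 1) :=
      mul_pos (by linarith) (by linarith)
    have hlow : -1 < -((n : ℝ) + 2) * ((cBound p n - alpha p n a e) /
        (4 * ((p : ℝ) + a + 1) * (alpha p n a e + 1))) := by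
      -- After clearing denominators: (n+2)c = 2(p-2), while 4(p+a+1) > 2p because a > -p/2 - 1.
      rw [neg_mul, neg_lt_neg_iff, ← mul_div_assoc, div_lt_one hden, mul_sub, hnc]
      nlinarith [mul_pos hn2 hα, mul_pos (show 0 < (p : ℝ) + a + 1 by linarith) hα]
    have hb' : -1 < b := hlow.trans_le hb1
    have hb0 : b < 0 := hb2.trans_le (min_le_left _ _)
    have hbD : b < (n : ℝ) / 2 + e - a - 1 := hb2.trans_le (min_le_right _ _)
    have hαA : ((p : ℝ) / 2 + a + 1) / ((p : ℝ) / 2 + n / 2 + e + 2 - 2 - ((p : ℝ) / 2 + a)) =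
        alpha p n a e := by rw [hND, alpha]
    refine ⟨hlow, isGeneralizedBayes_shrinkageEstimator hn hA hb' he, fun δ hδ => ?_, ?_, ?_, ?_⟩
    · have hae := hδ.ae_eq_shrinkageEstimator hn hA hb' he
      refine ⟨hae, ?_⟩
      rw [phi_eq_hyperPhi] at hae
      refine isMinimax_of_ae_eq (by omega) hn hA hb' (by rwa [hND]) (fun w hw => ?_) hδ.1 hae
      -- With h = p/2 - 1, 4h = 2(p-2) = (n+2)c and h + A + 2 = p + a + 1, so the required condition
      -- is the lower bound on b.
      have h := minimax_condition_of_neg (ν := (n : ℝ) + 2) (h := (p : ℝ) / 2 - 1) hA hb' hb0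
        (N := (p : ℝ) / 2 + n / 2 + e + 2) (by linarith) hn2 (by linarith) (by
          rw [hαA]
          rw [neg_mul, ← mul_div_assoc, neg_le, le_div_iff₀ hden] at hb1
          rw [mul_sub, hnc] at hb1
          linarith) hw
      refine le_trans (le_of_eq ?_) h
      ring
    · rw [phi_eq_hyperPhi, ← hαA]
      exact tendsto_hyperPhi hA hb' (by rwa [hND])
    · rw [phi_eq_hyperPhi]
      exact not_monotoneOn_hyperPhi hA hb' hb0 (by linarith)
    · rw [phi_eq_hyperPhi]
      exact not_antitoneOn_hyperPhi hA hb' _
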